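/- Let $(r,\phi,z)$ be cylindrical coordinates in $\mathbb{R}^3$ with unit vectors $e_r,e_\phi,e_z$. Let $\Omega\subset\{(r,z): r>0\}$ be a bounded simply connected domain with $\overline\Omega\subset\{r>0\}$, whose boundary is a regular real-analytic simple closed curve, and let $T=\{x\in\mathbb{R}^3 : (r(x),z(x))\in\Omega\}$ be the axisymmetric toroidal domain with cross-section $\Omega$. Let $u,B$ be vector fields and $p$ a function, all real analytic up to the boundary of $T$, forming a fixed-boundary steady solution of ideal incompressible MHD: $$u\cdot\nabla u-B\cdot\nabla B=-\nabla p,\quad u\cdot\nabla B-B\cdot\nabla u=0,\quad \nabla\cdot B=0,\quad \nabla\cdot u=0\quad\text{in }T,$$ $$u\cdot\hat n=B\cdot\hat n=0\quad\text{on }\partial T.$$ Suppose that this solution has the axisymmetric form, on $\overline T$, $$B=\tfrac1r C(A)e_\phi+\tfrac1r e_\phi\times\nabla A,\qquad u=\tfrac1r F(\psi)e_\phi+\tfrac1r e_\phi\times\nabla\psi,\qquad \psi=G(A),\qquad p+\tfrac12|u|^2-\tfrac12|B|^2=P(A),$$ where $A=A(r,z)$ is real analytic up to the boundary of $\Omega$,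 $A=0$ on $\partial\Omega$, and $C,F,G,P:\mathbb{R}\to\mathbb{R}$ are functions with $G$ differentiable at every value taken by $A$ on $\overline\Omega$. Put $H(a,r)=P(a)-\frac{1}{2r^2}F(G(a))^2+\frac1{2r^2}C(a)^2$ and let $n$ be the unit normal to $\partial\Omega$ in the $(r,z)$-plane. Suppose that $$(1-|G'(0)|^2)\,|\partial_nA|^2>-2r^2H(0,r)\qquad\text{on }\partial\Omega$$ (for $|G'(0)|<1$ this says $|\partial_nA|^2>-\frac{2r^2H(0,r)}{1-|G'(0)|^2}$). Then there is an external magnetic field $B_{\mathsf{ext}}$, generated by a toroidal current sheet, which makes $(u,B,T)$ a free-boundary equilibrium. That is, there are a bounded domain $\Omega'$ with $\overline{\Omega}\subset\Omega'$ and $\overline{\Omega'}\subset\{r>0\}$, whose boundary is a smooth regular simple closed curve generating a toroidal surface $T'$ by rotation about the axis; a continuous function $j:\partial\Omega'\to\mathbb{R}$; and a field $B_{\mathsf{ext}}$ on $\mathbb{R}^3\setminus T$, continuous on $(\mathbb{R}^3\setminus T)\setminus T'$ (in particular up to $\partial T$) and locally integrable in $\mathbb{R}^3\setminus\overline T$,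 such that $$\operatorname{curl}B_{\mathsf{ext}}=j\,e_\phi\,\delta_{T'},\quad \nabla\cdot B_{\mathsf{ext}}=0\quad\text{in the sense of distributions in }\mathbb{R}^3\setminus\overline T,\qquad B_{\mathsf{ext}}(x)\to0\text{ as }|x|\to\infty,$$ $$p=\tfrac12|B_{\mathsf{ext}}|^2,\qquad B_{\mathsf{ext}}\cdot\hat n=0=B\cdot\hat n,\qquad u\cdot\hat n=0\qquad\text{on }\partial T.$$ -/

import Mathlib

open Set Filter Topology MeasureTheory
open scoped ContDiff Gradient Matrix

noncomputable section

namespace AxiMHD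

/-- The plane of the coordinates `(r, z)`: `q 0 = r`, `q 1 = z`. -/
abbrev E2 : Type := EuclideanSpace ℝ (Fin 2)

/-- Physical space, with Cartesian coordinates `(x 0, x 1, x 2)`; the axis is the `x 2`-axis. -/
abbrev E3 : Type := EuclideanSpace ℝ (Fin 3)

/-! ### Cylindrical coordinates -/

/-- Distance to the axis. -/
def radius (x : E3) : ℝ := Real.sqrt (x 0 ^ 2 + x 1 ^ 2)

/-- The coordinates `(r, z)` of a point of space. -/
def cyl (x : E3) : E2 := !₂[radius x, x 2]

/-- The point of space with cylindrical coordinates `(r, θ, z) = (q 0, θ, q 1)`. -/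
def rotPoint (θ : ℝ) (q : E2) : E3 := !₂[q 0 * Real.cos θ, q 0 * Real.sin θ, q 1]

/-- The unit vector `e_r`. -/
def eR (x : E3) : E3 := (radius x)⁻¹ • !₂[x 0, x 1, 0]

/-- The unit vector `e_φ`. -/
def ePhi (x : E3) : E3 := (radius x)⁻¹ • !₂[-x 1, x 0, 0]

/-- The unit vector `e_z`. -/
def eZ : E3 := !₂[0, 0, 1]

/-- The axisymmetric set whose cross-section is `Ω`. -/
def torus (Ω : Set E2) : Set E3 := {x | cyl x ∈ Ω}

/-! ### Vector calculus in space -/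

/-- The cross product. -/
def cross (v w : E3) : E3 := WithLp.toLp 2 (v.ofLp ⨯₃ w.ofLp)

/-- The partial derivative `∂ᵢ vₖ`. -/
def pd (v : E3 → E3) (i k : Fin 3) (x : E3) : ℝ :=
  (fderiv ℝ v x (EuclideanSpace.single i 1)) k

/-- The divergence. -/
def divg (v : E3 → E3) (x : E3) : ℝ := ∑ i, pd v i i x

/-- The curl. -/
def curl (v : E3 → E3) (x : E3) : E3 :=
  !₂[pd v 1 2 x - pd v 2 1 x, pd v 2 0 x - pd v 0 2 x, pd v 0 1 x - pd v 1 0 x]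

/-- The directional derivative `v · ∇ w`. -/
def advect (v w : E3 → E3) (x : E3) : E3 := fderiv ℝ w x (v x)

/-! ### Cross-sections and their boundary -/

/-- `Ω` is a bounded domain whose closure lies in the open half-plane `r > 0` and whose boundary is
the simple closed regular curve `γ`, of period `1` and of class `C^n` (`n = ω`: real analytic).
Then `torus Ω` is the toroidal domain with cross-section `Ω`. -/
structure IsCrossSection (n : WithTop ℕ∞) (Ω : Set E2) (γ : ℝ → E2) : Prop where
  isOpen : IsOpen Ω
  isConnected : IsConnected Ω
  isBounded : Bornology.IsBounded Ω
  off_axis : ∀ q ∈ closure Ω, 0 < q 0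
  contDiff : ContDiff ℝ n γ
  periodic : Function.Periodic γ 1
  injOn : InjOn γ (Ico 0 1)
  regular : ∀ s, deriv γ s ≠ 0
  frontier_eq : frontier Ω = range γ

/-- The unit normal to the curve `γ` in the plane, at `γ s`. Whether it is the outward or the inward
one depends on the orientation of `γ`; it is only used in conditions that do not depend on its
sign. -/
def normal2 (γ : ℝ → E2) (s : ℝ) : E2 :=
  ‖deriv γ s‖⁻¹ • !₂[deriv γ s 1, -(deriv γ s 0)]

/-- The unit normal to the surface of revolution generated by `γ`, at a point `x` over `γ s`. -/
def normal3 (γ : ℝ → E2) (s : ℝ) (x : E3) : E3 :=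
  (normal2 γ s 0) • eR x + (normal2 γ s 1) • eZ

/-- The vector field `v` is tangent to the boundary of `torus Ω`: `v · n = 0` there. Here `γ` is
the boundary curve of `Ω`. -/
def TangentToBoundary (Ω : Set E2) (γ : ℝ → E2) (v : E3 → E3) : Prop :=
  ∀ x ∈ frontier (torus Ω), ∀ s, cyl x = γ s → inner ℝ (v x) (normal3 γ s x) = 0

/-! ### Equilibria -/

/-- The equations of steady ideal incompressible magnetohydrodynamics in `T`. -/
structure IsSteadyMHD (T : Set E3) (u B : E3 → E3) (p : E3 → ℝ) : Prop where
  momentum : ∀ x ∈ T, advect u u x - advect B B x = -∇ p x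
  induction : ∀ x ∈ T, advect u B x - advect B u x = 0
  div_B : ∀ x ∈ T, divg B x = 0
  div_u : ∀ x ∈ T, divg u x = 0

/-- An analytic fixed boundary steady solution in the toroidal domain with cross-section `Ω`;
the fields and the pressure are analytic up to the boundary. -/
structure IsAnalyticFixedBoundarySolution (Ω : Set E2) (γ : ℝ → E2) (u B : E3 → E3)
    (p : E3 → ℝ) : Prop where
  analytic_u : AnalyticOnNhd ℝ u (closure (torus Ω))
  analytic_B : AnalyticOnNhd ℝ B (closure (torus Ω))
  analytic_p : AnalyticOnNhd ℝ p (closure (torus Ω))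
  steady : IsSteadyMHD (torus Ω) u B p
  tangent_u : TangentToBoundary Ω γ u
  tangent_B : TangentToBoundary Ω γ B

/-- The axisymmetric fields `B = r⁻¹ C(A) e_φ + r⁻¹ e_φ × ∇A`, `u = r⁻¹ F(ψ) e_φ + r⁻¹ e_φ × ∇ψ` with
`ψ = G(A)`, `A = A(r, z)` vanishing on the boundary, and whose Bernoulli function
`p + |u|²/2 - |B|²/2` is `P(A)`. -/
structure HasGradShafranovForm (Ω : Set E2) (A : E2 → ℝ) (C F G P : ℝ → ℝ) (u B : E3 → E3)
    (p : E3 → ℝ) : Prop where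
  analytic_A : AnalyticOnNhd ℝ A (closure Ω)
  boundary_A : ∀ q ∈ frontier Ω, A q = 0
  differentiable_G : ∀ q ∈ closure Ω, DifferentiableAt ℝ G (A q)
  form_B : ∀ x ∈ closure (torus Ω), B x =
    ((radius x)⁻¹ * C (A (cyl x))) • ePhi x
      + (radius x)⁻¹ • cross (ePhi x) (∇ (fun y => A (cyl y)) x)
  form_u : ∀ x ∈ closure (torus Ω), u x =
    ((radius x)⁻¹ * F (G (A (cyl x)))) • ePhi x
      + (radius x)⁻¹ • cross (ePhi x) (∇ (fun y => G (A (cyl y))) x)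
  bernoulli : ∀ x ∈ closure (torus Ω),
    p x + ‖u x‖ ^ 2 / 2 - ‖B x‖ ^ 2 / 2 = P (A (cyl x))

/-- `H(a, r) = P(a) - F(G(a))² / (2r²) + C(a)² / (2r²)`. -/
def bigH (C F G P : ℝ → ℝ) (a r : ℝ) : ℝ :=
  P a - F (G a) ^ 2 / (2 * r ^ 2) + C a ^ 2 / (2 * r ^ 2)

/-- The integral of `j e_φ · v` over the surface of revolution generated by `Γ`, whose area element
is `r dθ |Γ'(s)| ds`. -/
def sheetIntegral (Γ : ℝ → E2) (j : E2 → ℝ) (v : E3 → E3) : ℝ :=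
  ∫ s in (0 : ℝ)..1, ∫ θ in (0 : ℝ)..(2 * Real.pi),
    j (Γ s) * inner ℝ (ePhi (rotPoint θ (Γ s))) (v (rotPoint θ (Γ s)))
      * (Γ s 0 * ‖deriv Γ s‖)

/-- `Bext` is a magnetic field outside `T`, decaying at infinity and continuous up to the boundary
of `T` and away from the sheet, with `div Bext = 0` and `curl Bext = j e_φ δ_{T'}` in the sense of
distributions in the exterior of `T`. Here `T'` is the surface of revolution generated by `Γ`. -/
structure IsFieldOfToroidalSheet (T : Set E3) (Γ : ℝ → E2) (j : E2 → ℝ) (Bext : E3 → E3) :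
    Prop where
  continuousOn_j : ContinuousOn j (range Γ)
  continuousOn_B : ContinuousOn Bext (Tᶜ \ torus (range Γ))
  locallyIntegrable_B : LocallyIntegrableOn Bext (closure T)ᶜ
  curl_eq : ∀ v : E3 → E3, ContDiff ℝ ∞ v → HasCompactSupport v → tsupport v ⊆ (closure T)ᶜ →
    ∫ x, inner ℝ (Bext x) (curl v x) ∂(volume.restrict (closure T)ᶜ) = sheetIntegral Γ j v
  div_eq : ∀ η : E3 → ℝ, ContDiff ℝ ∞ η → HasCompactSupport η → tsupport η ⊆ (closure T)ᶜ →
    ∫ x, inner ℝ (Bext x) (∇ η x) ∂(volume.restrict (closure T)ᶜ) = 0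
  decay : Tendsto Bext (cocompact E3) (𝓝 0)

/-- `(u, B, torus Ω)`, with pressure `p`, is a free boundary equilibrium for the (non-penetrating)
external field `Bext`. -/
structure IsFreeBoundaryEquilibrium (Ω : Set E2) (γ : ℝ → E2) (u B : E3 → E3) (p : E3 → ℝ)
    (Bext : E3 → E3) : Prop where
  steady : IsSteadyMHD (torus Ω) u B p
  pressure : ∀ x ∈ frontier (torus Ω), p x = ‖Bext x‖ ^ 2 / 2
  tangent_B : TangentToBoundary Ω γ B
  tangent_Bext : TangentToBoundary Ω γ Bext
  tangent_u : TangentToBoundary Ω γ u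

end AxiMHD

end

namespace AxiMHD

section DerivativeBounds

open scoped Nat NNReal ENNReal

variable {V : Type*} [NormedAddCommGroup V] [NormedSpace ℝ V]

/-- Near a point of analyticity the derivatives grow at most like `k! C ρ ^ k`. -/
theorem _root_.AnalyticAt.exists_iteratedDeriv_bound [CompleteSpace V] {f : ℝ → V} {x : ℝ}
    (hf : AnalyticAt ℝ f x) :
    ∃ C ρ : ℝ, 0 < C ∧ 0 < ρ ∧ ∀ᶠ y in 𝓝 x, ∀ k : ℕ, ‖iteratedDeriv k f y‖ ≤ k ! * (C * ρ ^ k) := by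
  obtain ⟨p, R, hp⟩ := hf
  obtain ⟨R', hR'0, hR'⟩ := ENNReal.lt_iff_exists_nnreal_btwn.1 hp.r_pos
  set r : ℝ≥0 := R' / 2 with hr
  have hr0 : 0 < r := by
    have : (0 : ℝ≥0) < R' := by exact_mod_cast hR'0
    positivity
  have hrr : ((r : ℝ≥0∞) + r) < p.radius := by
    have : r + r = R' := by rw [hr]; exact add_halves R'
    rw [← ENNReal.coe_add, this]
    exact hR'.trans_le hp.r_le
  have hS := p.changeOriginSeries_summable_aux₁ hrr
  set S : ℝ≥0 := ∑' s : Σ k l : ℕ, { s : Finset (Fin (k + l)) // s.card = l },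
      ‖p (s.1 + s.2.1)‖₊ * r ^ s.2.1 * r ^ s.1
  refine ⟨S + 1, (r : ℝ)⁻¹, by positivity, by positivity, ?_⟩
  filter_upwards [Metric.ball_mem_nhds x (ε := r) (by exact_mod_cast hr0)] with y hy k
  have hyr : ‖y - x‖₊ < r := by
    rw [← NNReal.coe_lt_coe]; simpa [dist_eq_norm] using hy
  have hyR : (‖y - x‖₊ : ℝ≥0∞) < R := by
    refine (lt_of_lt_of_le (ENNReal.coe_lt_coe.2 hyr) ?_).trans hR'
    exact_mod_cast (half_le_self (zero_le : 0 ≤ R'))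
  have hq := hp.changeOrigin hyR
  have h1 := hq.factorial_smul (1 : ℝ) k
  have hxy : x + (y - x) = y := by ring
  rw [hxy] at h1
  have h2 : ‖p.changeOrigin (y - x) k‖₊ * r ^ k ≤ S := by
    calc ‖p.changeOrigin (y - x) k‖₊ * r ^ k
        ≤ (∑' s : Σ l : ℕ, { s : Finset (Fin (k + l)) // s.card = l },
            ‖p (k + s.1)‖₊ * ‖y - x‖₊ ^ s.1) * r ^ k := by
          gcongr; exact p.nnnorm_changeOrigin_le k (hyR.trans_le hp.r_le)
      _ ≤ (∑' s : Σ l : ℕ, { s : Finset (Fin (k + l)) // s.card = l },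
            ‖p (k + s.1)‖₊ * r ^ s.1) * r ^ k := by
          refine mul_le_mul_left (Summable.tsum_le_tsum (fun s => by gcongr) ?_ ?_) _
          · exact p.changeOriginSeries_summable_aux₂ (hyR.trans_le hp.r_le) k
          · exact p.changeOriginSeries_summable_aux₂ (lt_of_le_of_lt (by simp) hrr) k
      _ ≤ S := by
          rw [← NNReal.tsum_mul_right]
          have := (NNReal.summable_sigma.1 hS).2.le_tsum k (fun _ _ => zero_le)
          refine this.trans_eq ?_
          exact (hS.tsum_sigma' (NNReal.summable_sigma.1 hS).1).symm
  rw [iteratedDeriv_eq_iteratedFDeriv, ← h1, ← Nat.cast_smul_eq_nsmul ℝ, norm_smul]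
  simp only [Real.norm_natCast]
  gcongr
  calc ‖p.changeOrigin (y - x) k fun _ => 1‖ ≤ ‖p.changeOrigin (y - x) k‖ := by
        simp
    _ ≤ (S + 1) * (r : ℝ)⁻¹ ^ k := by
        rw [inv_pow, ← div_eq_mul_inv, le_div_iff₀ (by positivity)]
        have : ‖p.changeOrigin (y - x) k‖ * (r : ℝ) ^ k ≤ S := by exact_mod_cast h2
        linarith

/-- The derivatives of a periodic analytic function grow at most like `k! C ρ ^ k`. -/
theorem exists_iteratedDeriv_bound_of_periodic [CompleteSpace V] {f : ℝ → V}
    (hf : ∀ x, AnalyticAt ℝ f x) (hper : Function.Periodic f 1) :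
    ∃ C ρ : ℝ, 0 < C ∧ 0 < ρ ∧ ∀ (k : ℕ) (y : ℝ), ‖iteratedDeriv k f y‖ ≤ k ! * (C * ρ ^ k) := by
  have hloc : ∃ C ρ : ℝ, 0 < C ∧ 0 < ρ ∧ ∀ y ∈ Icc (0 : ℝ) 1, ∀ k : ℕ,
      ‖iteratedDeriv k f y‖ ≤ k ! * (C * ρ ^ k) := by
    refine isCompact_Icc.induction_on (p := fun s => ∃ C ρ : ℝ, 0 < C ∧ 0 < ρ ∧ ∀ y ∈ s, ∀ k : ℕ,
      ‖iteratedDeriv k f y‖ ≤ k ! * (C * ρ ^ k)) ⟨1, 1, one_pos, one_pos, by simp⟩ ?_ ?_ ?_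
    · rintro s t hst ⟨C, ρ, hC, hρ, h⟩
      exact ⟨C, ρ, hC, hρ, fun y hy => h y (hst hy)⟩
    · rintro s t ⟨C, ρ, hC, hρ, h⟩ ⟨C', ρ', hC', hρ', h'⟩
      refine ⟨max C C', max ρ ρ', by positivity, by positivity, ?_⟩
      rintro y (hy | hy) k
      · refine (h y hy k).trans ?_
        gcongr <;> apply le_max_left
      · refine (h' y hy k).trans ?_
        gcongr <;> apply le_max_right
    · intro x _
      obtain ⟨C, ρ, hC, hρ, h⟩ := (hf x).exists_iteratedDeriv_bound
      exact ⟨_, mem_nhdsWithin_of_mem_nhds h, C, ρ, hC, hρ, fun y hy => hy⟩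
  obtain ⟨C, ρ, hC, hρ, h⟩ := hloc
  refine ⟨C, ρ, hC, hρ, fun k y => ?_⟩
  have hk : iteratedDeriv k f y = iteratedDeriv k f (Int.fract y) := by
    have h1 : (fun z => f (z + (-⌊y⌋ : ℤ))) = f := by
      funext z
      simpa using (hper.int_mul (-⌊y⌋)) z
    have h2 := iteratedDeriv_comp_add_const k f ((-⌊y⌋ : ℤ) : ℝ)
    rw [h1] at h2
    calc iteratedDeriv k f y = (fun t => iteratedDeriv k f (t + ((-⌊y⌋ : ℤ) : ℝ))) y := by
          rw [← h2]
      _ = _ := by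
          simp only [Int.fract]; push_cast; rw [sub_eq_add_neg]
  rw [hk]
  exact h _ ⟨Int.fract_nonneg y, (Int.fract_lt_one y).le⟩ k

/-- The `k`-th derivative of `f` is bounded by `k! b k`. -/
def DerivBound (f : ℝ → V) (b : ℕ → ℝ) : Prop :=
  ∀ (k : ℕ) (s : ℝ), ‖iteratedDeriv k f s‖ ≤ k ! * b k

theorem DerivBound.mono {f : ℝ → V} {b c : ℕ → ℝ} (h : DerivBound f b) (hbc : ∀ k, b k ≤ c k) :
    DerivBound f c := fun k s => (h k s).trans (by gcongr; exact hbc k)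

theorem DerivBound.nonneg {f : ℝ → V} {b : ℕ → ℝ} (h : DerivBound f b) (k : ℕ) : 0 ≤ b k := by
  have := (norm_nonneg _).trans (h k 0)
  exact nonneg_of_mul_nonneg_right this (by positivity)

theorem DerivBound.deriv {f : ℝ → V} {b : ℕ → ℝ} (h : DerivBound f b) :
    DerivBound (deriv f) (fun k => (k + 1) * b (k + 1)) := by
  intro k s
  rw [← iteratedDeriv_succ']
  refine (h (k + 1) s).trans_eq ?_
  rw [Nat.factorial_succ]; push_cast; ring

theorem DerivBound.const_smul {f : ℝ → V} {b : ℕ → ℝ} (h : DerivBound f b) (hf : ContDiff ℝ ∞ f)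
    (c : ℝ) : DerivBound (fun s => c • f s) (fun k => |c| * b k) := by
  intro k s
  have : iteratedDeriv k (fun s => c • f s) s = c • iteratedDeriv k f s :=
    iteratedDeriv_fun_const_smul ((hf.of_le (by exact_mod_cast le_top)).contDiffAt) c
  rw [this, norm_smul, Real.norm_eq_abs]
  calc |c| * _ ≤ |c| * (k ! * b k) := by gcongr; exact h k s
    _ = _ := by ring

theorem DerivBound.sum {ι : Type*} {f : ι → ℝ → V} {b : ι → ℕ → ℝ} (t : Finset ι)
    (hf : ∀ i ∈ t, ContDiff ℝ ∞ (f i)) (h : ∀ i ∈ t, DerivBound (f i) (b i)) :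
    DerivBound (fun s => ∑ i ∈ t, f i s) (fun k => ∑ i ∈ t, b i k) := by
  intro k s
  have : iteratedDeriv k (fun s => ∑ i ∈ t, f i s) s = ∑ i ∈ t, iteratedDeriv k (f i) s :=
    iteratedDeriv_fun_sum fun i hi => ((hf i hi).of_le (by exact_mod_cast le_top)).contDiffAt
  rw [this, Finset.mul_sum]
  exact (norm_sum_le _ _).trans (Finset.sum_le_sum fun i hi => h i hi k s)

theorem DerivBound.bilinear {V₁ V₂ : Type*} [NormedAddCommGroup V₁] [NormedSpace ℝ V₁]
    [NormedAddCommGroup V₂] [NormedSpace ℝ V₂] (B : V₁ →L[ℝ] V₂ →L[ℝ] V) {f : ℝ → V₁} {g : ℝ → V₂}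
    {b c : ℕ → ℝ} (hf : ContDiff ℝ ∞ f) (hg : ContDiff ℝ ∞ g)
    (hb : DerivBound f b) (hc : DerivBound g c) :
    DerivBound (fun s => B (f s) (g s))
      (fun k => ‖B‖ * ∑ ij ∈ Finset.HasAntidiagonal.antidiagonal k, b ij.1 * c ij.2) := by
  intro k s
  rw [← norm_iteratedFDeriv_eq_norm_iteratedDeriv]
  refine (B.norm_iteratedFDeriv_le_of_bilinear hf hg s (n := k) (by exact_mod_cast le_top)).trans ?_
  rw [mul_left_comm]
  gcongr
  rw [Finset.Nat.sum_antidiagonal_eq_sum_range_succ (fun i j => b i * c j), Finset.mul_sum]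
  refine Finset.sum_le_sum fun i hi => ?_
  have hik : i ≤ k := Nat.lt_succ_iff.1 (Finset.mem_range.1 hi)
  rw [norm_iteratedFDeriv_eq_norm_iteratedDeriv, norm_iteratedFDeriv_eq_norm_iteratedDeriv]
  calc (k.choose i : ℝ) * ‖iteratedDeriv i f s‖ * ‖iteratedDeriv (k - i) g s‖
      ≤ (k.choose i : ℝ) * (i ! * b i) * ((k - i)! * c (k - i)) := by
        gcongr
        · have := hb.nonneg i
          positivity
        · exact hb i s
        · exact hc (k - i) s
    _ = ((k.choose i * i ! * (k - i)! : ℕ) : ℝ) * (b i * c (k - i)) := by push_cast; ring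
    _ = _ := by rw [Nat.choose_mul_factorial_mul_factorial hik]

end DerivativeBounds

section Majorant

/-- The majorant of the `k`-th derivative of the `n`-th coefficient. -/
noncomputable def maj (L ρ : ℝ) (n k : ℕ) : ℝ :=
  L ^ n * ρ ^ k * (n + k).choose n * (((n + k : ℕ) : ℝ) + 1)⁻¹ ^ 2

theorem sum_inv_sq_le (N : ℕ) : ∑ i ∈ Finset.range (N + 1), ((i : ℝ) + 1)⁻¹ ^ 2 ≤ 2 := by
  have : ∀ N : ℕ, ∑ i ∈ Finset.range (N + 1), ((i : ℝ) + 1)⁻¹ ^ 2 ≤ 2 - ((N : ℝ) + 1)⁻¹ := by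
    intro N
    induction N with
    | zero => norm_num
    | succ N ih =>
      rw [Finset.sum_range_succ]
      have h : ((↑(N + 1) : ℝ) + 1)⁻¹ ^ 2 ≤ ((N : ℝ) + 1)⁻¹ - ((↑(N + 1) : ℝ) + 1)⁻¹ := by
        push_cast
        rw [inv_sub_inv (by positivity) (by positivity), inv_pow, inv_eq_one_div]
        rw [div_le_div_iff₀ (by positivity) (by positivity)]
        nlinarith [(Nat.cast_nonneg N : (0 : ℝ) ≤ N)]
      linarith
  have h := this N
  have : (0 : ℝ) ≤ ((N : ℝ) + 1)⁻¹ := by positivity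
  linarith

theorem sum_antidiagonal_inv_sq_le (N : ℕ) :
    ∑ ab ∈ Finset.HasAntidiagonal.antidiagonal N, ((ab.1 : ℝ) + 1)⁻¹ ^ 2 * ((ab.2 : ℝ) + 1)⁻¹ ^ 2
      ≤ 8 * ((N : ℝ) + 1)⁻¹ ^ 2 := by
  have hterm : ∀ ab ∈ Finset.HasAntidiagonal.antidiagonal N,
      ((ab.1 : ℝ) + 1)⁻¹ ^ 2 * ((ab.2 : ℝ) + 1)⁻¹ ^ 2
        ≤ 2 * ((N : ℝ) + 1)⁻¹ ^ 2 * (((ab.1 : ℝ) + 1)⁻¹ ^ 2 + ((ab.2 : ℝ) + 1)⁻¹ ^ 2) := by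
    rintro ⟨a, b⟩ hab
    have hN : (a : ℝ) + b = N := by exact_mod_cast Finset.HasAntidiagonal.mem_antidiagonal.1 hab
    simp only
    set x : ℝ := ((a : ℝ) + 1)⁻¹ with hx
    set y : ℝ := ((b : ℝ) + 1)⁻¹ with hy
    have hx0 : 0 < x := by positivity
    have hy0 : 0 < y := by positivity
    have h1 : x * y = ((N : ℝ) + 2)⁻¹ * (x + y) := by
      rw [hx, hy, ← hN]; field_simp; ring
    have h2 : x * y ≤ ((N : ℝ) + 1)⁻¹ * (x + y) := by
      rw [h1]; gcongr; norm_num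
    have h3 : (x * y) ^ 2 ≤ (((N : ℝ) + 1)⁻¹ * (x + y)) ^ 2 := by gcongr
    have h4 : (x + y) ^ 2 ≤ 2 * (x ^ 2 + y ^ 2) := by nlinarith [sq_nonneg (x - y)]
    calc x ^ 2 * y ^ 2 = (x * y) ^ 2 := by ring
      _ ≤ ((N : ℝ) + 1)⁻¹ ^ 2 * (x + y) ^ 2 := by rw [← mul_pow]; exact h3
      _ ≤ ((N : ℝ) + 1)⁻¹ ^ 2 * (2 * (x ^ 2 + y ^ 2)) := by gcongr
      _ = _ := by ring
  refine (Finset.sum_le_sum hterm).trans ?_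
  rw [← Finset.mul_sum, Finset.sum_add_distrib,
    Finset.Nat.sum_antidiagonal_eq_sum_range_succ (fun i _ => ((i : ℝ) + 1)⁻¹ ^ 2)]
  have hswap : ∑ x ∈ Finset.HasAntidiagonal.antidiagonal N, ((x.2 : ℝ) + 1)⁻¹ ^ 2
      = ∑ k ∈ Finset.range (N + 1), ((k : ℝ) + 1)⁻¹ ^ 2 := by
    rw [← Finset.Nat.sum_antidiagonal_swap]
    simp only [Prod.snd_swap]
    exact Finset.Nat.sum_antidiagonal_eq_sum_range_succ (fun i _ => ((i : ℝ) + 1)⁻¹ ^ 2) N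
  rw [hswap]
  have := sum_inv_sq_le N
  have h0 : (0 : ℝ) ≤ ((N : ℝ) + 1)⁻¹ ^ 2 := by positivity
  nlinarith

theorem maj_nonneg {L ρ : ℝ} (hL : 0 ≤ L) (hρ : 0 ≤ ρ) (n k : ℕ) : 0 ≤ maj L ρ n k := by
  unfold maj; positivity

theorem succ_mul_maj {L ρ : ℝ} (hL : L ≠ 0) (n k : ℕ) :
    ((k : ℝ) + 1) * maj L ρ n (k + 1) = (ρ / L) * ((n : ℝ) + 1) * maj L ρ (n + 1) k := by
  unfold maj
  have h1 : ((n + (k + 1)).choose n : ℝ) * (k + 1) = (n + 1 + k).choose (n + 1) * (n + 1) := by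
    have h := Nat.choose_succ_right_eq (n + 1 + k) n
    have h2 : n + 1 + k - n = k + 1 := by omega
    rw [h2] at h
    have h3 : n + (k + 1) = n + 1 + k := by omega
    rw [h3]
    exact_mod_cast h.symm
  have h3 : n + (k + 1) = n + 1 + k := by omega
  rw [h3] at h1 ⊢
  field_simp
  rw [mul_comm _ ((k : ℝ) + 1)] at h1
  linear_combination (L ^ n * L * ρ ^ k * ρ ) * h1

theorem maj_le {L ρ : ℝ} (hL : 0 ≤ L) (hρ : 0 ≤ ρ) (n k : ℕ) :
    maj L ρ n k ≤ (2 * L) ^ n * (2 * ρ) ^ k := by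
  unfold maj
  have h1 : ((n + k).choose n : ℝ) ≤ 2 ^ n * 2 ^ k := by
    rw [← pow_add]; exact_mod_cast Nat.choose_le_two_pow _ _
  have h2 : (((n + k : ℕ) : ℝ) + 1)⁻¹ ^ 2 ≤ 1 := by
    apply pow_le_one₀ (by positivity)
    apply inv_le_one_of_one_le₀
    linarith [(Nat.cast_nonneg (n + k) : (0 : ℝ) ≤ _)]
  calc _ ≤ L ^ n * ρ ^ k * (2 ^ n * 2 ^ k) * 1 := by gcongr
    _ = _ := by rw [mul_pow, mul_pow]; ring

/-- The majorants are stable under multiplication. -/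
theorem sum_maj_mul_maj_le {L ρ : ℝ} (hL : 0 ≤ L) (hρ : 0 ≤ ρ) (n k : ℕ) :
    ∑ ij ∈ Finset.HasAntidiagonal.antidiagonal n, ∑ ab ∈ Finset.HasAntidiagonal.antidiagonal k,
      maj L ρ ij.1 ab.1 * maj L ρ ij.2 ab.2 ≤ 8 * maj L ρ n k := by
  have hterm : ∀ ij ∈ Finset.HasAntidiagonal.antidiagonal n, ∀ ab ∈ Finset.HasAntidiagonal.antidiagonal k,
      maj L ρ ij.1 ab.1 * maj L ρ ij.2 ab.2 = L ^ n * ρ ^ k *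
        ((((ij.1 + ab.1).choose ij.1 * (ij.2 + ab.2).choose ij.2 : ℕ) : ℝ) *
        ((((ij.1 + ab.1 : ℕ) : ℝ) + 1)⁻¹ ^ 2 * (((ij.2 + ab.2 : ℕ) : ℝ) + 1)⁻¹ ^ 2)) := by
    rintro ⟨i, j⟩ hij ⟨a, b⟩ hab
    simp only [Finset.HasAntidiagonal.mem_antidiagonal] at hij hab
    subst hij hab
    unfold maj
    push_cast
    ring
  have hsum : ∑ ij ∈ Finset.HasAntidiagonal.antidiagonal n, ∑ ab ∈ Finset.HasAntidiagonal.antidiagonal k,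
      ((((ij.1 + ab.1).choose ij.1 * (ij.2 + ab.2).choose ij.2 : ℕ) : ℝ) *
        ((((ij.1 + ab.1 : ℕ) : ℝ) + 1)⁻¹ ^ 2 * (((ij.2 + ab.2 : ℕ) : ℝ) + 1)⁻¹ ^ 2))
      ≤ ∑ N ∈ Finset.HasAntidiagonal.antidiagonal (n + k), ∑ ij ∈ Finset.HasAntidiagonal.antidiagonal n,
        ((N.1.choose ij.1 * N.2.choose ij.2 : ℕ) : ℝ) *
        (((N.1 : ℝ) + 1)⁻¹ ^ 2 * ((N.2 : ℝ) + 1)⁻¹ ^ 2) := by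
    rw [Finset.sum_comm (s := Finset.HasAntidiagonal.antidiagonal (n + k))]
    refine Finset.sum_le_sum fun ij hij => ?_
    have hij' := Finset.HasAntidiagonal.mem_antidiagonal.1 hij
    rw [← Finset.sum_image (s := Finset.HasAntidiagonal.antidiagonal k)
      (g := fun ab : ℕ × ℕ => (ij.1 + ab.1, ij.2 + ab.2))
      (f := fun N : ℕ × ℕ => ((N.1.choose ij.1 * N.2.choose ij.2 : ℕ) : ℝ) *
        (((N.1 : ℝ) + 1)⁻¹ ^ 2 * ((N.2 : ℝ) + 1)⁻¹ ^ 2))]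
    · refine Finset.sum_le_sum_of_subset_of_nonneg ?_ fun _ _ _ => by positivity
      intro N hN
      obtain ⟨ab, hab, rfl⟩ := Finset.mem_image.1 hN
      have := Finset.HasAntidiagonal.mem_antidiagonal.1 hab
      rw [Finset.HasAntidiagonal.mem_antidiagonal]
      simp only
      omega
    · rintro ⟨a, b⟩ _ ⟨a', b'⟩ _ h
      simp only [Prod.mk.injEq] at h ⊢
      omega
  rw [Finset.sum_congr rfl fun ij hij => Finset.sum_congr rfl (hterm ij hij)]
  simp_rw [← Finset.mul_sum]
  have hV : ∀ N ∈ Finset.HasAntidiagonal.antidiagonal (n + k), ∑ ij ∈ Finset.HasAntidiagonal.antidiagonal n,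
        ((N.1.choose ij.1 * N.2.choose ij.2 : ℕ) : ℝ) *
        (((N.1 : ℝ) + 1)⁻¹ ^ 2 * ((N.2 : ℝ) + 1)⁻¹ ^ 2) =
      ((n + k).choose n : ℝ) * (((N.1 : ℝ) + 1)⁻¹ ^ 2 * ((N.2 : ℝ) + 1)⁻¹ ^ 2) := by
    intro N hN
    rw [← Finset.sum_mul, ← Nat.cast_sum, ← Nat.add_choose_eq, Finset.HasAntidiagonal.mem_antidiagonal.1 hN]
  rw [Finset.sum_congr rfl hV, ← Finset.mul_sum] at hsum
  have hw := sum_antidiagonal_inv_sq_le (n + k)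
  calc _ ≤ L ^ n * ρ ^ k * (((n + k).choose n : ℝ) * (8 * (((n + k : ℕ) : ℝ) + 1)⁻¹ ^ 2)) := by
        gcongr
        refine hsum.trans ?_
        gcongr
    _ = _ := by unfold maj; ring

end Majorant

end AxiMHD

namespace AxiMHD

section CauchyProduct

open Finset.HasAntidiagonal

variable {V₁ V₂ V₃ : Type*} [NormedAddCommGroup V₁] [NormedSpace ℝ V₁]
  [NormedAddCommGroup V₂] [NormedSpace ℝ V₂] [NormedAddCommGroup V₃] [NormedSpace ℝ V₃]

theorem summable_norm_sum_bilinear_antidiagonal (B : V₁ →L[ℝ] V₂ →L[ℝ] V₃) {f : ℕ → V₁}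
    {g : ℕ → V₂} (hf : Summable fun n => ‖f n‖) (hg : Summable fun n => ‖g n‖) :
    Summable fun n => ‖∑ ij ∈ antidiagonal n, B (f ij.1) (g ij.2)‖ := by
  have := (summable_sum_mul_antidiagonal_of_summable_mul
      (Summable.mul_of_nonneg hf hg (fun _ => norm_nonneg _) fun _ => norm_nonneg _)).mul_left ‖B‖
  refine this.of_nonneg_of_le (fun _ => norm_nonneg _) (fun n ↦ ?_)
  rw [Finset.mul_sum]
  refine (norm_sum_le _ _).trans (Finset.sum_le_sum fun ij _ => ?_)
  rw [← mul_assoc]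
  exact B.le_opNorm₂ _ _

/-- The Cauchy product formula for a continuous bilinear map. -/
theorem bilinear_tsum_tsum [CompleteSpace V₁] [CompleteSpace V₂] [CompleteSpace V₃]
    (B : V₁ →L[ℝ] V₂ →L[ℝ] V₃) {f : ℕ → V₁} {g : ℕ → V₂} (hf : Summable fun n => ‖f n‖)
    (hg : Summable fun n => ‖g n‖) :
    B (∑' n, f n) (∑' n, g n) = ∑' n, ∑ ij ∈ antidiagonal n, B (f ij.1) (g ij.2) := by
  have hsum : Summable fun x : ℕ × ℕ => B (f x.1) (g x.2) := by
    have h := (Summable.mul_of_nonneg hf hg (fun _ => norm_nonneg _)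
      fun _ => norm_nonneg _).mul_left ‖B‖
    refine Summable.of_norm_bounded h fun x => ?_
    rw [← mul_assoc]
    exact B.le_opNorm₂ _ _
  have h1 : B (∑' n, f n) (∑' n, g n) = ∑' x : ℕ × ℕ, B (f x.1) (g x.2) := by
    rw [hsum.tsum_prod' fun i => (B (f i)).summable hg.of_norm]
    rw [B.map_tsum hf.of_norm]
    have h2 := (ContinuousLinearMap.apply ℝ V₃ (∑' n, g n)).map_tsum (B.summable hf.of_norm)
    simp only [ContinuousLinearMap.apply_apply] at h2
    rw [h2]
    exact tsum_congr fun i => (B (f i)).map_tsum hg.of_norm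
  conv_rhs => congr; ext; rw [← Finset.sum_finset_coe, ← tsum_fintype (L := .unconditional _)]
  rw [h1, ← Finset.HasAntidiagonal.sigmaAntidiagonalEquivProd.tsum_eq (_ : ℕ × ℕ → V₃)]
  exact ((Finset.HasAntidiagonal.sigmaAntidiagonalEquivProd.summable_iff).2 hsum).tsum_sigma'
    (fun n ↦ (hasSum_fintype _).summable)

end CauchyProduct

section CauchyKovalevskaya

set_option maxSynthPendingDepth 3

open Finset.HasAntidiagonal
open scoped Nat

variable {V : Type*} [NormedAddCommGroup V] [NormedSpace ℝ V]

/-- The coefficients of the solution `∑ tⁿ uₙ(s)` of `∂ₜ U = T(U, U, ∂ₛ U)`, `U(s, 0) = u₀(s)`. -/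
noncomputable def ckCoeff (T : V →L[ℝ] V →L[ℝ] V →L[ℝ] V) (u₀ : ℝ → V) : ℕ → ℝ → V
  | 0 => u₀
  | n + 1 => fun s => ((n : ℝ) + 1)⁻¹ • ∑ ij ∈ (antidiagonal n).attach,
      (∑ ab ∈ (antidiagonal ij.1.1).attach, T (ckCoeff T u₀ ab.1.1 s) (ckCoeff T u₀ ab.1.2 s))
        (deriv (ckCoeff T u₀ ij.1.2) s)
  termination_by n => n
  decreasing_by
    · have h1 := mem_antidiagonal.1 ij.2
      have h2 := mem_antidiagonal.1 ab.2
      omega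
    · have h1 := mem_antidiagonal.1 ij.2
      have h2 := mem_antidiagonal.1 ab.2
      omega
    · have h1 := mem_antidiagonal.1 ij.2
      omega

theorem ckCoeff_zero (T : V →L[ℝ] V →L[ℝ] V →L[ℝ] V) (u₀ : ℝ → V) : ckCoeff T u₀ 0 = u₀ := by
  rw [ckCoeff]

theorem ckCoeff_succ (T : V →L[ℝ] V →L[ℝ] V →L[ℝ] V) (u₀ : ℝ → V) (n : ℕ) :
    ckCoeff T u₀ (n + 1) = fun s => ((n : ℝ) + 1)⁻¹ • ∑ ij ∈ antidiagonal n,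
      (∑ ab ∈ antidiagonal ij.1, T (ckCoeff T u₀ ab.1 s) (ckCoeff T u₀ ab.2 s))
        (deriv (ckCoeff T u₀ ij.2) s) := by
  rw [ckCoeff]
  funext s
  congr 1
  rw [← Finset.sum_attach (antidiagonal n)]
  refine Finset.sum_congr rfl fun ij _ => ?_
  rw [← Finset.sum_attach (antidiagonal ij.1.1)]

theorem periodic_ckCoeff (T : V →L[ℝ] V →L[ℝ] V →L[ℝ] V) {u₀ : ℝ → V}
    (h : Function.Periodic u₀ 1) (n : ℕ) : Function.Periodic (ckCoeff T u₀ n) 1 := by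
  induction n using Nat.strong_induction_on with
  | _ n ih =>
    cases n with
    | zero => rwa [ckCoeff_zero]
    | succ n =>
      intro s
      rw [ckCoeff_succ]
      simp only
      congr 1
      refine Finset.sum_congr rfl fun ij hij => ?_
      have hij' := mem_antidiagonal.1 hij
      have hd : Function.Periodic (deriv (ckCoeff T u₀ ij.2)) 1 := by
        intro x
        rw [← deriv_comp_add_const]
        congr 1
        funext y
        exact ih ij.2 (by omega) y
      rw [hd s]
      congr 1
      refine Finset.sum_congr rfl fun ab hab => ?_
      have hab' := mem_antidiagonal.1 hab
      rw [ih ab.1 (by omega) s, ih ab.2 (by omega) s]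

theorem ckCoeff_bound (T : V →L[ℝ] V →L[ℝ] V →L[ℝ] V) {u₀ : ℝ → V} {C ρ L : ℝ}
    (hC : 0 < C) (hρ : 0 < ρ) (hL : 64 * ‖T‖ * C ^ 2 * ρ ≤ L) (hL0 : 0 < L)
    (h0 : ContDiff ℝ ∞ u₀) (hb : DerivBound u₀ fun k => C * maj L ρ 0 k) (n : ℕ) :
    ContDiff ℝ ∞ (ckCoeff T u₀ n) ∧ DerivBound (ckCoeff T u₀ n) fun k => C * maj L ρ n k := by
  induction n using Nat.strong_induction_on with
  | _ n ih =>
    cases n with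
    | zero => rw [ckCoeff_zero]; exact ⟨h0, hb⟩
    | succ n =>
      set g : ℕ → ℝ → V →L[ℝ] V := fun i s =>
        ∑ ab ∈ antidiagonal i, T (ckCoeff T u₀ ab.1 s) (ckCoeff T u₀ ab.2 s) with hg
      have hgterm : ∀ i ≤ n, ∀ ab ∈ antidiagonal i,
          ContDiff ℝ ∞ (fun s => T (ckCoeff T u₀ ab.1 s) (ckCoeff T u₀ ab.2 s)) ∧
          DerivBound (fun s => T (ckCoeff T u₀ ab.1 s) (ckCoeff T u₀ ab.2 s)) fun k => ‖T‖ *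
            ∑ cd ∈ antidiagonal k, (C * maj L ρ ab.1 cd.1) * (C * maj L ρ ab.2 cd.2) := by
        intro i hi ab hab
        have hab' := mem_antidiagonal.1 hab
        have h1 := ih ab.1 (by omega)
        have h2 := ih ab.2 (by omega)
        exact ⟨(T.contDiff.comp h1.1).clm_apply h2.1,
          DerivBound.bilinear T h1.1 h2.1 h1.2 h2.2⟩
      have hgc : ∀ i ≤ n, ContDiff ℝ ∞ (g i) := fun i hi =>
        ContDiff.sum fun ab hab => (hgterm i hi ab hab).1
      have hgb : ∀ i ≤ n, DerivBound (g i) fun k => 8 * ‖T‖ * C ^ 2 * maj L ρ i k := by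
        intro i hi
        refine (DerivBound.sum _ (fun ab hab => (hgterm i hi ab hab).1)
          (fun ab hab => (hgterm i hi ab hab).2)).mono fun k => ?_
        calc _ = ‖T‖ * C ^ 2 * ∑ ab ∈ antidiagonal i, ∑ cd ∈ antidiagonal k,
                maj L ρ ab.1 cd.1 * maj L ρ ab.2 cd.2 := by
              rw [Finset.mul_sum]
              refine Finset.sum_congr rfl fun ab _ => ?_
              rw [Finset.mul_sum, Finset.mul_sum]
              refine Finset.sum_congr rfl fun cd _ => by ring
          _ ≤ ‖T‖ * C ^ 2 * (8 * maj L ρ i k) := by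
              gcongr
              exact sum_maj_mul_maj_le hL0.le hρ.le i k
          _ = _ := by ring
      have hdc : ∀ j ≤ n, ContDiff ℝ ∞ (deriv (ckCoeff T u₀ j)) := fun j hj =>
        (contDiff_infty_iff_deriv.1 (ih j (by omega)).1).2
      have hdb : ∀ j ≤ n, DerivBound (deriv (ckCoeff T u₀ j))
          fun k => C * (ρ / L) * ((n : ℝ) + 1) * maj L ρ (j + 1) k := by
        intro j hj
        refine (ih j (by omega)).2.deriv.mono fun k => ?_
        have h1 := succ_mul_maj (ρ := ρ) hL0.ne' j k
        have h2 := maj_nonneg hL0.le hρ.le (j + 1) k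
        calc ((k : ℝ) + 1) * (C * maj L ρ j (k + 1))
            = C * ((ρ / L) * ((j : ℝ) + 1) * maj L ρ (j + 1) k) := by rw [← h1]; ring
          _ ≤ C * ((ρ / L) * ((n : ℝ) + 1) * maj L ρ (j + 1) k) := by gcongr
          _ = _ := by ring
      have hterm : ∀ ij ∈ antidiagonal n,
          ContDiff ℝ ∞ (fun s => (g ij.1 s) (deriv (ckCoeff T u₀ ij.2) s)) ∧
          DerivBound (fun s => (g ij.1 s) (deriv (ckCoeff T u₀ ij.2) s)) fun k =>
            ∑ cd ∈ antidiagonal k, (8 * ‖T‖ * C ^ 2 * maj L ρ ij.1 cd.1) *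
              (C * (ρ / L) * ((n : ℝ) + 1) * maj L ρ (ij.2 + 1) cd.2) := by
        intro ij hij
        have hij' := mem_antidiagonal.1 hij
        have h1 := hgc ij.1 (by omega)
        have h2 := hdc ij.2 (by omega)
        refine ⟨h1.clm_apply h2, ?_⟩
        refine (DerivBound.bilinear (ContinuousLinearMap.id ℝ (V →L[ℝ] V)) h1 h2
          (hgb ij.1 (by omega)) (hdb ij.2 (by omega))).mono fun k => ?_
        refine mul_le_of_le_one_left (Finset.sum_nonneg fun cd _ => ?_)
          ContinuousLinearMap.norm_id_le
        have := maj_nonneg hL0.le hρ.le ij.1 cd.1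
        have := maj_nonneg hL0.le hρ.le (ij.2 + 1) cd.2
        positivity
      have hsumc : ContDiff ℝ ∞ (fun s => ∑ ij ∈ antidiagonal n,
          (g ij.1 s) (deriv (ckCoeff T u₀ ij.2) s)) := ContDiff.sum fun ij hij => (hterm ij hij).1
      rw [ckCoeff_succ]
      refine ⟨hsumc.const_smul _, ?_⟩
      refine ((DerivBound.sum _ (fun ij hij => (hterm ij hij).1)
          (fun ij hij => (hterm ij hij).2)).const_smul hsumc _).mono fun k => ?_
      have hshift : ∑ ij ∈ antidiagonal n, ∑ cd ∈ antidiagonal k,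
          maj L ρ ij.1 cd.1 * maj L ρ (ij.2 + 1) cd.2 ≤ 8 * maj L ρ (n + 1) k := by
        refine le_trans ?_ (sum_maj_mul_maj_le hL0.le hρ.le (n + 1) k)
        rw [Finset.Nat.antidiagonal_succ']
        rw [Finset.sum_cons, Finset.sum_map]
        refine le_add_of_nonneg_left ?_
        exact Finset.sum_nonneg fun cd _ =>
          mul_nonneg (maj_nonneg hL0.le hρ.le _ _) (maj_nonneg hL0.le hρ.le _ _)
      have hn : |((n : ℝ) + 1)⁻¹| = ((n : ℝ) + 1)⁻¹ := abs_of_pos (by positivity)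
      rw [hn]
      calc _ = 8 * ‖T‖ * C ^ 3 * (ρ / L) * ∑ ij ∈ antidiagonal n, ∑ cd ∈ antidiagonal k,
          maj L ρ ij.1 cd.1 * maj L ρ (ij.2 + 1) cd.2 := by
            rw [Finset.mul_sum, Finset.mul_sum]
            refine Finset.sum_congr rfl fun ij _ => ?_
            rw [Finset.mul_sum, Finset.mul_sum]
            refine Finset.sum_congr rfl fun cd _ => ?_
            field_simp
        _ ≤ 8 * ‖T‖ * C ^ 3 * (ρ / L) * (8 * maj L ρ (n + 1) k) := by gcongr
        _ = (64 * ‖T‖ * C ^ 2 * ρ / L) * (C * maj L ρ (n + 1) k) := by ring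
        _ ≤ 1 * (C * maj L ρ (n + 1) k) := by
            have := maj_nonneg hL0.le hρ.le (n + 1) k
            gcongr
            rwa [div_le_one hL0]
        _ = _ := one_mul _

/-- Local existence for the analytic periodic Cauchy problem `∂ₜ U = T(U, U, ∂ₛ U)`,
`U(s, 0) = u₀(s)`, where `T` is trilinear. -/
theorem exists_solution_of_analytic_periodic [CompleteSpace V]
    (T : V →L[ℝ] V →L[ℝ] V →L[ℝ] V) {u₀ : ℝ → V} (ha : ∀ x, AnalyticAt ℝ u₀ x)
    (hper : Function.Periodic u₀ 1) :
    ∃ δ > 0, ∃ U : ℝ → ℝ → V, (∀ s, U s 0 = u₀ s) ∧ (∀ t, Function.Periodic (fun s => U s t) 1) ∧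
      (∀ t ∈ Ioo (-δ) δ, ContDiff ℝ ∞ fun s => U s t) ∧
      (∀ t ∈ Ioo (-δ) δ, ∀ s,
        HasDerivAt (fun t => U s t) (T (U s t) (U s t) (deriv (fun s => U s t) s)) t) ∧
      ContinuousOn (fun q : ℝ × ℝ => U q.1 q.2) (univ ×ˢ Ioo (-δ) δ) ∧
      ContinuousOn (fun q : ℝ × ℝ => deriv (fun s => U s q.2) q.1) (univ ×ˢ Ioo (-δ) δ) := by
  obtain ⟨C, ρ₀, hC, hρ₀, hbd⟩ := exists_iteratedDeriv_bound_of_periodic ha hper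
  set ρ : ℝ := 4 * ρ₀ with hρdef
  have hρ : 0 < ρ := by positivity
  set L : ℝ := 64 * ‖T‖ * C ^ 2 * ρ + 1 with hLdef
  have hL0 : 0 < L := by positivity
  have hbase : DerivBound u₀ fun k => C * maj L ρ 0 k := by
    have h1 : DerivBound u₀ fun k => C * ρ₀ ^ k := hbd
    refine h1.mono fun k => ?_
    gcongr
    unfold maj
    simp only [pow_zero, one_mul, zero_add, Nat.choose_zero_right, Nat.cast_one, mul_one]
    rw [hρdef, mul_pow, inv_pow, ← div_eq_mul_inv, le_div_iff₀ (by positivity), mul_comm]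
    gcongr
    have h2 : (k : ℝ) + 1 ≤ 2 ^ k := by exact_mod_cast Nat.lt_two_pow_self (n := k)
    calc ((k : ℝ) + 1) ^ 2 ≤ (2 ^ k) ^ 2 := by gcongr
      _ = 4 ^ k := by rw [← pow_mul, mul_comm, pow_mul]; norm_num
  have hu0 : ContDiff ℝ ∞ u₀ := contDiff_iff_contDiffAt.2 fun x => (ha x).contDiffAt
  have hck := ckCoeff_bound T hC hρ (by linarith : 64 * ‖T‖ * C ^ 2 * ρ ≤ L) hL0 hu0 hbase
  have hperc := periodic_ckCoeff T hper
  have hrec := ckCoeff_succ T u₀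
  have hzero := ckCoeff_zero T u₀
  set u := ckCoeff T u₀
  have hub : ∀ n k s, ‖iteratedDeriv k (u n) s‖ ≤ k ! * (C * ((2 * L) ^ n * (2 * ρ) ^ k)) := by
    intro n k s
    refine ((hck n).2 k s).trans ?_
    show (k ! : ℝ) * (C * maj L ρ n k) ≤ _
    gcongr
    exact maj_le hL0.le hρ.le n k
  set δ : ℝ := (4 * L)⁻¹ with hδ
  have hδ0 : 0 < δ := by positivity
  have hLδ : 2 * L * δ = 1 / 2 := by rw [hδ]; field_simp; norm_num
  have hpow : ∀ n : ℕ, ∀ t ∈ Ioo (-δ) δ, |t| ^ n * (2 * L) ^ n ≤ (1 / 2) ^ n := by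
    intro n t ht
    rw [← mul_pow]
    have : |t| ≤ δ := (abs_lt.2 ht).le
    have h2 : |t| * (2 * L) ≤ 1 / 2 := by rw [← hLδ, mul_comm]; gcongr
    gcongr
  have hbk : ∀ (n k : ℕ) (s t : ℝ), t ∈ Ioo (-δ) δ →
      ‖t ^ n • iteratedDeriv k (u n) s‖ ≤ k ! * C * (2 * ρ) ^ k * (1 / 2) ^ n := by
    intro n k s t ht
    rw [norm_smul, norm_pow, Real.norm_eq_abs]
    calc |t| ^ n * ‖iteratedDeriv k (u n) s‖
        ≤ |t| ^ n * (k ! * (C * ((2 * L) ^ n * (2 * ρ) ^ k))) := by gcongr; exact hub n k s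
      _ = k ! * C * (2 * ρ) ^ k * (|t| ^ n * (2 * L) ^ n) := by ring
      _ ≤ _ := by gcongr; exact hpow n t ht
  have hsumk : ∀ k : ℕ, Summable fun n : ℕ => (k ! * C * (2 * ρ) ^ k * (1 / 2) ^ n : ℝ) := fun k =>
    (summable_geometric_of_lt_one (by norm_num) (by norm_num)).mul_left _
  have hb0 : ∀ (n : ℕ) (s t : ℝ), t ∈ Ioo (-δ) δ → ‖t ^ n • u n s‖ ≤ C * (1 / 2) ^ n := by
    intro n s t ht
    simpa using hbk n 0 s t ht
  have hb1 : ∀ (n : ℕ) (s t : ℝ), t ∈ Ioo (-δ) δ →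
      ‖t ^ n • deriv (u n) s‖ ≤ C * (2 * ρ) * (1 / 2) ^ n := by
    intro n s t ht
    simpa [iteratedDeriv_one] using hbk n 1 s t ht
  have hs0 : Summable fun n : ℕ => (C * (1 / 2) ^ n : ℝ) := by simpa using hsumk 0
  have hs1 : Summable fun n : ℕ => (C * (2 * ρ) * (1 / 2) ^ n : ℝ) := by simpa using hsumk 1
  have hdiffu : ∀ n s, HasDerivAt (u n) (deriv (u n) s) s := fun n s =>
    ((hck n).1.differentiable (by simp) s).hasDerivAt
  have hderiv : ∀ t ∈ Ioo (-δ) δ, ∀ s,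
      HasDerivAt (fun s => ∑' n, t ^ n • u n s) (∑' n, t ^ n • deriv (u n) s) s := by
    intro t ht s
    exact hasDerivAt_tsum hs1 (fun n y => (hdiffu n y).const_smul (t ^ n))
      (fun n y => hb1 n y t ht) (y₀ := s) (Summable.of_norm_bounded hs0 fun n => hb0 n s t ht) s
  refine ⟨δ, hδ0, fun s t => ∑' n, t ^ n • u n s, ?_, ?_, ?_, ?_, ?_, ?_⟩
  · intro s
    show ∑' n, (0 : ℝ) ^ n • u n s = u₀ s
    rw [tsum_eq_single 0]
    · simp [hzero]
    · intro n hn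
      simp [hn]
  · intro t s
    exact tsum_congr fun n => by rw [hperc n s]
  · intro t ht
    refine contDiff_tsum (N := ⊤) (fun n => ((hck n).1).const_smul (t ^ n))
      (v := fun k n => (k ! * C * (2 * ρ) ^ k * (1 / 2) ^ n : ℝ)) (fun k _ => hsumk k) ?_
    intro k n x _
    rw [norm_iteratedFDeriv_eq_norm_iteratedDeriv]
    have : iteratedDeriv k (fun s => t ^ n • u n s) x = t ^ n • iteratedDeriv k (u n) x :=
      iteratedDeriv_fun_const_smul (((hck n).1.of_le (by exact_mod_cast le_top)).contDiffAt) _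
    exact (congrArg norm this).trans_le (hbk n k x t ht)
  · intro t ht s
    have hR : T (∑' n, t ^ n • u n s) (∑' n, t ^ n • u n s) (∑' n, t ^ n • deriv (u n) s)
        = ∑' n : ℕ, ((n : ℝ) * t ^ (n - 1)) • u n s := by
      have hsu : Summable fun n => ‖t ^ n • u n s‖ :=
        Summable.of_nonneg_of_le (fun _ => norm_nonneg _) (fun n => hb0 n s t ht) hs0
      have hsd : Summable fun n => ‖t ^ n • deriv (u n) s‖ :=
        Summable.of_nonneg_of_le (fun _ => norm_nonneg _) (fun n => hb1 n s t ht) hs1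
      rw [bilinear_tsum_tsum T hsu hsu]
      have h2 := bilinear_tsum_tsum (ContinuousLinearMap.id ℝ (V →L[ℝ] V))
        (summable_norm_sum_bilinear_antidiagonal T hsu hsu) hsd
      simp only [ContinuousLinearMap.id_apply] at h2
      rw [h2]
      have hterm : ∀ n : ℕ, ∑ ij ∈ antidiagonal n,
          (∑ ab ∈ antidiagonal ij.1, T (t ^ ab.1 • u ab.1 s) (t ^ ab.2 • u ab.2 s))
            (t ^ ij.2 • deriv (u ij.2) s) = (((n + 1 : ℕ) : ℝ) * t ^ (n + 1 - 1)) • u (n + 1) s := by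
        intro n
        rw [hrec n]
        simp only [add_tsub_cancel_right]
        rw [smul_smul]
        have : ((n + 1 : ℕ) : ℝ) * t ^ n * ((n : ℝ) + 1)⁻¹ = t ^ n := by
          push_cast; field_simp
        rw [this, Finset.smul_sum]
        refine Finset.sum_congr rfl fun ij hij => ?_
        rw [← mem_antidiagonal.1 hij, pow_add, mul_smul, smul_comm]
        rw [map_smul]
        congr 1
        rw [← smul_apply, Finset.smul_sum]
        congr 1
        refine Finset.sum_congr rfl fun ab hab => ?_
        rw [← mem_antidiagonal.1 hab, pow_add, mul_smul]
        rw [map_smul, map_smul, smul_apply, smul_comm]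
      rw [tsum_congr hterm]
      have hsumm : Summable fun n : ℕ => ((n : ℝ) * t ^ (n - 1)) • u n s := by
        rw [← summable_nat_add_iff 1]
        have := (summable_norm_sum_bilinear_antidiagonal (ContinuousLinearMap.id ℝ (V →L[ℝ] V))
          (summable_norm_sum_bilinear_antidiagonal T hsu hsu) hsd).of_norm
        simp only [ContinuousLinearMap.id_apply] at this
        exact this.congr hterm
      rw [hsumm.tsum_eq_zero_add]
      simp
    rw [(hderiv t ht s).deriv, hR]
    have hsn : Summable fun n : ℕ => C * (4 * L) * ((n : ℝ) * (1 / 2) ^ n) := by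
      have := summable_pow_mul_geometric_of_norm_lt_one 1 (r := (1 / 2 : ℝ)) (by norm_num)
      simpa using this.mul_left (C * (4 * L))
    refine hasDerivAt_tsum_of_isPreconnected hsn isOpen_Ioo isPreconnected_Ioo
      (g := fun n t => t ^ n • u n s) (g' := fun n t => ((n : ℝ) * t ^ (n - 1)) • u n s)
      (fun n y _ => (hasDerivAt_pow n y).smul_const (u n s)) ?_ ht
      (Summable.of_norm_bounded hs0 fun n => hb0 n s t ht) ht
    intro n y hy
    rcases n with _ | n
    · simp
    · simp only [add_tsub_cancel_right]
      rw [norm_smul, norm_mul, norm_pow, Real.norm_eq_abs, Real.norm_eq_abs,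
        abs_of_nonneg (by positivity : (0 : ℝ) ≤ ((n + 1 : ℕ) : ℝ))]
      have h1 : ‖u (n + 1) s‖ ≤ C * (2 * L) ^ (n + 1) := by simpa using hub (n + 1) 0 s
      calc ((n + 1 : ℕ) : ℝ) * |y| ^ n * ‖u (n + 1) s‖
          ≤ ((n + 1 : ℕ) : ℝ) * |y| ^ n * (C * (2 * L) ^ (n + 1)) := by gcongr
        _ = ((n + 1 : ℕ) : ℝ) * C * (2 * L) * (|y| ^ n * (2 * L) ^ n) := by ring
        _ ≤ ((n + 1 : ℕ) : ℝ) * C * (2 * L) * (1 / 2) ^ n := by gcongr; exact hpow n y hy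
        _ = _ := by ring
  · refine continuousOn_tsum (u := fun n : ℕ => (C * (1 / 2) ^ n : ℝ)) (fun n => ?_) hs0
      fun n q hq => hb0 n q.1 q.2 hq.2
    have := (hck n).1.continuous
    fun_prop
  · have : ContinuousOn (fun q : ℝ × ℝ => ∑' n, q.2 ^ n • deriv (u n) q.1)
        (univ ×ˢ Ioo (-δ) δ) := by
      refine continuousOn_tsum (u := fun n : ℕ => (C * (2 * ρ) * (1 / 2) ^ n : ℝ)) (fun n => ?_) hs1
        fun n q hq => hb1 n q.1 q.2 hq.2
      have := (hck n).1.continuous_deriv (by simp)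
      fun_prop
    exact this.congr fun q hq => (hderiv q.2 hq.2 q.1).deriv

end CauchyKovalevskaya

end AxiMHD

namespace AxiMHD

section Hodograph

set_option maxSynthPendingDepth 3

/-- `(R, Z)`, with `s`-derivatives `(Rs, Zs)`, solves the hodograph system
`∂ₜ R = ∂ₛ Z / (m R)`, `∂ₜ Z = - ∂ₛ R / (m R)` for `|t| < δ` and extends the curve `γ`. -/
structure IsHodograph (γ : ℝ → E2) (m : ℝ → ℝ) (δ : ℝ) (R Z Rs Zs : ℝ → ℝ → ℝ) : Prop where
  pos : 0 < δ
  continuous_m : Continuous m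
  periodic_m : Function.Periodic m 1
  m_ne : ∀ s, m s ≠ 0
  init_R : ∀ s, R s 0 = γ s 0
  init_Z : ∀ s, Z s 0 = γ s 1
  per_R : ∀ s t, R (s + 1) t = R s t
  per_Z : ∀ s t, Z (s + 1) t = Z s t
  per_Rs : ∀ s t, Rs (s + 1) t = Rs s t
  per_Zs : ∀ s t, Zs (s + 1) t = Zs s t
  R_pos : ∀ s, ∀ t, 0 < R s t
  smooth_R : ∀ t ∈ Ioo (-δ) δ, ContDiff ℝ ∞ fun s => R s t
  smooth_Z : ∀ t ∈ Ioo (-δ) δ, ContDiff ℝ ∞ fun s => Z s t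
  dR_s : ∀ t ∈ Ioo (-δ) δ, ∀ s, HasDerivAt (fun s => R s t) (Rs s t) s
  dZ_s : ∀ t ∈ Ioo (-δ) δ, ∀ s, HasDerivAt (fun s => Z s t) (Zs s t) s
  dR_t : ∀ t ∈ Ioo (-δ) δ, ∀ s, HasDerivAt (fun t => R s t) (Zs s t / (m s * R s t)) t
  dZ_t : ∀ t ∈ Ioo (-δ) δ, ∀ s, HasDerivAt (fun t => Z s t) (-(Rs s t / (m s * R s t))) t
  cont_R : ContinuousOn (fun q : ℝ × ℝ => R q.1 q.2) (univ ×ˢ Ioo (-δ) δ)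
  cont_Z : ContinuousOn (fun q : ℝ × ℝ => Z q.1 q.2) (univ ×ˢ Ioo (-δ) δ)
  cont_Rs : ContinuousOn (fun q : ℝ × ℝ => Rs q.1 q.2) (univ ×ˢ Ioo (-δ) δ)
  cont_Zs : ContinuousOn (fun q : ℝ × ℝ => Zs q.1 q.2) (univ ×ˢ Ioo (-δ) δ)

theorem IsHodograph.mono {γ : ℝ → E2} {m : ℝ → ℝ} {δ δ' : ℝ} {R Z Rs Zs : ℝ → ℝ → ℝ}
    (h : IsHodograph γ m δ R Z Rs Zs) (hδ' : 0 < δ') (hle : δ' ≤ δ) :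
    IsHodograph γ m δ' R Z Rs Zs := by
  have hsub : Ioo (-δ') δ' ⊆ Ioo (-δ) δ := Ioo_subset_Ioo (by linarith) hle
  have hsub2 : (univ : Set ℝ) ×ˢ Ioo (-δ') δ' ⊆ univ ×ˢ Ioo (-δ) δ := prod_mono_right hsub
  exact { h with
    pos := hδ'
    smooth_R := fun t ht => h.smooth_R t (hsub ht)
    smooth_Z := fun t ht => h.smooth_Z t (hsub ht)
    dR_s := fun t ht => h.dR_s t (hsub ht)
    dZ_s := fun t ht => h.dZ_s t (hsub ht)
    dR_t := fun t ht => h.dR_t t (hsub ht)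
    dZ_t := fun t ht => h.dZ_t t (hsub ht)
    cont_R := h.cont_R.mono hsub2
    cont_Z := h.cont_Z.mono hsub2
    cont_Rs := h.cont_Rs.mono hsub2
    cont_Zs := h.cont_Zs.mono hsub2 }

/-- Reversing `t` amounts to reversing the sign of `m`. -/
theorem IsHodograph.reflect {γ : ℝ → E2} {m : ℝ → ℝ} {δ : ℝ} {R Z Rs Zs : ℝ → ℝ → ℝ}
    (h : IsHodograph γ m δ R Z Rs Zs) :
    IsHodograph γ (fun s => -m s) δ (fun s t => R s (-t)) (fun s t => Z s (-t))
      (fun s t => Rs s (-t)) (fun s t => Zs s (-t)) := by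
  have hneg : ∀ t ∈ Ioo (-δ) δ, -t ∈ Ioo (-δ) δ := fun t ht =>
    ⟨by linarith [ht.2], by linarith [ht.1]⟩
  have hc : ∀ f : ℝ → ℝ → ℝ, ContinuousOn (fun q : ℝ × ℝ => f q.1 q.2) (univ ×ˢ Ioo (-δ) δ) →
      ContinuousOn (fun q : ℝ × ℝ => f q.1 (-q.2)) (univ ×ˢ Ioo (-δ) δ) := by
    intro f hf
    have hg : ContinuousOn (fun q : ℝ × ℝ => (q.1, -q.2)) (univ ×ˢ Ioo (-δ) δ) := by fun_prop
    exact hf.comp hg fun q hq => ⟨mem_univ _, hneg _ hq.2⟩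
  exact
  { pos := h.pos
    continuous_m := h.continuous_m.neg
    periodic_m := fun s => by simp only [h.periodic_m s]
    m_ne := fun s => neg_ne_zero.2 (h.m_ne s)
    init_R := fun s => by simp [h.init_R]
    init_Z := fun s => by simp [h.init_Z]
    per_R := fun s t => h.per_R s _
    per_Z := fun s t => h.per_Z s _
    per_Rs := fun s t => h.per_Rs s _
    per_Zs := fun s t => h.per_Zs s _
    R_pos := fun s t => h.R_pos s _
    smooth_R := fun t ht => h.smooth_R _ (hneg t ht)
    smooth_Z := fun t ht => h.smooth_Z _ (hneg t ht)
    dR_s := fun t ht => h.dR_s _ (hneg t ht)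
    dZ_s := fun t ht => h.dZ_s _ (hneg t ht)
    dR_t := fun t ht s => by
      have := (h.dR_t _ (hneg t ht) s).scomp t (hasDerivAt_neg t)
      refine this.congr_deriv ?_
      rw [neg_mul, div_neg, neg_smul, one_smul]
    dZ_t := fun t ht s => by
      have := (h.dZ_t _ (hneg t ht) s).scomp t (hasDerivAt_neg t)
      refine this.congr_deriv ?_
      rw [neg_mul, div_neg, neg_smul, one_smul]
    cont_R := hc R h.cont_R
    cont_Z := hc Z h.cont_Z
    cont_Rs := hc Rs h.cont_Rs
    cont_Zs := hc Zs h.cont_Zs }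

/-- The trilinear map `(x, y, z) ↦ xᵢ yⱼ zₖ v`. -/
noncomputable def trilinearTerm {n : ℕ} (i j k : Fin n) (v : Fin n → ℝ) :
    (Fin n → ℝ) →L[ℝ] (Fin n → ℝ) →L[ℝ] (Fin n → ℝ) →L[ℝ] (Fin n → ℝ) :=
  (ContinuousLinearMap.proj i).smulRight ((ContinuousLinearMap.proj j).smulRight
    ((ContinuousLinearMap.proj k).smulRight v))

theorem trilinearTerm_apply {n : ℕ} (i j k : Fin n) (v x y z : Fin n → ℝ) :
    trilinearTerm i j k v x y z = (x i * y j * z k) • v := by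
  simp [trilinearTerm, smul_smul]

theorem eq_of_hasDerivAt_zero {f : ℝ → ℝ} {δ t : ℝ} (h : ∀ t ∈ Ioo (-δ) δ, HasDerivAt f 0 t)
    (ht : t ∈ Ioo (-δ) δ) : f t = f 0 := by
  have h0 : (0 : ℝ) ∈ Ioo (-δ) δ := ⟨by linarith [ht.1, ht.2], by linarith [ht.1, ht.2]⟩
  exact isOpen_Ioo.is_const_of_deriv_eq_zero isPreconnected_Ioo
    (fun t ht => (h t ht).differentiableAt.differentiableWithinAt)
    (fun t ht => (h t ht).deriv) ht h0

theorem exists_isHodograph {γ : ℝ → E2} {m : ℝ → ℝ} (hγ : ∀ s, AnalyticAt ℝ γ s)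
    (hγper : Function.Periodic γ 1) (hpos : ∀ s, 0 < γ s 0) (hm : ∀ s, AnalyticAt ℝ m s)
    (hmper : Function.Periodic m 1) (hmne : ∀ s, m s ≠ 0) :
    ∃ δ R Z Rs Zs, IsHodograph γ m δ R Z Rs Zs := by
  set T : (Fin 5 → ℝ) →L[ℝ] (Fin 5 → ℝ) →L[ℝ] (Fin 5 → ℝ) →L[ℝ] (Fin 5 → ℝ) :=
    trilinearTerm (n := 5) 4 0 3 (Pi.single 2 1) - trilinearTerm (n := 5) 1 0 2 (Pi.single 3 1)
      - (2 : ℝ) • trilinearTerm (n := 5) 4 4 3 (Pi.single 4 1) with hT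
  set u₀ : ℝ → Fin 5 → ℝ := fun s => ![1, (m s)⁻¹, Real.log (γ s 0), γ s 1,
    (m s)⁻¹ * (γ s 0)⁻¹ ^ 2] with hu₀
  have hγi : ∀ i s, AnalyticAt ℝ (fun s => γ s i) s := fun i s =>
    (EuclideanSpace.proj i : E2 →L[ℝ] ℝ).analyticAt _ |>.comp (hγ s)
  have ha : ∀ s, AnalyticAt ℝ u₀ s := by
    intro s
    rw [analyticAt_pi_iff]
    intro i
    fin_cases i
    · exact analyticAt_const
    · exact (hm s).inv (hmne s)
    · exact (hγi 0 s).log (hpos s)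
    · exact hγi 1 s
    · exact ((hm s).inv (hmne s)).mul (((hγi 0 s).inv (hpos s).ne').pow 2)
  have hper : Function.Periodic u₀ 1 := by
    intro s
    simp only [hu₀, hγper s, hmper s]
  obtain ⟨δ, hδ, U, hU0, hUper, hUsm, hUt, hUc, hUsc⟩ :=
    exists_solution_of_analytic_periodic T ha hper
  have hUi : ∀ i, ∀ t ∈ Ioo (-δ) δ, ContDiff ℝ ∞ fun s => U s t i := fun i t ht =>
    contDiff_pi.1 (hUsm t ht) i
  have hUs : ∀ i, ∀ t ∈ Ioo (-δ) δ, ∀ s,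
      HasDerivAt (fun s => U s t i) (deriv (fun s => U s t) s i) s := by
    intro i t ht s
    have := ((hUsm t ht).differentiable (by simp) s).hasDerivAt
    exact hasDerivAt_pi.1 this i
  have hUti : ∀ i, ∀ t ∈ Ioo (-δ) δ, ∀ s, HasDerivAt (fun t => U s t i)
      (T (U s t) (U s t) (deriv (fun s => U s t) s) i) t := fun i t ht s =>
    hasDerivAt_pi.1 (hUt t ht s) i
  simp only [hT, sub_apply, smul_apply, trilinearTerm_apply] at hUti
  have hone : ∀ s, ∀ t ∈ Ioo (-δ) δ, U s t 0 = 1 := by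
    intro s t ht
    have h := eq_of_hasDerivAt_zero (f := fun t => U s t 0)
      (fun t ht => by simpa using hUti 0 t ht s) ht
    rw [h, hU0]; rfl
  have hmu : ∀ s, ∀ t ∈ Ioo (-δ) δ, U s t 1 = (m s)⁻¹ := by
    intro s t ht
    have h := eq_of_hasDerivAt_zero (f := fun t => U s t 1)
      (fun t ht => by simpa using hUti 1 t ht s) ht
    rw [h, hU0]; rfl
  have h2 : ∀ s, ∀ t ∈ Ioo (-δ) δ, HasDerivAt (fun t => U s t 2)
      (U s t 4 * deriv (fun s => U s t) s 3) t := by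
    intro s t ht
    have := hUti 2 t ht s
    simpa [hone s t ht] using this
  have h3 : ∀ s, ∀ t ∈ Ioo (-δ) δ, HasDerivAt (fun t => U s t 3)
      (-((m s)⁻¹ * deriv (fun s => U s t) s 2)) t := by
    intro s t ht
    have := hUti 3 t ht s
    simpa [hone s t ht, hmu s t ht] using this
  have h4 : ∀ s, ∀ t ∈ Ioo (-δ) δ, HasDerivAt (fun t => U s t 4)
      (-(2 * (U s t 4 * U s t 4 * deriv (fun s => U s t) s 3))) t := by
    intro s t ht
    have := hUti 4 t ht s
    simpa [hone s t ht, hmu s t ht] using this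
  have ha4 : ∀ s, ∀ t ∈ Ioo (-δ) δ, U s t 4 = (m s)⁻¹ * (Real.exp (U s t 2))⁻¹ ^ 2 := by
    intro s t ht
    have h := eq_of_hasDerivAt_zero (f := fun t => U s t 4 * Real.exp (U s t 2) ^ 2)
      (fun t ht => by
        refine ((h4 s t ht).mul ((h2 s t ht).exp.fun_pow 2)).congr_deriv ?_
        ring) ht
    have h0 : U s 0 4 * Real.exp (U s 0 2) ^ 2 = (m s)⁻¹ := by
      rw [hU0]
      simp only [hu₀]
      show (m s)⁻¹ * (γ s 0)⁻¹ ^ 2 * Real.exp (Real.log (γ s 0)) ^ 2 = _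
      rw [Real.exp_log (hpos s)]
      have := (hpos s).ne'
      field_simp
    rw [h0] at h
    rw [← h]
    field_simp
  have hci : ∀ i, ContinuousOn (fun q : ℝ × ℝ => U q.1 q.2 i) (univ ×ˢ Ioo (-δ) δ) := fun i =>
    continuousOn_pi.1 hUc i
  have hcsi : ∀ i, ContinuousOn (fun q : ℝ × ℝ => deriv (fun s => U s q.2) q.1 i)
      (univ ×ˢ Ioo (-δ) δ) := fun i => continuousOn_pi.1 hUsc i
  have hperd : ∀ s t, deriv (fun s => U s t) (s + 1) = deriv (fun s => U s t) s := by
    intro s t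
    rw [← deriv_comp_add_const]
    congr 1
    funext y
    exact hUper t y
  refine ⟨δ, fun s t => Real.exp (U s t 2), fun s t => U s t 3,
    fun s t => Real.exp (U s t 2) * deriv (fun s => U s t) s 2,
    fun s t => deriv (fun s => U s t) s 3, ?_⟩
  exact
  { pos := hδ
    continuous_m := continuous_iff_continuousAt.2 fun s => (hm s).continuousAt
    periodic_m := hmper
    m_ne := hmne
    init_R := fun s => by
      rw [hU0]
      exact Real.exp_log (hpos s)
    init_Z := fun s => by rw [hU0]; rfl
    per_R := fun s t => by
      have : U (s + 1) t = U s t := hUper t s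
      rw [this]
    per_Z := fun s t => by
      have : U (s + 1) t = U s t := hUper t s
      rw [this]
    per_Rs := fun s t => by
      have : U (s + 1) t = U s t := hUper t s
      rw [this, hperd]
    per_Zs := fun s t => by rw [hperd]
    R_pos := fun s t => Real.exp_pos _
    smooth_R := fun t ht => (hUi 2 t ht).exp
    smooth_Z := fun t ht => hUi 3 t ht
    dR_s := fun t ht s => (hUs 2 t ht s).exp
    dZ_s := fun t ht s => hUs 3 t ht s
    dR_t := fun t ht s => by
      refine (h2 s t ht).exp.congr_deriv ?_
      rw [ha4 s t ht]
      have := Real.exp_pos (U s t 2)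
      have := hmne s
      field_simp
    dZ_t := fun t ht s => by
      refine (h3 s t ht).congr_deriv ?_
      have := Real.exp_pos (U s t 2)
      have := hmne s
      field_simp
    cont_R := (hci 2).rexp
    cont_Z := hci 3
    cont_Rs := (hci 2).rexp.mul (hcsi 2)
    cont_Zs := hcsi 3 }

end Hodograph

end AxiMHD

namespace AxiMHD

section Collar

theorem hasStrictFDerivAt_of_partials {f fs ft : ℝ → ℝ → ℝ} {O : Set ℝ} (hO : IsOpen O)
    (hs : ∀ t ∈ O, ∀ s, HasDerivAt (fun s => f s t) (fs s t) s)
    (ht : ∀ t ∈ O, ∀ s, HasDerivAt (fun t => f s t) (ft s t) t)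
    (hcs : ContinuousOn (fun q : ℝ × ℝ => fs q.1 q.2) (univ ×ˢ O))
    (hct : ContinuousOn (fun q : ℝ × ℝ => ft q.1 q.2) (univ ×ˢ O)) {q : ℝ × ℝ} (hq : q.2 ∈ O) :
    HasStrictFDerivAt (fun q : ℝ × ℝ => f q.1 q.2)
      (fs q.1 q.2 • ContinuousLinearMap.fst ℝ ℝ ℝ + ft q.1 q.2 • ContinuousLinearMap.snd ℝ ℝ ℝ)
      q := by
  have hopen : (univ : Set ℝ) ×ˢ O ∈ 𝓝 q := (isOpen_univ.prod hO).mem_nhds ⟨mem_univ _, hq⟩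
  have key := hasStrictFDerivAt_uncurry_coprod (𝕜 := ℝ) (u := q) (f := f)
    (f₁ := fun s t => fs s t • ContinuousLinearMap.id ℝ ℝ)
    (f₂ := fun s t => ft s t • ContinuousLinearMap.id ℝ ℝ) ?_ ?_ ?_ ?_
  · refine key.congr_fderiv ?_
    ext <;> simp [Function.HasUncurry.uncurry]
  · filter_upwards [hopen] with v hv
    refine (hs v.2 hv.2 v.1).hasFDerivAt.congr_fderiv ?_
    ext; simp [Function.HasUncurry.uncurry]
  · filter_upwards [hopen] with v hv
    refine (ht v.2 hv.2 v.1).hasFDerivAt.congr_fderiv ?_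
    ext; simp [Function.HasUncurry.uncurry]
  · exact (hcs.continuousAt hopen).smul continuousAt_const
  · exact (hct.continuousAt hopen).smul continuousAt_const

variable {γ : ℝ → E2} {m : ℝ → ℝ} {δ : ℝ} {R Z Rs Zs : ℝ → ℝ → ℝ}

theorem IsHodograph.cont_Rt (h : IsHodograph γ m δ R Z Rs Zs) :
    ContinuousOn (fun q : ℝ × ℝ => Zs q.1 q.2 / (m q.1 * R q.1 q.2)) (univ ×ˢ Ioo (-δ) δ) :=
  h.cont_Zs.div ((h.continuous_m.comp continuous_fst).continuousOn.mul h.cont_R)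
    fun _ _ => mul_ne_zero (h.m_ne _) (h.R_pos _ _).ne'

theorem IsHodograph.cont_Zt (h : IsHodograph γ m δ R Z Rs Zs) :
    ContinuousOn (fun q : ℝ × ℝ => -(Rs q.1 q.2 / (m q.1 * R q.1 q.2))) (univ ×ˢ Ioo (-δ) δ) :=
  (h.cont_Rs.div ((h.continuous_m.comp continuous_fst).continuousOn.mul h.cont_R)
    fun _ _ => mul_ne_zero (h.m_ne _) (h.R_pos _ _).ne').neg

theorem IsHodograph.hasStrictFDerivAt_R (h : IsHodograph γ m δ R Z Rs Zs) {q : ℝ × ℝ}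
    (hq : q.2 ∈ Ioo (-δ) δ) : HasStrictFDerivAt (fun q : ℝ × ℝ => R q.1 q.2)
      (Rs q.1 q.2 • ContinuousLinearMap.fst ℝ ℝ ℝ
        + (Zs q.1 q.2 / (m q.1 * R q.1 q.2)) • ContinuousLinearMap.snd ℝ ℝ ℝ) q :=
  hasStrictFDerivAt_of_partials (ft := fun s t => Zs s t / (m s * R s t)) isOpen_Ioo
    h.dR_s h.dR_t h.cont_Rs h.cont_Rt hq

theorem IsHodograph.hasStrictFDerivAt_Z (h : IsHodograph γ m δ R Z Rs Zs) {q : ℝ × ℝ}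
    (hq : q.2 ∈ Ioo (-δ) δ) : HasStrictFDerivAt (fun q : ℝ × ℝ => Z q.1 q.2)
      (Zs q.1 q.2 • ContinuousLinearMap.fst ℝ ℝ ℝ
        + (-(Rs q.1 q.2 / (m q.1 * R q.1 q.2))) • ContinuousLinearMap.snd ℝ ℝ ℝ) q :=
  hasStrictFDerivAt_of_partials (ft := fun s t => -(Rs s t / (m s * R s t))) isOpen_Ioo
    h.dZ_s h.dZ_t h.cont_Zs h.cont_Zt hq

/-- Where the curves `t = const` are regular the hodograph map is a local diffeomorphism. -/
theorem IsHodograph.exists_equiv (h : IsHodograph γ m δ R Z Rs Zs) {q : ℝ × ℝ}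
    (hq : q.2 ∈ Ioo (-δ) δ) (hreg : 0 < Rs q.1 q.2 ^ 2 + Zs q.1 q.2 ^ 2) :
    ∃ A : (ℝ × ℝ) ≃L[ℝ] (ℝ × ℝ), HasStrictFDerivAt (fun q : ℝ × ℝ => (R q.1 q.2, Z q.1 q.2))
      (A : (ℝ × ℝ) →L[ℝ] (ℝ × ℝ)) q := by
  have hd := (h.hasStrictFDerivAt_R hq).prodMk (h.hasStrictFDerivAt_Z hq)
  set D := ((Rs q.1 q.2 • ContinuousLinearMap.fst ℝ ℝ ℝ
        + (Zs q.1 q.2 / (m q.1 * R q.1 q.2)) • ContinuousLinearMap.snd ℝ ℝ ℝ).prod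
    (Zs q.1 q.2 • ContinuousLinearMap.fst ℝ ℝ ℝ
        + (-(Rs q.1 q.2 / (m q.1 * R q.1 q.2))) • ContinuousLinearMap.snd ℝ ℝ ℝ)) with hD
  have hinj : Function.Injective (D : (ℝ × ℝ) →ₗ[ℝ] (ℝ × ℝ)) := by
    rw [← LinearMap.ker_eq_bot, LinearMap.ker_eq_bot']
    rintro ⟨x, y⟩ hxy
    have hmR : m q.1 * R q.1 q.2 ≠ 0 := mul_ne_zero (h.m_ne _) (h.R_pos _ _).ne'
    simp only [hD, ContinuousLinearMap.coe_coe, ContinuousLinearMap.prod_apply, add_apply,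
      smul_apply, ContinuousLinearMap.coe_fst', ContinuousLinearMap.coe_snd', smul_eq_mul,
      Prod.mk_eq_zero] at hxy
    obtain ⟨h1, h2⟩ := hxy
    set a := Rs q.1 q.2
    set b := Zs q.1 q.2
    set k := m q.1 * R q.1 q.2
    have hx : (a ^ 2 + b ^ 2) * x = 0 := by linear_combination a * h1 + b * h2
    have hy : (a ^ 2 + b ^ 2) * (y / k) = 0 := by linear_combination b * h1 - a * h2
    have hx' : x = 0 := (mul_eq_zero.1 hx).resolve_left hreg.ne'
    have hy' : y / k = 0 := (mul_eq_zero.1 hy).resolve_left hreg.ne'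
    have hy'' : y = 0 := (div_eq_zero_iff.1 hy').resolve_right hmR
    simp [hx', hy'']
  refine ⟨(LinearEquiv.ofInjectiveEndo (D : (ℝ × ℝ) →ₗ[ℝ] (ℝ × ℝ)) hinj).toContinuousLinearEquiv,
    hd.congr_fderiv ?_⟩
  ext <;> rfl

/-- A hodograph solution whose map is a diffeomorphism, up to the period, onto a collar of `γ`. -/
structure IsCollar (γ : ℝ → E2) (m : ℝ → ℝ) (δ : ℝ) (R Z Rs Zs : ℝ → ℝ → ℝ) : Prop extends
    IsHodograph γ m δ R Z Rs Zs where
  regular : ∀ s, ∀ t ∈ Ioo (-δ) δ, 0 < Rs s t ^ 2 + Zs s t ^ 2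
  inj : ∀ s s', ∀ t ∈ Ioo (-δ) δ, ∀ t' ∈ Ioo (-δ) δ, R s t = R s' t' → Z s t = Z s' t' →
    t = t' ∧ ∃ n : ℤ, s = s' + n

theorem IsCollar.reflect (h : IsCollar γ m δ R Z Rs Zs) :
    IsCollar γ (fun s => -m s) δ (fun s t => R s (-t)) (fun s t => Z s (-t))
      (fun s t => Rs s (-t)) (fun s t => Zs s (-t)) := by
  have hneg : ∀ t ∈ Ioo (-δ) δ, -t ∈ Ioo (-δ) δ := fun t ht =>
    ⟨by linarith [ht.2], by linarith [ht.1]⟩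
  refine ⟨h.toIsHodograph.reflect, fun s t ht => h.regular s _ (hneg t ht),
    fun s s' t ht t' ht' h1 h2 => ?_⟩
  obtain ⟨h3, h4⟩ := h.inj s s' _ (hneg t ht) _ (hneg t' ht') h1 h2
  exact ⟨neg_injective h3, h4⟩

theorem periodic_int {X : Type*} {f : ℝ → X} (hf : ∀ s, f (s + 1) = f s) (s : ℝ) (n : ℤ) :
    f (s + n) = f s := by
  have := (show Function.Periodic f 1 from hf).int_mul n s
  simpa using this

theorem eq_add_int_of_eq {X : Type*} {γ : ℝ → X} (hper : Function.Periodic γ 1)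
    (hinj : InjOn γ (Ico 0 1)) {s s' : ℝ} (h : γ s = γ s') : ∃ n : ℤ, s = s' + n := by
  have hf : ∀ x, γ (Int.fract x) = γ x := fun x => by
    have := periodic_int hper (Int.fract x) ⌊x⌋
    rw [← this, Int.fract_add_floor]
  have h1 : Int.fract s = Int.fract s' :=
    hinj ⟨Int.fract_nonneg _, Int.fract_lt_one _⟩ ⟨Int.fract_nonneg _, Int.fract_lt_one _⟩
      (by rw [hf, hf, h])
  refine ⟨⌊s⌋ - ⌊s'⌋, ?_⟩
  have h2 := Int.fract_add_floor s
  have h3 := Int.fract_add_floor s'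
  push_cast
  linarith

theorem IsHodograph.exists_isCollar (h : IsHodograph γ m δ R Z Rs Zs)
    (hper : Function.Periodic γ 1) (hinj : InjOn γ (Ico 0 1)) (hreg : ∀ s, deriv γ s ≠ 0)
    (hdiff : Differentiable ℝ γ) : ∃ δ', IsCollar γ m δ' R Z Rs Zs := by
  have h0 : (0 : ℝ) ∈ Ioo (-δ) δ := ⟨by linarith [h.pos], h.pos⟩
  have hmem : ∀ s : ℝ, (univ : Set ℝ) ×ˢ Ioo (-δ) δ ∈ 𝓝 (s, (0 : ℝ)) := fun s =>
    (isOpen_univ.prod isOpen_Ioo).mem_nhds ⟨mem_univ _, h0⟩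
  have hγ0 : ∀ s i, HasDerivAt (fun s => γ s i) (deriv γ s i) s := fun s i =>
    ((EuclideanSpace.proj i : E2 →L[ℝ] ℝ).hasFDerivAt.comp_hasDerivAt s (hdiff s).hasDerivAt)
  have hreg0 : ∀ s, 0 < Rs s 0 ^ 2 + Zs s 0 ^ 2 := by
    intro s
    have h1 : Rs s 0 = deriv γ s 0 := by
      refine (h.dR_s 0 h0 s).unique ?_
      simpa only [h.init_R] using hγ0 s 0
    have h2 : Zs s 0 = deriv γ s 1 := by
      refine (h.dZ_s 0 h0 s).unique ?_
      simpa only [h.init_Z] using hγ0 s 1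
    by_contra hcon
    push Not at hcon
    apply hreg s
    ext i
    fin_cases i
    · show deriv γ s 0 = 0
      rw [← h1]; nlinarith [sq_nonneg (Rs s 0), sq_nonneg (Zs s 0)]
    · show deriv γ s 1 = 0
      rw [← h2]; nlinarith [sq_nonneg (Rs s 0), sq_nonneg (Zs s 0)]
  have hev1 : ∀ᶠ t in 𝓝 (0 : ℝ), ∀ s ∈ Icc (0 : ℝ) 1, 0 < Rs s t ^ 2 + Zs s t ^ 2 := by
    refine isCompact_Icc.eventually_forall_of_forall_eventually fun s _ => ?_
    have hc : ContinuousAt (fun q : ℝ × ℝ => Rs q.1 q.2 ^ 2 + Zs q.1 q.2 ^ 2) (s, 0) :=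
      ((h.cont_Rs.continuousAt (hmem s)).pow 2).add ((h.cont_Zs.continuousAt (hmem s)).pow 2)
    have hsw : Tendsto (Prod.swap : ℝ × ℝ → ℝ × ℝ) (𝓝 (0, s)) (𝓝 (s, 0)) :=
      continuous_swap.tendsto' _ _ rfl
    exact hsw.eventually (hc.eventually (lt_mem_nhds (hreg0 s)))
  set Φ : ℝ × ℝ → ℝ × ℝ := fun q => (R q.1 q.2, Z q.1 q.2) with hΦ
  have hΦc : ∀ s : ℝ, ContinuousAt Φ (s, 0) := fun s =>
    (h.cont_R.continuousAt (hmem s)).prodMk (h.cont_Z.continuousAt (hmem s))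
  have hΦper : ∀ (s t : ℝ) (n : ℤ), Φ (s + n, t) = Φ (s, t) := by
    intro s t n
    simp only [hΦ]
    rw [periodic_int (f := fun s => R s t) (fun s => h.per_R s t) s n,
      periodic_int (f := fun s => Z s t) (fun s => h.per_Z s t) s n]
  have hev2 : ∀ᶠ tt in 𝓝 ((0 : ℝ), (0 : ℝ)), ∀ ss ∈ Icc (0 : ℝ) 1 ×ˢ Icc (0 : ℝ) 1,
      Φ (ss.1, tt.1) = Φ (ss.2, tt.2) → tt.1 = tt.2 ∧ ∃ n : ℤ, ss.1 = ss.2 + n := by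
    refine (isCompact_Icc.prod isCompact_Icc).eventually_forall_of_forall_eventually ?_
    rintro ⟨s, s'⟩ _
    have hc1 : Tendsto (fun z : (ℝ × ℝ) × (ℝ × ℝ) => (z.2.1, z.1.1)) (𝓝 ((0, 0), (s, s')))
        (𝓝 (s, 0)) := by
      have : Continuous (fun z : (ℝ × ℝ) × (ℝ × ℝ) => (z.2.1, z.1.1)) := by fun_prop
      exact this.tendsto' _ _ rfl
    have hc2 : ∀ a : ℝ, Tendsto (fun z : (ℝ × ℝ) × (ℝ × ℝ) => (z.2.2 + a, z.1.2))
        (𝓝 ((0, 0), (s, s'))) (𝓝 (s' + a, 0)) := by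
      intro a
      have : Continuous (fun z : (ℝ × ℝ) × (ℝ × ℝ) => (z.2.2 + a, z.1.2)) := by fun_prop
      exact this.tendsto' _ _ rfl
    by_cases hss : γ s = γ s'
    · obtain ⟨n, hn⟩ := eq_add_int_of_eq hper hinj hss
      obtain ⟨A, hA⟩ := h.exists_equiv (q := (s, 0)) h0 (hreg0 s)
      have hinjN : InjOn Φ (hA.toOpenPartialHomeomorph Φ).source :=
        (hA.toOpenPartialHomeomorph Φ).injOn
      have hN : (hA.toOpenPartialHomeomorph Φ).source ∈ 𝓝 (s, (0 : ℝ)) :=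
        (hA.toOpenPartialHomeomorph Φ).open_source.mem_nhds hA.mem_toOpenPartialHomeomorph_source
      have hc2' := hc2 n
      rw [← hn] at hc2'
      filter_upwards [hc1.eventually hN, hc2'.eventually hN] with z hz1 hz2 hz
      rw [← hΦper z.2.2 z.1.2 n] at hz
      have := hinjN hz1 hz2 hz
      simp only [Prod.mk.injEq] at this
      exact ⟨this.2, n, this.1⟩
    · have hne : Φ (s, 0) ≠ Φ (s', 0) := by
        intro heq
        simp only [hΦ, Prod.mk.injEq, h.init_R, h.init_Z] at heq
        apply hss
        ext i
        fin_cases i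
        · exact heq.1
        · exact heq.2
      have hc2' := hc2 0
      simp only [add_zero] at hc2'
      have := ((hΦc s).tendsto.comp hc1).prodMk_nhds ((hΦc s').tendsto.comp hc2')
      have hev := this.eventually (isOpen_ne_fun continuous_fst continuous_snd |>.mem_nhds hne)
      filter_upwards [hev] with z hz hz'
      exact absurd hz' hz
  obtain ⟨ε₁, hε₁, H1⟩ := Metric.eventually_nhds_iff_ball.1 hev1
  obtain ⟨ε₂, hε₂, H2⟩ := Metric.eventually_nhds_iff_ball.1 hev2
  set δ' := min δ (min ε₁ ε₂) with hδ'
  have hδ'0 : 0 < δ' := lt_min h.pos (lt_min hε₁ hε₂)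
  have hball : ∀ t ∈ Ioo (-δ') δ', |t| < ε₁ ∧ |t| < ε₂ := by
    intro t ht
    have := abs_lt.2 ht
    exact ⟨this.trans_le ((min_le_right _ _).trans (min_le_left _ _)),
      this.trans_le ((min_le_right _ _).trans (min_le_right _ _))⟩
  have hfr : ∀ s : ℝ, Int.fract s ∈ Icc (0 : ℝ) 1 := fun s =>
    ⟨Int.fract_nonneg s, (Int.fract_lt_one s).le⟩
  refine ⟨δ', h.mono hδ'0 (min_le_left _ _), ?_, ?_⟩
  · intro s t ht
    have := H1 t (by simpa using (hball t ht).1) _ (hfr s)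
    rw [← periodic_int (f := fun s => Rs s t) (fun s => h.per_Rs s t) _ ⌊s⌋,
      ← periodic_int (f := fun s => Zs s t) (fun s => h.per_Zs s t) _ ⌊s⌋,
      Int.fract_add_floor] at this
    exact this
  · intro s s' t ht t' ht' hR hZ
    have hp : Φ (Int.fract s, t) = Φ (Int.fract s', t') := by
      rw [← hΦper _ t ⌊s⌋, ← hΦper _ t' ⌊s'⌋, Int.fract_add_floor, Int.fract_add_floor]
      exact Prod.ext hR hZ
    have hb : (t, t') ∈ Metric.ball ((0 : ℝ), (0 : ℝ)) ε₂ := by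
      rw [← ball_prod_same]
      exact ⟨by simpa using (hball t ht).2, by simpa using (hball t' ht').2⟩
    obtain ⟨h1, n, h2⟩ := H2 (t, t') hb (Int.fract s, Int.fract s') ⟨hfr s, hfr s'⟩ hp
    refine ⟨h1, n + ⌊s⌋ - ⌊s'⌋, ?_⟩
    have h3 := Int.fract_add_floor s
    have h4 := Int.fract_add_floor s'
    simp only at h2
    push_cast
    linarith

end Collar

end AxiMHD

namespace AxiMHD

section PlanarCollar

/-- The collar map, with values in the `(r, z)`-plane. -/
noncomputable def collarMap (R Z : ℝ → ℝ → ℝ) (q : ℝ × ℝ) : E2 := !₂[R q.1 q.2, Z q.1 q.2]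

/-- The identification of `ℝ × ℝ` with the Euclidean plane. -/
noncomputable def prodEquivE2 : (ℝ × ℝ) ≃L[ℝ] E2 :=
  (LinearEquiv.finTwoArrow ℝ ℝ).toContinuousLinearEquiv.symm.trans
    (PiLp.continuousLinearEquiv 2 ℝ fun _ : Fin 2 => ℝ).symm

theorem prodEquivE2_apply (p : ℝ × ℝ) : prodEquivE2 p = !₂[p.1, p.2] := by
  ext i
  fin_cases i <;> rfl

variable {γ : ℝ → E2} {m : ℝ → ℝ} {δ : ℝ} {R Z Rs Zs : ℝ → ℝ → ℝ}

theorem collarMap_eq : collarMap R Z = prodEquivE2 ∘ fun q : ℝ × ℝ => (R q.1 q.2, Z q.1 q.2) := by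
  funext q
  rw [Function.comp_apply, prodEquivE2_apply]
  rfl

theorem IsHodograph.continuousOn_collarMap (h : IsHodograph γ m δ R Z Rs Zs) :
    ContinuousOn (collarMap R Z) (univ ×ˢ Ioo (-δ) δ) := by
  rw [collarMap_eq]
  exact prodEquivE2.continuous.comp_continuousOn (h.cont_R.prodMk h.cont_Z)

theorem IsHodograph.collarMap_zero (h : IsHodograph γ m δ R Z Rs Zs) (s : ℝ) :
    collarMap R Z (s, 0) = γ s := by
  ext i
  fin_cases i
  · exact h.init_R s
  · exact h.init_Z s

theorem IsHodograph.collarMap_add_int (h : IsHodograph γ m δ R Z Rs Zs) (s t : ℝ) (n : ℤ) :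
    collarMap R Z (s + n, t) = collarMap R Z (s, t) := by
  simp only [collarMap]
  rw [periodic_int (f := fun s => R s t) (fun s => h.per_R s t) s n,
    periodic_int (f := fun s => Z s t) (fun s => h.per_Z s t) s n]

theorem IsHodograph.collarMap_fract (h : IsHodograph γ m δ R Z Rs Zs) (s t : ℝ) :
    collarMap R Z (Int.fract s, t) = collarMap R Z (s, t) := by
  rw [← h.collarMap_add_int (Int.fract s) t ⌊s⌋, Int.fract_add_floor]

theorem IsHodograph.isCompact_image (h : IsHodograph γ m δ R Z Rs Zs) {a b : ℝ} (ha : -δ < a)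
    (hb : b < δ) : IsCompact (collarMap R Z '' (univ ×ˢ Icc a b)) := by
  have heq : collarMap R Z '' (univ ×ˢ Icc a b) = collarMap R Z '' (Icc 0 1 ×ˢ Icc a b) := by
    apply Subset.antisymm
    · rintro _ ⟨⟨s, t⟩, ⟨_, ht⟩, rfl⟩
      exact ⟨(Int.fract s, t), ⟨⟨Int.fract_nonneg s, (Int.fract_lt_one s).le⟩, ht⟩,
        h.collarMap_fract s t⟩
    · exact image_mono (prod_mono_left (subset_univ _))
  rw [heq]
  refine (isCompact_Icc.prod isCompact_Icc).image_of_continuousOn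
    (h.continuousOn_collarMap.mono (prod_mono (subset_univ _) ?_))
  exact fun t ht => ⟨ha.trans_le ht.1, ht.2.trans_lt hb⟩

theorem IsHodograph.isPreconnected_image (h : IsHodograph γ m δ R Z Rs Zs) {a b : ℝ} (ha : -δ ≤ a)
    (hb : b ≤ δ) : IsPreconnected (collarMap R Z '' (univ ×ˢ Ioo a b)) :=
  (isPreconnected_univ.prod isPreconnected_Ioo).image _
    (h.continuousOn_collarMap.mono (prod_mono_right (Ioo_subset_Ioo ha hb)))

theorem IsCollar.map_nhds (h : IsCollar γ m δ R Z Rs Zs) {q : ℝ × ℝ} (hq : q.2 ∈ Ioo (-δ) δ) :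
    map (collarMap R Z) (𝓝 q) = 𝓝 (collarMap R Z q) := by
  obtain ⟨A, hA⟩ := h.exists_equiv hq (h.regular q.1 q.2 hq)
  rw [collarMap_eq, ← Filter.map_map, hA.map_nhds_eq_of_equiv]
  exact prodEquivE2.toHomeomorph.map_nhds_eq _

theorem IsCollar.isOpen_image (h : IsCollar γ m δ R Z Rs Zs) {O : Set ℝ} (hO : IsOpen O)
    (hsub : O ⊆ Ioo (-δ) δ) : IsOpen (collarMap R Z '' (univ ×ˢ O)) := by
  rw [isOpen_iff_mem_nhds]
  rintro _ ⟨q, hq, rfl⟩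
  rw [← h.map_nhds (hsub hq.2)]
  exact image_mem_map ((isOpen_univ.prod hO).mem_nhds hq)

theorem IsCollar.eq_of_collarMap_eq (h : IsCollar γ m δ R Z Rs Zs) {q q' : ℝ × ℝ}
    (hq : q.2 ∈ Ioo (-δ) δ) (hq' : q'.2 ∈ Ioo (-δ) δ) (heq : collarMap R Z q = collarMap R Z q') :
    q.2 = q'.2 ∧ ∃ n : ℤ, q.1 = q'.1 + n :=
  h.inj _ _ _ hq _ hq' (congrArg (fun x : E2 => x 0) heq) (congrArg (fun x : E2 => x 1) heq)

/-- Continuous periodic functions of the collar coordinates descend to the collar. -/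
theorem IsCollar.exists_descend (h : IsCollar γ m δ R Z Rs Zs) {Y : Type*} [TopologicalSpace Y]
    [Nonempty Y] {f : ℝ → ℝ → Y} (hf : ContinuousOn (fun q : ℝ × ℝ => f q.1 q.2)
      (univ ×ˢ Ioo (-δ) δ)) (hper : ∀ s t, f (s + 1) t = f s t) :
    ∃ g : E2 → Y, (∀ s, ∀ t ∈ Ioo (-δ) δ, g (collarMap R Z (s, t)) = f s t) ∧
      ∀ s, ∀ t ∈ Ioo (-δ) δ, ContinuousAt g (collarMap R Z (s, t)) := by
  classical
  have hval : ∃ g : E2 → Y, ∀ s, ∀ t ∈ Ioo (-δ) δ, g (collarMap R Z (s, t)) = f s t := by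
    have hch : ∀ x : E2, ∃ y : Y, ∀ s, ∀ t ∈ Ioo (-δ) δ, collarMap R Z (s, t) = x → y = f s t := by
      intro x
      by_cases hx : ∃ q : ℝ × ℝ, q.2 ∈ Ioo (-δ) δ ∧ collarMap R Z q = x
      · obtain ⟨q, hq, hqx⟩ := hx
        refine ⟨f q.1 q.2, fun s t ht hst => ?_⟩
        obtain ⟨h1, n, h2⟩ := h.eq_of_collarMap_eq (q := q) (q' := (s, t)) hq ht (hqx.trans hst.symm)
        rw [h1, h2]
        exact periodic_int (f := fun s => f s t) (fun s => hper s t) s n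
      · exact ⟨Classical.arbitrary Y, fun s t ht hst => absurd ⟨(s, t), ht, hst⟩ hx⟩
    choose g hg using hch
    exact ⟨g, fun s t ht => hg _ s t ht rfl⟩
  obtain ⟨g, hg⟩ := hval
  refine ⟨g, hg, fun s t ht => ?_⟩
  have hD : (univ : Set ℝ) ×ˢ Ioo (-δ) δ ∈ 𝓝 (s, t) :=
    (isOpen_univ.prod isOpen_Ioo).mem_nhds ⟨mem_univ _, ht⟩
  rw [ContinuousAt, ← h.map_nhds (q := (s, t)) ht, hg s t ht, tendsto_map'_iff]
  refine (hf.continuousAt hD).tendsto.congr' ?_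
  filter_upwards [hD] with q hq
  exact (hg q.1 q.2 hq.2).symm

/-- A collar of the boundary of `Ω` whose part `t > 0` lies outside `Ω`. -/
structure IsOuterCollar (Ω : Set E2) (γ : ℝ → E2) (m : ℝ → ℝ) (δ : ℝ) (R Z Rs Zs : ℝ → ℝ → ℝ) :
    Prop extends IsCollar γ m δ R Z Rs Zs where
  outside : ∀ s, ∀ t ∈ Ioo 0 δ, collarMap R Z (s, t) ∉ closure Ω
  inside : ∀ s, ∀ t ∈ Ioo (-δ) 0, collarMap R Z (s, t) ∈ Ω

variable {Ω : Set E2} {n : WithTop ℕ∞}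

theorem IsCrossSection.range_subset_closure (hΩ : IsCrossSection n Ω γ) : range γ ⊆ closure Ω := by
  rw [← hΩ.frontier_eq]
  exact frontier_subset_closure

theorem IsCrossSection.notMem (hΩ : IsCrossSection n Ω γ) (s : ℝ) : γ s ∉ Ω := by
  have h1 : γ s ∈ frontier Ω := hΩ.frontier_eq ▸ mem_range_self s
  rw [hΩ.isOpen.frontier_eq] at h1
  exact h1.2

theorem IsCrossSection.closure_eq (hΩ : IsCrossSection n Ω γ) : closure Ω = Ω ∪ range γ := by
  rw [← hΩ.frontier_eq, closure_eq_self_union_frontier]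

/-- Up to reversing `t`, every collar is an outer collar. -/
theorem IsCollar.exists_isOuterCollar (h : IsCollar γ m δ R Z Rs Zs) (hΩ : IsCrossSection n Ω γ) :
    IsOuterCollar Ω γ m δ R Z Rs Zs ∨
    IsOuterCollar Ω γ (fun s => -m s) δ (fun s t => R s (-t)) (fun s t => Z s (-t))
      (fun s t => Rs s (-t)) (fun s t => Zs s (-t)) := by
  have h0 : (0 : ℝ) ∈ Ioo (-δ) δ := ⟨by linarith [h.pos], h.pos⟩
  have hside : ∀ a b, -δ ≤ a → b ≤ δ → (0 : ℝ) ∉ Ioo a b →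
      collarMap R Z '' (univ ×ˢ Ioo a b) ⊆ Ω ∨
      collarMap R Z '' (univ ×ˢ Ioo a b) ⊆ (closure Ω)ᶜ := by
    intro a b ha hb hab
    refine (h.isPreconnected_image ha hb).subset_or_subset hΩ.isOpen
      isClosed_closure.isOpen_compl (disjoint_compl_right.mono_left subset_closure) ?_
    rintro _ ⟨q, hq, rfl⟩
    by_cases hc : collarMap R Z q ∈ closure Ω
    · rw [hΩ.closure_eq] at hc
      rcases hc with hc | ⟨s, hs⟩
      · exact Or.inl hc
      · exfalso
        rw [← h.collarMap_zero s] at hs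
        have := (h.eq_of_collarMap_eq (q := (s, 0)) h0 ⟨ha.trans_lt hq.2.1, hq.2.2.trans_le hb⟩ hs).1
        exact hab (by rw [show (0 : ℝ) = q.2 from this]; exact hq.2)
    · exact Or.inr hc
  have hsplit : ∀ t ∈ Ioo (-δ) δ, t ∈ Ioo (-δ) 0 ∨ t = 0 ∨ t ∈ Ioo 0 δ := by
    intro t ht
    rcases lt_trichotomy t 0 with h1 | h1 | h1
    · exact Or.inl ⟨ht.1, h1⟩
    · exact Or.inr (Or.inl h1)
    · exact Or.inr (Or.inr ⟨h1, ht.2⟩)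
  rcases hside (-δ) 0 le_rfl h.pos.le (by simp) with hm | hm <;>
  rcases hside 0 δ (by linarith [h.pos]) le_rfl (by simp) with hp | hp
  · exfalso
    have hopen : IsOpen (closure Ω) := by
      have : closure Ω = Ω ∪ collarMap R Z '' (univ ×ˢ Ioo (-δ) δ) := by
        rw [hΩ.closure_eq]
        apply Subset.antisymm
        · refine union_subset_union_right _ ?_
          rintro _ ⟨s, rfl⟩
          exact ⟨(s, 0), ⟨mem_univ _, h0⟩, h.collarMap_zero s⟩
        · refine union_subset subset_union_left ?_
          rintro _ ⟨⟨s, t⟩, ⟨_, ht⟩, rfl⟩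
          rcases hsplit t ht with h1 | h1 | h1
          · exact Or.inl (hm ⟨(s, t), ⟨mem_univ _, h1⟩, rfl⟩)
          · refine Or.inr ⟨s, ?_⟩
            rw [show t = 0 from h1, h.collarMap_zero]
          · exact Or.inl (hp ⟨(s, t), ⟨mem_univ _, h1⟩, rfl⟩)
      rw [this]
      exact hΩ.isOpen.union (h.isOpen_image isOpen_Ioo Subset.rfl)
    rcases isClopen_iff.1 ⟨isClosed_closure, hopen⟩ with he | he
    · exact hΩ.isConnected.nonempty.closure.ne_empty he
    · exact NormedSpace.unbounded_univ ℝ E2 (he ▸ hΩ.isBounded.closure)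
  · exact Or.inl ⟨h, fun s t ht => hp ⟨(s, t), ⟨mem_univ _, ht⟩, rfl⟩,
      fun s t ht => hm ⟨(s, t), ⟨mem_univ _, ht⟩, rfl⟩⟩
  · refine Or.inr ⟨h.reflect, fun s t ht => ?_, fun s t ht => ?_⟩
    · exact hm ⟨(s, -t), ⟨mem_univ _, by simpa using ht.2, by simpa using ht.1⟩, rfl⟩
    · exact hp ⟨(s, -t), ⟨mem_univ _, by simpa using ht.2, by linarith [ht.1]⟩, rfl⟩
  · exfalso
    have h1 : γ 0 ∈ closure Ω := hΩ.range_subset_closure (mem_range_self 0)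
    have h2 : collarMap R Z '' (univ ×ˢ Ioo (-δ) δ) ∈ 𝓝 (γ 0) :=
      (h.isOpen_image isOpen_Ioo Subset.rfl).mem_nhds
        ⟨(0, 0), ⟨mem_univ _, h0⟩, h.collarMap_zero 0⟩
    obtain ⟨x, ⟨⟨s, t⟩, ⟨_, ht⟩, rfl⟩, hx⟩ := mem_closure_iff_nhds.1 h1 _ h2
    rcases hsplit t ht with h3 | h3 | h3
    · exact hm ⟨(s, t), ⟨mem_univ _, h3⟩, rfl⟩ (subset_closure hx)
    · rw [show t = 0 from h3, h.collarMap_zero] at hx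
      exact hΩ.notMem s hx
    · exact hp ⟨(s, t), ⟨mem_univ _, h3⟩, rfl⟩ (subset_closure hx)

/-- The domain enlarged by the part `t < ε` of the collar. -/
def enlarge (Ω : Set E2) (R Z : ℝ → ℝ → ℝ) (δ ε : ℝ) : Set E2 :=
  Ω ∪ collarMap R Z '' (univ ×ˢ Ioo (-δ) ε)

theorem IsOuterCollar.closure_subset_enlarge (h : IsOuterCollar Ω γ m δ R Z Rs Zs)
    (hΩ : IsCrossSection n Ω γ) {ε : ℝ} (hε : ε ∈ Ioo 0 δ) : closure Ω ⊆ enlarge Ω R Z δ ε := by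
  rw [hΩ.closure_eq]
  refine union_subset_union_right _ ?_
  rintro _ ⟨s, rfl⟩
  exact ⟨(s, 0), ⟨mem_univ _, by linarith [h.pos], hε.1⟩, h.collarMap_zero s⟩

theorem IsOuterCollar.closure_enlarge_subset (h : IsOuterCollar Ω γ m δ R Z Rs Zs)
    {ε : ℝ} (hε : ε ∈ Ioo 0 δ) :
    closure (enlarge Ω R Z δ ε) ⊆ closure Ω ∪ collarMap R Z '' (univ ×ˢ Icc 0 ε) := by
  refine closure_minimal ?_ (isClosed_closure.union
    (h.isCompact_image (by linarith [h.pos]) hε.2).isClosed)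
  rintro x (hx | ⟨⟨s, t⟩, ⟨_, ht⟩, rfl⟩)
  · exact Or.inl (subset_closure hx)
  · rcases lt_or_ge t 0 with h1 | h1
    · exact Or.inl (subset_closure (h.inside s t ⟨ht.1, h1⟩))
    · exact Or.inr ⟨(s, t), ⟨mem_univ _, h1, ht.2.le⟩, rfl⟩

theorem IsOuterCollar.collarMap_notMem_enlarge (h : IsOuterCollar Ω γ m δ R Z Rs Zs)
    {ε : ℝ} (hε : ε ∈ Ioo 0 δ) (s : ℝ) : collarMap R Z (s, ε) ∉ enlarge Ω R Z δ ε := by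
  rintro (hx | ⟨q, ⟨_, hq⟩, hx⟩)
  · exact h.outside s ε hε (subset_closure hx)
  · have := (h.eq_of_collarMap_eq (q' := (s, ε)) ⟨hq.1, hq.2.trans hε.2⟩
      ⟨by linarith [h.pos, hε.1], hε.2⟩ hx).1
    exact absurd this hq.2.ne

theorem IsHodograph.hasDerivAt_collarMap (h : IsHodograph γ m δ R Z Rs Zs) {t : ℝ}
    (ht : t ∈ Ioo (-δ) δ) (s : ℝ) :
    HasDerivAt (fun s => collarMap R Z (s, t)) !₂[Rs s t, Zs s t] s := by
  rw [collarMap_eq, ← prodEquivE2_apply (Rs s t, Zs s t)]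
  exact prodEquivE2.toContinuousLinearMap.hasFDerivAt.comp_hasDerivAt s
    ((h.dR_s t ht s).prodMk (h.dZ_s t ht s))

theorem IsOuterCollar.isCrossSection_enlarge (h : IsOuterCollar Ω γ m δ R Z Rs Zs)
    (hΩ : IsCrossSection n Ω γ) {ε : ℝ} (hε : ε ∈ Ioo 0 δ) :
    IsCrossSection ∞ (enlarge Ω R Z δ ε) (fun s => collarMap R Z (s, ε)) := by
  have hεδ : ε ∈ Ioo (-δ) δ := ⟨by linarith [h.pos, hε.1], hε.2⟩
  have h0 : (0 : ℝ) ∈ Ioo (-δ) ε := ⟨by linarith [h.pos], hε.1⟩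
  have hopen : IsOpen (enlarge Ω R Z δ ε) :=
    hΩ.isOpen.union (h.isOpen_image isOpen_Ioo (Ioo_subset_Ioo_right hε.2.le))
  refine ⟨hopen, ?_, ?_, ?_, ?_, ?_, ?_, ?_, ?_⟩
  · refine hΩ.isConnected.union ?_ ⟨⟨_, (0, 0), ⟨mem_univ _, h0⟩, rfl⟩,
      h.isPreconnected_image le_rfl hε.2.le⟩
    refine ⟨collarMap R Z (0, -δ / 2), h.inside 0 _ ?_, (0, -δ / 2), ⟨mem_univ _, ?_⟩, rfl⟩
    · constructor <;> linarith [h.pos]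
    · constructor <;> linarith [h.pos, hε.1]
  · refine (hΩ.isBounded.closure.union
      (h.isCompact_image (by linarith [h.pos]) hε.2).isBounded).subset
      (subset_closure.trans (h.closure_enlarge_subset hε))
  · intro q hq
    rcases h.closure_enlarge_subset hε hq with hq | ⟨q', _, rfl⟩
    · exact hΩ.off_axis q hq
    · exact h.R_pos _ _
  · rw [collarMap_eq]
    exact prodEquivE2.contDiff.comp ((h.smooth_R ε hεδ).prodMk (h.smooth_Z ε hεδ))
  · intro s
    simpa using h.collarMap_add_int s ε 1
  · intro s hs s' hs' heq
    obtain ⟨_, k, hk⟩ := h.eq_of_collarMap_eq (q := (s, ε)) (q' := (s', ε)) hεδ hεδ heq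
    simp only at hk
    have hk1 : (k : ℝ) < 1 := by linarith [hs.2, hs'.1]
    have hk2 : (-1 : ℝ) < k := by linarith [hs.1, hs'.2]
    have hk0 : k = 0 := by
      have h1 : k < 1 := by exact_mod_cast hk1
      have h2 : -1 < k := by exact_mod_cast hk2
      omega
    rw [hk, hk0]; simp
  · intro s hs
    rw [(h.hasDerivAt_collarMap hεδ s).deriv] at hs
    have h1 : Rs s ε = 0 := congrArg (fun x : E2 => x 0) hs
    have h2 : Zs s ε = 0 := congrArg (fun x : E2 => x 1) hs
    have := h.regular s ε hεδ
    rw [h1, h2] at this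
    norm_num at this
  · rw [hopen.frontier_eq]
    apply Subset.antisymm
    · rintro x ⟨hx, hx'⟩
      rcases h.closure_enlarge_subset hε hx with hx | ⟨⟨s, t⟩, ⟨_, ht⟩, rfl⟩
      · exact absurd (h.closure_subset_enlarge hΩ hε hx) hx'
      · rcases ht.2.lt_or_eq with h1 | h1
        · exact absurd (Or.inr ⟨(s, t), ⟨mem_univ _, by linarith [h.pos, ht.1], h1⟩, rfl⟩) hx'
        · exact ⟨s, by simp only [h1.symm]⟩
    · rintro _ ⟨s, rfl⟩
      refine ⟨?_, h.collarMap_notMem_enlarge hε s⟩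
      have hc : ContinuousAt (fun t => collarMap R Z (s, t)) ε := by
        refine ContinuousAt.comp (f := fun t : ℝ => (s, t)) (g := collarMap R Z)
          (h.continuousOn_collarMap.continuousAt ?_) (by fun_prop)
        exact (isOpen_univ.prod isOpen_Ioo).mem_nhds ⟨mem_univ _, hεδ⟩
      refine mem_closure_of_tendsto (hc.tendsto.mono_left (nhdsWithin_le_nhds (s := Iio ε))) ?_
      filter_upwards [Ioo_mem_nhdsLT (show -δ < ε from hεδ.1)] with t ht
      exact Or.inr ⟨(s, t), ⟨mem_univ _, ht⟩, rfl⟩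

end PlanarCollar

end AxiMHD

namespace AxiMHD

section Cylindrical

theorem radius_sq (x : E3) : radius x ^ 2 = x 0 ^ 2 + x 1 ^ 2 := Real.sq_sqrt (by positivity)

@[simp] theorem cyl_zero (x : E3) : cyl x 0 = radius x := rfl

theorem continuous_radius : Continuous radius := by
  unfold radius
  fun_prop

theorem continuous_cyl : Continuous cyl := by
  have : cyl = fun x => prodEquivE2 (radius x, x 2) := by
    funext x
    rw [prodEquivE2_apply]
    rfl
  rw [this]
  have := continuous_radius
  fun_prop

theorem continuous_toLp3 {X : Type*} [TopologicalSpace X] {a b c : X → ℝ} (ha : Continuous a)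
    (hb : Continuous b) (hc : Continuous c) : Continuous fun x => (!₂[a x, b x, c x] : E3) := by
  refine (PiLp.continuous_toLp 2 _).comp (continuous_pi fun i => ?_)
  fin_cases i <;> assumption

theorem continuousOn_toLp3 {X : Type*} [TopologicalSpace X] {a b c : X → ℝ} {S : Set X}
    (ha : ContinuousOn a S) (hb : ContinuousOn b S) (hc : ContinuousOn c S) :
    ContinuousOn (fun x => (!₂[a x, b x, c x] : E3)) S := by
  refine (PiLp.continuous_toLp 2 _).comp_continuousOn (continuousOn_pi.2 fun i => ?_)
  fin_cases i <;> assumption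

theorem hasDerivAt_toLp3 {a b c : ℝ → ℝ} {a' b' c' s : ℝ} (ha : HasDerivAt a a' s)
    (hb : HasDerivAt b b' s) (hc : HasDerivAt c c' s) :
    HasDerivAt (fun s => (!₂[a s, b s, c s] : E3)) !₂[a', b', c'] s := by
  have h : HasDerivAt (fun s => ![a s, b s, c s]) ![a', b', c'] s := by
    rw [hasDerivAt_pi]
    intro i
    fin_cases i <;> assumption
  exact (PiLp.continuousLinearEquiv 2 ℝ
    fun _ : Fin 3 => ℝ).symm.toContinuousLinearMap.hasFDerivAt.comp_hasDerivAt s h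

theorem continuous_rotPoint (θ : ℝ) : Continuous (rotPoint θ) := by
  unfold rotPoint
  exact continuous_toLp3 (by fun_prop) (by fun_prop) (by fun_prop)

theorem radius_rotPoint (θ : ℝ) {q : E2} (hq : 0 ≤ q 0) : radius (rotPoint θ q) = q 0 := by
  have : (q 0 * Real.cos θ) ^ 2 + (q 0 * Real.sin θ) ^ 2 = q 0 ^ 2 := by
    linear_combination q 0 ^ 2 * Real.cos_sq_add_sin_sq θ
  show Real.sqrt ((q 0 * Real.cos θ) ^ 2 + (q 0 * Real.sin θ) ^ 2) = q 0
  rw [this, Real.sqrt_sq hq]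

theorem cyl_rotPoint (θ : ℝ) {q : E2} (hq : 0 ≤ q 0) : cyl (rotPoint θ q) = q := by
  ext i
  fin_cases i
  · exact radius_rotPoint θ hq
  · rfl

theorem eR_rotPoint (θ : ℝ) {q : E2} (hq : 0 < q 0) :
    eR (rotPoint θ q) = !₂[Real.cos θ, Real.sin θ, 0] := by
  have h := radius_rotPoint θ hq.le
  have hne := hq.ne'
  unfold eR
  rw [h]
  ext i
  fin_cases i <;> simp [rotPoint, hne]

theorem ePhi_rotPoint (θ : ℝ) {q : E2} (hq : 0 < q 0) :
    ePhi (rotPoint θ q) = !₂[-Real.sin θ, Real.cos θ, 0] := by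
  have h := radius_rotPoint θ hq.le
  have hne := hq.ne'
  unfold ePhi
  rw [h]
  ext i
  fin_cases i <;> simp [rotPoint, hne]

theorem exists_rotPoint_eq (x : E3) : ∃ θ ∈ Ioc 0 (2 * Real.pi), rotPoint θ (cyl x) = x := by
  set z : ℂ := ⟨x 0, x 1⟩ with hz
  have hnorm : ‖z‖ = radius x := by
    rw [Complex.norm_eq_sqrt_sq_add_sq]; rfl
  set θ := toIocMod Real.two_pi_pos 0 z.arg with hθ
  have hθ' : θ = z.arg - toIocDiv Real.two_pi_pos 0 z.arg * (2 * Real.pi) := by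
    rw [hθ, toIocMod, zsmul_eq_mul]
  have hmem : θ ∈ Ioc 0 (2 * Real.pi) := by
    have := toIocMod_mem_Ioc Real.two_pi_pos 0 z.arg
    rwa [zero_add] at this
  refine ⟨θ, hmem, ?_⟩
  have hc : radius x * Real.cos θ = x 0 := by
    rw [hθ', Real.cos_sub_int_mul_two_pi, ← hnorm, Complex.norm_mul_cos_arg]
  have hs : radius x * Real.sin θ = x 1 := by
    rw [hθ', Real.sin_sub_int_mul_two_pi, ← hnorm, Complex.norm_mul_sin_arg]
  ext i
  fin_cases i
  · exact hc
  · exact hs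
  · rfl

theorem rotPoint_injOn {θ θ' : ℝ} (hθ : θ ∈ Ioc 0 (2 * Real.pi)) (hθ' : θ' ∈ Ioc 0 (2 * Real.pi))
    {q q' : E2} (hq : 0 < q 0) (hq' : 0 < q' 0) (h : rotPoint θ q = rotPoint θ' q') :
    θ = θ' ∧ q = q' := by
  have hqq : q = q' := by rw [← cyl_rotPoint θ hq.le, h, cyl_rotPoint θ' hq'.le]
  refine ⟨?_, hqq⟩
  subst hqq
  have h0 : q 0 * Real.cos θ = q 0 * Real.cos θ' := congrArg (fun x : E3 => x 0) h
  have h1 : q 0 * Real.sin θ = q 0 * Real.sin θ' := congrArg (fun x : E3 => x 1) h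
  have hc := mul_left_cancel₀ hq.ne' h0
  have hs := mul_left_cancel₀ hq.ne' h1
  have hcos : Real.cos (θ - θ') = 1 := by
    rw [Real.cos_sub, hc, hs]
    linear_combination Real.cos_sq_add_sin_sq θ'
  have := (Real.cos_eq_one_iff_of_lt_of_lt (by linarith [hθ.1, hθ'.2]) (by linarith [hθ.2, hθ'.1])).1
    hcos
  linarith

theorem isOpen_torus {Ω : Set E2} (h : IsOpen Ω) : IsOpen (torus Ω) := h.preimage continuous_cyl

theorem isClosed_torus {Ω : Set E2} (h : IsClosed Ω) : IsClosed (torus Ω) :=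
  h.preimage continuous_cyl

theorem closure_torus {Ω : Set E2} (h : ∀ q ∈ closure Ω, 0 < q 0) :
    closure (torus Ω) = torus (closure Ω) := by
  apply Subset.antisymm
  · exact closure_minimal (fun x hx => subset_closure hx) (isClosed_torus isClosed_closure)
  · intro x hx
    obtain ⟨θ, _, hθ⟩ := exists_rotPoint_eq x
    rw [← hθ]
    refine map_mem_closure (continuous_rotPoint θ) hx fun q hq => ?_
    show cyl (rotPoint θ q) ∈ Ω
    rwa [cyl_rotPoint θ (h q (subset_closure hq)).le]

theorem frontier_torus {Ω : Set E2} (hΩ : IsOpen Ω) (h : ∀ q ∈ closure Ω, 0 < q 0) :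
    frontier (torus Ω) = torus (frontier Ω) := by
  rw [(isOpen_torus hΩ).frontier_eq, hΩ.frontier_eq, closure_torus h]
  rfl

theorem isCompact_torus {K : Set E2} (hK : IsCompact K) : IsCompact (torus K) := by
  have hcont : Continuous fun p : ℝ × E2 => rotPoint p.1 p.2 := by
    unfold rotPoint
    exact continuous_toLp3 (by fun_prop) (by fun_prop) (by fun_prop)
  have hsub : torus K ⊆ (fun p : ℝ × E2 => rotPoint p.1 p.2) '' (Icc 0 (2 * Real.pi) ×ˢ K) := by
    intro x hx
    obtain ⟨θ, hθ, hx'⟩ := exists_rotPoint_eq x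
    exact ⟨(θ, cyl x), ⟨⟨hθ.1.le, hθ.2⟩, hx⟩, hx'⟩
  exact ((isCompact_Icc.prod hK).image hcont).of_isClosed_subset (isClosed_torus hK.isClosed) hsub

theorem continuousAt_eR {x : E3} (hx : 0 < radius x) : ContinuousAt eR x := by
  unfold eR
  refine (continuous_radius.continuousAt.inv₀ hx.ne').smul (Continuous.continuousAt ?_)
  exact continuous_toLp3 (by fun_prop) (by fun_prop) (by fun_prop)

theorem norm_sq_frame {x : E3} (hx : 0 < radius x) (a b : ℝ) :
    ‖a • eR x + b • eZ‖ ^ 2 = a ^ 2 + b ^ 2 := by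
  have h := radius_sq x
  have hne := hx.ne'
  rw [EuclideanSpace.real_norm_sq_eq, Fin.sum_univ_three]
  simp [eR, eZ]
  field_simp
  rw [h]

theorem inner_frame {x : E3} (hx : 0 < radius x) (a b c d : ℝ) :
    inner ℝ (a • eR x + b • eZ) (c • eR x + d • eZ) = a * c + b * d := by
  have h := radius_sq x
  have hne := hx.ne'
  rw [PiLp.inner_apply, Fin.sum_univ_three]
  simp [eR, eZ]
  field_simp
  rw [h]; ring

end Cylindrical

end AxiMHD

namespace AxiMHD

section ChangeOfVariables

/-- The identification of Euclidean space with `ℝ × ℝ × ℝ`. -/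
noncomputable def tripleEquiv : E3 ≃ᵐ ℝ × ℝ × ℝ :=
  (MeasurableEquiv.toLp 2 (Fin 3 → ℝ)).symm.trans
    ((MeasurableEquiv.piFinSuccAbove (fun _ : Fin 3 => ℝ) 0).trans
      ((MeasurableEquiv.refl ℝ).prodCongr MeasurableEquiv.finTwoArrow))

theorem tripleEquiv_apply (y : E3) : tripleEquiv y = (y 0, y 1, y 2) := rfl

theorem measurePreserving_tripleEquiv : MeasurePreserving tripleEquiv := by
  refine (PiLp.volume_preserving_ofLp (Fin 3)).trans
    ((volume_preserving_piFinSuccAbove (fun _ : Fin 3 => ℝ) 0).trans ?_)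
  exact (MeasurePreserving.id volume).prod (volume_preserving_finTwoArrow ℝ)

variable {γ : ℝ → E2} {m : ℝ → ℝ} {δ : ℝ} {R Z Rs Zs : ℝ → ℝ → ℝ}

/-- The part `0 < t < ε` of the collar, rotated about the axis. -/
def shell (R Z : ℝ → ℝ → ℝ) (ε : ℝ) : Set E3 := torus (collarMap R Z '' (univ ×ˢ Ioo 0 ε))

/-- The point of space with collar coordinates `s`, `t` and angle `θ`. -/
noncomputable def shellPoint (R Z : ℝ → ℝ → ℝ) (s t θ : ℝ) : E3 := rotPoint θ (collarMap R Z (s, t))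

theorem shellPoint_eq (s t θ : ℝ) :
    shellPoint R Z s t θ = !₂[R s t * Real.cos θ, R s t * Real.sin θ, Z s t] := rfl

/-- The Jacobian matrix of `shellPoint`. -/
noncomputable def shellJacobian (m : ℝ → ℝ) (R Rs Zs : ℝ → ℝ → ℝ) (s t θ : ℝ) :
    Matrix (Fin 3) (Fin 3) ℝ :=
  !![Rs s t * Real.cos θ, Zs s t / (m s * R s t) * Real.cos θ, -(R s t * Real.sin θ);
    Rs s t * Real.sin θ, Zs s t / (m s * R s t) * Real.sin θ, R s t * Real.cos θ;
    Zs s t, -(Rs s t / (m s * R s t)), 0]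

theorem IsHodograph.det_shellJacobian (h : IsHodograph γ m δ R Z Rs Zs) (s t θ : ℝ) :
    (shellJacobian m R Rs Zs s t θ).det = (m s)⁻¹ * (Rs s t ^ 2 + Zs s t ^ 2) := by
  have hR := (h.R_pos s t).ne'
  have hm := h.m_ne s
  rw [Matrix.det_fin_three]
  simp only [shellJacobian, Matrix.of_apply, Matrix.cons_val', Matrix.cons_val]
  field_simp
  linear_combination R s t * (Rs s t ^ 2 + Zs s t ^ 2) * Real.cos_sq_add_sin_sq θ

theorem IsHodograph.hasFDerivWithinAt_shellPoint (h : IsHodograph γ m δ R Z Rs Zs) {S : Set E3}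
    {y : E3} (hy : y 1 ∈ Ioo (-δ) δ) :
    HasFDerivWithinAt (fun y : E3 => shellPoint R Z (y 0) (y 1) (y 2))
      (LinearMap.toContinuousLinearMap
        ((shellJacobian m R Rs Zs (y 0) (y 1) (y 2)).toLpLin 2 2)) S y := by
  have hp : ∀ i, HasFDerivAt (fun y : E3 => y i) (EuclideanSpace.proj i : E3 →L[ℝ] ℝ) y :=
    fun i => (EuclideanSpace.proj i : E3 →L[ℝ] ℝ).hasFDerivAt
  have hRd := HasFDerivAt.comp y (f := fun y : E3 => (y 0, y 1))
    (h.hasStrictFDerivAt_R (q := (y 0, y 1)) hy).hasFDerivAt ((hp 0).prodMk (hp 1))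
  have hZd := HasFDerivAt.comp y (f := fun y : E3 => (y 0, y 1))
    (h.hasStrictFDerivAt_Z (q := (y 0, y 1)) hy).hasFDerivAt ((hp 0).prodMk (hp 1))
  rw [hasFDerivWithinAt_piLp]
  intro i
  refine HasFDerivAt.hasFDerivWithinAt ?_
  fin_cases i
  · refine (hRd.mul ((hp 2).cos)).congr_fderiv ?_
    ext v
    simp [shellJacobian, Matrix.toLpLin_apply, dotProduct, Fin.sum_univ_three]
    ring
  · refine (hRd.mul ((hp 2).sin)).congr_fderiv ?_
    ext v
    simp [shellJacobian, Matrix.toLpLin_apply, dotProduct, Fin.sum_univ_three]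
    ring
  · refine hZd.congr_fderiv ?_
    ext v
    simp [shellJacobian, Matrix.toLpLin_apply, dotProduct, Fin.sum_univ_three]

theorem IsCollar.setIntegral_shell (h : IsCollar γ m δ R Z Rs Zs) {ε : ℝ} (hε : ε ∈ Ioo 0 δ)
    (g : E3 → ℝ) :
    ∫ x in shell R Z ε, g x = ∫ p in Ioc (0 : ℝ) 1 ×ˢ (Ioc 0 ε ×ˢ Ioc 0 (2 * Real.pi)),
      (|m p.1|⁻¹ * (Rs p.1 p.2.1 ^ 2 + Zs p.1 p.2.1 ^ 2)) *
        g (shellPoint R Z p.1 p.2.1 p.2.2) := by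
  set box : Set (ℝ × ℝ × ℝ) := Ico (0 : ℝ) 1 ×ˢ (Ioo 0 ε ×ˢ Ioc 0 (2 * Real.pi)) with hbox
  have hboxm : MeasurableSet box := measurableSet_Ico.prod (measurableSet_Ioo.prod measurableSet_Ioc)
  set S : Set E3 := tripleEquiv ⁻¹' box with hS
  have hSm : MeasurableSet S := tripleEquiv.measurable hboxm
  have hSmem : ∀ y ∈ S, y 0 ∈ Ico (0 : ℝ) 1 ∧ y 1 ∈ Ioo 0 ε ∧ y 2 ∈ Ioc 0 (2 * Real.pi) :=
    fun y hy => hy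
  have hsub : ∀ t ∈ Ioo 0 ε, t ∈ Ioo (-δ) δ := fun t ht =>
    ⟨by linarith [h.pos, ht.1], ht.2.trans hε.2⟩
  have hinj : InjOn (fun y : E3 => shellPoint R Z (y 0) (y 1) (y 2)) S := by
    intro y hy y' hy' heq
    obtain ⟨h0, h1, h2⟩ := hSmem y hy
    obtain ⟨h0', h1', h2'⟩ := hSmem y' hy'
    obtain ⟨hθ, hq⟩ := rotPoint_injOn h2 h2' (h.R_pos _ _) (h.R_pos _ _) heq
    obtain ⟨ht, k, hk⟩ := h.eq_of_collarMap_eq (hsub _ h1) (hsub _ h1') hq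
    simp only at ht hk
    have hk1 : (k : ℝ) < 1 := by linarith [h0.2, h0'.1]
    have hk2 : (-1 : ℝ) < k := by linarith [h0.1, h0'.2]
    have hk0 : k = 0 := by
      have h1 : k < 1 := by exact_mod_cast hk1
      have h2 : -1 < k := by exact_mod_cast hk2
      omega
    rw [hk0, Int.cast_zero, add_zero] at hk
    ext i
    fin_cases i
    · exact hk
    · exact ht
    · exact hθ
  have himage : (fun y : E3 => shellPoint R Z (y 0) (y 1) (y 2)) '' S = shell R Z ε := by
    apply Subset.antisymm
    · rintro _ ⟨y, hy, rfl⟩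
      obtain ⟨h0, h1, h2⟩ := hSmem y hy
      refine ⟨(y 0, y 1), ⟨mem_univ _, h1⟩, ?_⟩
      exact (cyl_rotPoint (y 2) (q := collarMap R Z (y 0, y 1)) (h.R_pos _ _).le).symm
    · rintro x ⟨⟨s, t⟩, ⟨_, ht⟩, hst⟩
      obtain ⟨θ, hθ, hx⟩ := exists_rotPoint_eq x
      refine ⟨tripleEquiv.symm (Int.fract s, t, θ), ?_, ?_⟩
      · rw [hS, mem_preimage, MeasurableEquiv.apply_symm_apply]
        exact ⟨⟨Int.fract_nonneg s, Int.fract_lt_one s⟩, ht, hθ⟩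
      · have he := tripleEquiv.apply_symm_apply (Int.fract s, t, θ)
        rw [tripleEquiv_apply] at he
        simp only [Prod.mk.injEq] at he
        simp only [he.1, he.2.1, he.2.2]
        rw [shellPoint, h.collarMap_fract, hst, hx]
  rw [← himage, integral_image_eq_integral_abs_det_fderiv_smul volume hSm
    (fun y hy => h.hasFDerivWithinAt_shellPoint (hsub _ (hSmem y hy).2.1)) hinj]
  have hmp := measurePreserving_tripleEquiv.setIntegral_preimage_emb
    tripleEquiv.measurableEmbedding (fun p : ℝ × ℝ × ℝ =>
      (|m p.1|⁻¹ * (Rs p.1 p.2.1 ^ 2 + Zs p.1 p.2.1 ^ 2)) *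
        g (shellPoint R Z p.1 p.2.1 p.2.2)) box
  have hae : box =ᵐ[volume] Ioc (0 : ℝ) 1 ×ˢ (Ioc 0 ε ×ˢ Ioc 0 (2 * Real.pi)) :=
    Measure.set_prod_ae_eq Ico_ae_eq_Ioc (Measure.set_prod_ae_eq Ioo_ae_eq_Ioc (ae_eq_refl _))
  rw [← setIntegral_congr_set hae, ← hmp]
  refine setIntegral_congr_fun hSm fun y _ => ?_
  simp only [tripleEquiv_apply, smul_eq_mul]
  rw [LinearMap.det_toContinuousLinearMap, LinearMap.det_toLpLin, h.det_shellJacobian, abs_mul,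
    abs_inv, abs_of_nonneg (by positivity : (0 : ℝ) ≤ Rs (y 0) (y 1) ^ 2 + Zs (y 0) (y 1) ^ 2)]

end ChangeOfVariables

section Fubini

theorem setIntegral_prod_Ioc {a b c d : ℝ} (hab : a ≤ b) (hcd : c ≤ d) {f : ℝ × ℝ → ℝ}
    (hf : ContinuousOn f (Icc a b ×ˢ Icc c d)) :
    ∫ p in Ioc a b ×ˢ Ioc c d, f p = ∫ x in a..b, ∫ y in c..d, f (x, y) := by
  have hint : IntegrableOn f (Ioc a b ×ˢ Ioc c d) (volume.prod volume) :=
    (hf.integrableOn_compact (isCompact_Icc.prod isCompact_Icc)).mono_set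
      (prod_mono Ioc_subset_Icc_self Ioc_subset_Icc_self)
  rw [Measure.volume_eq_prod, setIntegral_prod f hint]
  simp only [intervalIntegral.integral_of_le hab, intervalIntegral.integral_of_le hcd]

theorem setIntegral_prod_Ioc_symm {a b c d : ℝ} (hab : a ≤ b) (hcd : c ≤ d) {f : ℝ × ℝ → ℝ}
    (hf : ContinuousOn f (Icc a b ×ˢ Icc c d)) :
    ∫ p in Ioc a b ×ˢ Ioc c d, f p = ∫ y in c..d, ∫ x in a..b, f (x, y) := by
  have hsw := setIntegral_prod_swap (μ := (volume : Measure ℝ)) (ν := (volume : Measure ℝ))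
    (Ioc a b) (Ioc c d) f
  rw [Measure.volume_eq_prod, ← hsw, ← Measure.volume_eq_prod]
  exact setIntegral_prod_Ioc hcd hab (f := fun z => f z.swap)
    (hf.comp continuous_swap.continuousOn fun z hz => ⟨hz.2, hz.1⟩)

variable {ε : ℝ} {f : ℝ × ℝ × ℝ → ℝ}

theorem integrableOn_box (hf : ContinuousOn f (Icc 0 1 ×ˢ (Icc 0 ε ×ˢ Icc 0 (2 * Real.pi)))) :
    IntegrableOn f (Ioc (0 : ℝ) 1 ×ˢ (Ioc 0 ε ×ˢ Ioc 0 (2 * Real.pi))) :=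
  (hf.integrableOn_compact (isCompact_Icc.prod (isCompact_Icc.prod isCompact_Icc))).mono_set
    (prod_mono Ioc_subset_Icc_self (prod_mono Ioc_subset_Icc_self Ioc_subset_Icc_self))

theorem continuousOn_slice (hf : ContinuousOn f (Icc 0 1 ×ˢ (Icc 0 ε ×ˢ Icc 0 (2 * Real.pi))))
    {s : ℝ} (hs : s ∈ Icc (0 : ℝ) 1) :
    ContinuousOn (fun q : ℝ × ℝ => f (s, q)) (Icc 0 ε ×ˢ Icc 0 (2 * Real.pi)) :=
  hf.comp (by fun_prop) fun _ hq => ⟨hs, hq⟩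

/-- Integration over a box, with `t` innermost. -/
theorem setIntegral_box_theta_t (hε : 0 ≤ ε)
    (hf : ContinuousOn f (Icc 0 1 ×ˢ (Icc 0 ε ×ˢ Icc 0 (2 * Real.pi)))) :
    ∫ p in Ioc (0 : ℝ) 1 ×ˢ (Ioc 0 ε ×ˢ Ioc 0 (2 * Real.pi)), f p =
      ∫ s in (0 : ℝ)..1, ∫ θ in (0 : ℝ)..(2 * Real.pi), ∫ t in (0 : ℝ)..ε, f (s, t, θ) := by
  have hint := integrableOn_box hf
  rw [Measure.volume_eq_prod] at hint ⊢
  rw [setIntegral_prod f hint, intervalIntegral.integral_of_le zero_le_one]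
  refine setIntegral_congr_fun measurableSet_Ioc fun s hs => ?_
  exact setIntegral_prod_Ioc_symm hε Real.two_pi_pos.le
    (continuousOn_slice hf (Ioc_subset_Icc_self hs))

/-- Integration over a box, with the angle innermost. -/
theorem setIntegral_box_t_theta (hε : 0 ≤ ε)
    (hf : ContinuousOn f (Icc 0 1 ×ˢ (Icc 0 ε ×ˢ Icc 0 (2 * Real.pi)))) :
    ∫ p in Ioc (0 : ℝ) 1 ×ˢ (Ioc 0 ε ×ˢ Ioc 0 (2 * Real.pi)), f p =
      ∫ s in (0 : ℝ)..1, ∫ t in (0 : ℝ)..ε, ∫ θ in (0 : ℝ)..(2 * Real.pi), f (s, t, θ) := by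
  have hint := integrableOn_box hf
  rw [Measure.volume_eq_prod] at hint ⊢
  rw [setIntegral_prod f hint, intervalIntegral.integral_of_le zero_le_one]
  refine setIntegral_congr_fun measurableSet_Ioc fun s hs => ?_
  exact setIntegral_prod_Ioc hε Real.two_pi_pos.le
    (continuousOn_slice hf (Ioc_subset_Icc_self hs))

/-- Integration over a box, with `s` innermost. -/
theorem setIntegral_box_s
    (hf : ContinuousOn f (Icc 0 1 ×ˢ (Icc 0 ε ×ˢ Icc 0 (2 * Real.pi)))) :
    ∫ p in Ioc (0 : ℝ) 1 ×ˢ (Ioc 0 ε ×ˢ Ioc 0 (2 * Real.pi)), f p =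
      ∫ q in Ioc 0 ε ×ˢ Ioc 0 (2 * Real.pi), ∫ s in (0 : ℝ)..1, f (s, q) := by
  have hint := integrableOn_box hf
  rw [Measure.volume_eq_prod] at hint ⊢
  rw [IntegrableOn, ← Measure.prod_restrict] at hint
  rw [← Measure.prod_restrict, integral_prod_symm f hint]
  simp only [intervalIntegral.integral_of_le zero_le_one]

end Fubini

end AxiMHD

namespace AxiMHD

section WeakIdentities

theorem inner_cross_curl (v : E3 → E3) (x a b : E3) :
    (a 1 * b 2 - a 2 * b 1) * curl v x 0 + (a 2 * b 0 - a 0 * b 2) * curl v x 1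
      + (a 0 * b 1 - a 1 * b 0) * curl v x 2
      = inner ℝ (fderiv ℝ v x a) b - inner ℝ (fderiv ℝ v x b) a := by
  have hL : ∀ w : E3, fderiv ℝ v x w = ∑ i, w i • fderiv ℝ v x (EuclideanSpace.single i 1) := by
    intro w
    conv_lhs => rw [← (EuclideanSpace.basisFun (Fin 3) ℝ).sum_repr w]
    simp [map_sum]
  rw [hL a, hL b]
  simp only [Fin.sum_univ_three, PiLp.inner_apply, PiLp.add_apply, PiLp.smul_apply, smul_eq_mul,
    RCLike.inner_apply, conj_trivial]
  show (a 1 * b 2 - a 2 * b 1) * (pd v 1 2 x - pd v 2 1 x)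
    + (a 2 * b 0 - a 0 * b 2) * (pd v 2 0 x - pd v 0 2 x)
    + (a 0 * b 1 - a 1 * b 0) * (pd v 0 1 x - pd v 1 0 x) = _
  simp only [pd]
  ring

/-- The derivative of `shellPoint` in `s`. -/
noncomputable def shellS (Rs Zs : ℝ → ℝ → ℝ) (s t θ : ℝ) : E3 :=
  !₂[Rs s t * Real.cos θ, Rs s t * Real.sin θ, Zs s t]

/-- The derivative of `shellPoint` in `t`. -/
noncomputable def shellT (m : ℝ → ℝ) (R Rs Zs : ℝ → ℝ → ℝ) (s t θ : ℝ) : E3 :=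
  !₂[Zs s t / (m s * R s t) * Real.cos θ, Zs s t / (m s * R s t) * Real.sin θ,
    -(Rs s t / (m s * R s t))]

/-- The derivative of `shellPoint` in the angle. -/
noncomputable def shellTheta (R : ℝ → ℝ → ℝ) (s t θ : ℝ) : E3 :=
  !₂[R s t * -Real.sin θ, R s t * Real.cos θ, 0]

/-- The mixed second derivative of `shellPoint` in `t` and the angle. -/
noncomputable def shellTTheta (m : ℝ → ℝ) (R Zs : ℝ → ℝ → ℝ) (s t θ : ℝ) : E3 :=
  !₂[Zs s t / (m s * R s t) * -Real.sin θ, Zs s t / (m s * R s t) * Real.cos θ, 0]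

variable {γ : ℝ → E2} {m : ℝ → ℝ} {δ : ℝ} {R Z Rs Zs : ℝ → ℝ → ℝ}

theorem IsHodograph.inner_shellS_curl (h : IsHodograph γ m δ R Z Rs Zs) (v : E3 → E3)
    (s t θ : ℝ) (x : E3) :
    inner ℝ (shellS Rs Zs s t θ) (curl v x) =
      m s * (inner ℝ (fderiv ℝ v x (shellT m R Rs Zs s t θ)) (shellTheta R s t θ)
        - inner ℝ (fderiv ℝ v x (shellTheta R s t θ)) (shellT m R Rs Zs s t θ)) := by
  have hR := (h.R_pos s t).ne'
  have hm := h.m_ne s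
  rw [← inner_cross_curl]
  simp only [PiLp.inner_apply, Fin.sum_univ_three, RCLike.inner_apply, conj_trivial]
  simp only [shellS, shellT, shellTheta, PiLp.toLp_apply, Matrix.cons_val_zero,
    Matrix.cons_val_one, Matrix.cons_val]
  field_simp
  linear_combination -(R s t * Zs s t * (curl v x).ofLp 2) * Real.cos_sq_add_sin_sq θ

theorem IsHodograph.hasDerivAt_shellPoint_s (h : IsHodograph γ m δ R Z Rs Zs) {t : ℝ}
    (ht : t ∈ Ioo (-δ) δ) (s θ : ℝ) :
    HasDerivAt (fun s => shellPoint R Z s t θ) (shellS Rs Zs s t θ) s :=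
  hasDerivAt_toLp3 ((h.dR_s t ht s).mul_const _) ((h.dR_s t ht s).mul_const _) (h.dZ_s t ht s)

theorem IsHodograph.hasDerivAt_shellPoint_t (h : IsHodograph γ m δ R Z Rs Zs) {t : ℝ}
    (ht : t ∈ Ioo (-δ) δ) (s θ : ℝ) :
    HasDerivAt (fun t => shellPoint R Z s t θ) (shellT m R Rs Zs s t θ) t :=
  hasDerivAt_toLp3 ((h.dR_t t ht s).mul_const _) ((h.dR_t t ht s).mul_const _) (h.dZ_t t ht s)

theorem hasDerivAt_shellPoint_theta (s t θ : ℝ) :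
    HasDerivAt (fun θ => shellPoint R Z s t θ) (shellTheta R s t θ) θ :=
  hasDerivAt_toLp3 ((Real.hasDerivAt_cos θ).const_mul _) ((Real.hasDerivAt_sin θ).const_mul _)
    (hasDerivAt_const θ _)

theorem IsHodograph.hasDerivAt_shellTheta (h : IsHodograph γ m δ R Z Rs Zs) {t : ℝ}
    (ht : t ∈ Ioo (-δ) δ) (s θ : ℝ) :
    HasDerivAt (fun t => shellTheta R s t θ) (shellTTheta m R Zs s t θ) t :=
  hasDerivAt_toLp3 ((h.dR_t t ht s).mul_const _) ((h.dR_t t ht s).mul_const _)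
    (hasDerivAt_const t _)

theorem hasDerivAt_shellT (s t θ : ℝ) :
    HasDerivAt (fun θ => shellT m R Rs Zs s t θ) (shellTTheta m R Zs s t θ) θ :=
  hasDerivAt_toLp3 ((Real.hasDerivAt_cos θ).const_mul _) ((Real.hasDerivAt_sin θ).const_mul _)
    (hasDerivAt_const θ _)

theorem continuousOn_lift {f : ℝ → ℝ → ℝ}
    (hf : ContinuousOn (fun q : ℝ × ℝ => f q.1 q.2) (univ ×ˢ Ioo (-δ) δ)) :
    ContinuousOn (fun p : ℝ × ℝ × ℝ => f p.1 p.2.1) (univ ×ˢ (Ioo (-δ) δ ×ˢ univ)) := by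
  have hg : ContinuousOn (fun p : ℝ × ℝ × ℝ => (p.1, p.2.1)) (univ ×ˢ (Ioo (-δ) δ ×ˢ univ)) := by
    fun_prop
  exact hf.comp hg fun p hp => ⟨mem_univ _, hp.2.1⟩

theorem continuousOn_cos_lift {S : Set (ℝ × ℝ × ℝ)} :
    ContinuousOn (fun p : ℝ × ℝ × ℝ => Real.cos p.2.2) S := by fun_prop

theorem continuousOn_sin_lift {S : Set (ℝ × ℝ × ℝ)} :
    ContinuousOn (fun p : ℝ × ℝ × ℝ => Real.sin p.2.2) S := by fun_prop

theorem IsHodograph.continuousOn_shellPoint (h : IsHodograph γ m δ R Z Rs Zs) :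
    ContinuousOn (fun p : ℝ × ℝ × ℝ => shellPoint R Z p.1 p.2.1 p.2.2)
      (univ ×ˢ (Ioo (-δ) δ ×ˢ univ)) :=
  continuousOn_toLp3 ((continuousOn_lift h.cont_R).mul continuousOn_cos_lift)
    ((continuousOn_lift h.cont_R).mul continuousOn_sin_lift) (continuousOn_lift h.cont_Z)

theorem IsHodograph.continuousOn_shellS (h : IsHodograph γ m δ R Z Rs Zs) :
    ContinuousOn (fun p : ℝ × ℝ × ℝ => shellS Rs Zs p.1 p.2.1 p.2.2)
      (univ ×ˢ (Ioo (-δ) δ ×ˢ univ)) :=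
  continuousOn_toLp3 ((continuousOn_lift h.cont_Rs).mul continuousOn_cos_lift)
    ((continuousOn_lift h.cont_Rs).mul continuousOn_sin_lift) (continuousOn_lift h.cont_Zs)

theorem IsHodograph.continuousOn_shellT (h : IsHodograph γ m δ R Z Rs Zs) :
    ContinuousOn (fun p : ℝ × ℝ × ℝ => shellT m R Rs Zs p.1 p.2.1 p.2.2)
      (univ ×ˢ (Ioo (-δ) δ ×ˢ univ)) :=
  have hRt := continuousOn_lift (f := fun s t => Zs s t / (m s * R s t)) h.cont_Rt
  have hZt := continuousOn_lift (f := fun s t => -(Rs s t / (m s * R s t))) h.cont_Zt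
  continuousOn_toLp3 (hRt.mul continuousOn_cos_lift) (hRt.mul continuousOn_sin_lift) hZt

theorem IsHodograph.continuousOn_shellTheta (h : IsHodograph γ m δ R Z Rs Zs) :
    ContinuousOn (fun p : ℝ × ℝ × ℝ => shellTheta R p.1 p.2.1 p.2.2)
      (univ ×ˢ (Ioo (-δ) δ ×ˢ univ)) :=
  continuousOn_toLp3 ((continuousOn_lift h.cont_R).mul continuousOn_sin_lift.neg)
    ((continuousOn_lift h.cont_R).mul continuousOn_cos_lift) continuousOn_const

theorem IsHodograph.continuousOn_shellTTheta (h : IsHodograph γ m δ R Z Rs Zs) :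
    ContinuousOn (fun p : ℝ × ℝ × ℝ => shellTTheta m R Zs p.1 p.2.1 p.2.2)
      (univ ×ˢ (Ioo (-δ) δ ×ˢ univ)) :=
  have hRt := continuousOn_lift (f := fun s t => Zs s t / (m s * R s t)) h.cont_Rt
  continuousOn_toLp3 (hRt.mul continuousOn_sin_lift.neg) (hRt.mul continuousOn_cos_lift)
    continuousOn_const

theorem box_subset {ε : ℝ} (hδ : 0 < δ) (hε : ε < δ) :
    (Icc (0 : ℝ) 1 ×ˢ (Icc 0 ε ×ˢ Icc 0 (2 * Real.pi)) : Set (ℝ × ℝ × ℝ)) ⊆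
      univ ×ˢ (Ioo (-δ) δ ×ˢ univ) :=
  prod_mono (subset_univ _) (prod_mono
    (fun t ht => ⟨by linarith [ht.1], ht.2.trans_lt hε⟩) (subset_univ _))

/-- The weak form of the curl equation in collar coordinates. -/
theorem IsHodograph.integral_inner_shellS_curl (h : IsHodograph γ m δ R Z Rs Zs) {ε : ℝ}
    (hε : ε ∈ Ioo 0 δ) {v : E3 → E3} (hv : ContDiff ℝ ∞ v)
    (hv0 : ∀ s θ, v (shellPoint R Z s 0 θ) = 0) :
    ∫ p in Ioc (0 : ℝ) 1 ×ˢ (Ioc 0 ε ×ˢ Ioc 0 (2 * Real.pi)),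
      inner ℝ (shellS Rs Zs p.1 p.2.1 p.2.2) (curl v (shellPoint R Z p.1 p.2.1 p.2.2)) =
    ∫ s in (0 : ℝ)..1, ∫ θ in (0 : ℝ)..(2 * Real.pi),
      m s * inner ℝ (v (shellPoint R Z s ε θ)) (shellTheta R s ε θ) := by
  set α' : ℝ × ℝ × ℝ → ℝ := fun p =>
    inner ℝ (v (shellPoint R Z p.1 p.2.1 p.2.2)) (shellTTheta m R Zs p.1 p.2.1 p.2.2)
      + inner ℝ (fderiv ℝ v (shellPoint R Z p.1 p.2.1 p.2.2) (shellT m R Rs Zs p.1 p.2.1 p.2.2))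
        (shellTheta R p.1 p.2.1 p.2.2) with hα'
  set β' : ℝ × ℝ × ℝ → ℝ := fun p =>
    inner ℝ (v (shellPoint R Z p.1 p.2.1 p.2.2)) (shellTTheta m R Zs p.1 p.2.1 p.2.2)
      + inner ℝ (fderiv ℝ v (shellPoint R Z p.1 p.2.1 p.2.2) (shellTheta R p.1 p.2.1 p.2.2))
        (shellT m R Rs Zs p.1 p.2.1 p.2.2) with hβ'
  have hvc : ContinuousOn (fun p : ℝ × ℝ × ℝ => v (shellPoint R Z p.1 p.2.1 p.2.2))
      (univ ×ˢ (Ioo (-δ) δ ×ˢ univ)) := hv.continuous.comp_continuousOn h.continuousOn_shellPoint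
  have hdvc : ContinuousOn (fun p : ℝ × ℝ × ℝ => fderiv ℝ v (shellPoint R Z p.1 p.2.1 p.2.2))
      (univ ×ˢ (Ioo (-δ) δ ×ˢ univ)) :=
    (hv.continuous_fderiv (by simp)).comp_continuousOn h.continuousOn_shellPoint
  have hmc : ContinuousOn (fun p : ℝ × ℝ × ℝ => m p.1) (univ ×ˢ (Ioo (-δ) δ ×ˢ univ)) :=
    (h.continuous_m.comp continuous_fst).continuousOn
  have hαc : ContinuousOn (fun p => m p.1 * α' p) (univ ×ˢ (Ioo (-δ) δ ×ˢ univ)) :=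
    hmc.mul ((hvc.inner h.continuousOn_shellTTheta).add
      ((hdvc.clm_apply h.continuousOn_shellT).inner h.continuousOn_shellTheta))
  have hβc : ContinuousOn (fun p => m p.1 * β' p) (univ ×ˢ (Ioo (-δ) δ ×ˢ univ)) :=
    hmc.mul ((hvc.inner h.continuousOn_shellTTheta).add
      ((hdvc.clm_apply h.continuousOn_shellTheta).inner h.continuousOn_shellT))
  have hbox := box_subset (ε := ε) h.pos hε.2
  have hvd : ∀ x, HasFDerivAt v (fderiv ℝ v x) x := fun x =>
    (hv.differentiable (by simp) x).hasFDerivAt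
  have hmem : ∀ t ∈ uIcc 0 ε, t ∈ Ioo (-δ) δ := by
    intro t ht
    rw [uIcc_of_le hε.1.le] at ht
    exact ⟨by linarith [h.pos, ht.1], ht.2.trans_lt hε.2⟩
  have hαint : ∀ s θ : ℝ, ∫ t in (0 : ℝ)..ε, m s * α' (s, t, θ) =
      m s * inner ℝ (v (shellPoint R Z s ε θ)) (shellTheta R s ε θ) := by
    intro s θ
    rw [intervalIntegral.integral_eq_sub_of_hasDerivAt
      (f := fun t => m s * inner ℝ (v (shellPoint R Z s t θ)) (shellTheta R s t θ))]
    · simp [hv0]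
    · intro t ht
      exact (((hvd _).comp_hasDerivAt t (h.hasDerivAt_shellPoint_t (hmem t ht) s θ)).inner ℝ
        (h.hasDerivAt_shellTheta (hmem t ht) s θ)).const_mul _
    · refine ContinuousOn.intervalIntegrable ?_
      have hg : ContinuousOn (fun t : ℝ => (s, t, θ)) (uIcc 0 ε) := by fun_prop
      exact hαc.comp hg fun t ht => ⟨mem_univ _, hmem t ht, mem_univ _⟩
  have hβint : ∀ s : ℝ, ∀ t ∈ uIcc 0 ε, ∫ θ in (0 : ℝ)..(2 * Real.pi), m s * β' (s, t, θ) = 0 := by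
    intro s t ht
    rw [intervalIntegral.integral_eq_sub_of_hasDerivAt
      (f := fun θ => m s * inner ℝ (v (shellPoint R Z s t θ)) (shellT m R Rs Zs s t θ))]
    · simp [shellPoint_eq, shellT]
    · intro θ _
      exact (((hvd _).comp_hasDerivAt θ (hasDerivAt_shellPoint_theta s t θ)).inner ℝ
        (hasDerivAt_shellT s t θ)).const_mul _
    · refine ContinuousOn.intervalIntegrable ?_
      have hg : ContinuousOn (fun θ : ℝ => (s, t, θ)) (uIcc 0 (2 * Real.pi)) := by fun_prop
      exact hβc.comp hg fun θ _ => ⟨mem_univ _, hmem t ht, mem_univ _⟩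
  have hpt : ∀ p : ℝ × ℝ × ℝ,
      inner ℝ (shellS Rs Zs p.1 p.2.1 p.2.2) (curl v (shellPoint R Z p.1 p.2.1 p.2.2)) =
      m p.1 * α' p - m p.1 * β' p := by
    intro p
    rw [h.inner_shellS_curl]
    simp only [hα', hβ']
    ring
  simp_rw [hpt]
  rw [integral_sub (integrableOn_box (hαc.mono hbox)) (integrableOn_box (hβc.mono hbox)),
    setIntegral_box_theta_t hε.1.le (hαc.mono hbox),
    setIntegral_box_t_theta hε.1.le (hβc.mono hbox)]
  have hβ0 : ∫ s in (0 : ℝ)..1, ∫ t in (0 : ℝ)..ε, ∫ θ in (0 : ℝ)..(2 * Real.pi),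
      m s * β' (s, t, θ) = 0 := by
    refine intervalIntegral.integral_zero_ae (Eventually.of_forall fun s _ => ?_)
    exact intervalIntegral.integral_zero_ae (Eventually.of_forall fun t ht =>
      hβint s t (uIoc_subset_uIcc ht))
  rw [hβ0, sub_zero]
  simp only [hαint]

/-- The weak form of the divergence equation in collar coordinates. -/
theorem IsHodograph.integral_inner_shellS_gradient (h : IsHodograph γ m δ R Z Rs Zs) {ε : ℝ}
    (hε : ε ∈ Ioo 0 δ) {η : E3 → ℝ} (hη : ContDiff ℝ ∞ η) :
    ∫ p in Ioc (0 : ℝ) 1 ×ˢ (Ioc 0 ε ×ˢ Ioc 0 (2 * Real.pi)),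
      inner ℝ (shellS Rs Zs p.1 p.2.1 p.2.2) (∇ η (shellPoint R Z p.1 p.2.1 p.2.2)) = 0 := by
  have hpt : ∀ p : ℝ × ℝ × ℝ,
      inner ℝ (shellS Rs Zs p.1 p.2.1 p.2.2) (∇ η (shellPoint R Z p.1 p.2.1 p.2.2)) =
      fderiv ℝ η (shellPoint R Z p.1 p.2.1 p.2.2) (shellS Rs Zs p.1 p.2.1 p.2.2) := by
    intro p
    rw [real_inner_comm]
    exact inner_gradient_left
  simp_rw [hpt]
  have hc : ContinuousOn (fun p : ℝ × ℝ × ℝ =>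
      fderiv ℝ η (shellPoint R Z p.1 p.2.1 p.2.2) (shellS Rs Zs p.1 p.2.1 p.2.2))
      (univ ×ˢ (Ioo (-δ) δ ×ˢ univ)) :=
    ((hη.continuous_fderiv (by simp)).comp_continuousOn h.continuousOn_shellPoint).clm_apply
      h.continuousOn_shellS
  rw [setIntegral_box_s (hc.mono (box_subset h.pos hε.2))]
  refine setIntegral_eq_zero_of_forall_eq_zero fun q hq => ?_
  have hq' : q.1 ∈ Ioo (-δ) δ := ⟨by linarith [h.pos, hq.1.1], hq.1.2.trans_lt hε.2⟩
  rw [intervalIntegral.integral_eq_sub_of_hasDerivAt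
    (f := fun s => η (shellPoint R Z s q.1 q.2))]
  · have := h.collarMap_add_int 0 q.1 1
    simp only [Int.cast_one, zero_add] at this
    simp [shellPoint, this]
  · intro s _
    exact ((hη.differentiable (by simp) _).hasFDerivAt).comp_hasDerivAt s
      (h.hasDerivAt_shellPoint_s hq' s q.2)
  · refine ContinuousOn.intervalIntegrable ?_
    have hg : ContinuousOn (fun s : ℝ => (s, q)) (uIcc 0 1) := by fun_prop
    exact hc.comp hg fun s _ => ⟨mem_univ _, hq', mem_univ _⟩

end WeakIdentities

end AxiMHD

namespace AxiMHD

section ExternalField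

/-- The axisymmetric field with components `b = (b_r, b_z)`. -/
noncomputable def poloidal (b : E2 → ℝ × ℝ) (x : E3) : E3 :=
  (b (cyl x)).1 • eR x + (b (cyl x)).2 • eZ

theorem continuousAt_poloidal {b : E2 → ℝ × ℝ} {x : E3} (hb : ContinuousAt b (cyl x))
    (hx : 0 < radius x) : ContinuousAt (poloidal b) x := by
  have h1 : ContinuousAt (fun x => b (cyl x)) x :=
    ContinuousAt.comp (f := cyl) hb continuous_cyl.continuousAt
  exact (h1.fst.smul (continuousAt_eR hx)).add (h1.snd.smul continuousAt_const)

variable {Ω : Set E2} {γ : ℝ → E2} {m : ℝ → ℝ} {δ : ℝ} {R Z Rs Zs : ℝ → ℝ → ℝ} {n : WithTop ℕ∞}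

theorem IsHodograph.norm_deriv_collarMap (h : IsHodograph γ m δ R Z Rs Zs) {t : ℝ}
    (ht : t ∈ Ioo (-δ) δ) (s : ℝ) :
    ‖deriv (fun s => collarMap R Z (s, t)) s‖ = Real.sqrt (Rs s t ^ 2 + Zs s t ^ 2) := by
  rw [(h.hasDerivAt_collarMap ht s).deriv, EuclideanSpace.norm_eq, Fin.sum_univ_two]
  simp

theorem IsOuterCollar.shell_subset (h : IsOuterCollar Ω γ m δ R Z Rs Zs)
    (hΩ : IsCrossSection n Ω γ) {ε : ℝ} (hε : ε ∈ Ioo 0 δ) :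
    shell R Z ε ⊆ (closure (torus Ω))ᶜ := by
  rw [closure_torus hΩ.off_axis]
  rintro x ⟨⟨s, t⟩, ⟨_, ht⟩, hst⟩ hx
  have hx' : cyl x ∈ closure Ω := hx
  rw [← hst] at hx'
  exact h.outside s t ⟨ht.1, ht.2.trans hε.2⟩ hx'

/-- In the exterior of the torus, the rotated collar is the shell. -/
theorem IsOuterCollar.mem_shell (h : IsOuterCollar Ω γ m δ R Z Rs Zs)
    (hΩ : IsCrossSection n Ω γ) {ε : ℝ} {x : E3} (hx : x ∉ closure (torus Ω))
    (hxc : cyl x ∈ collarMap R Z '' (univ ×ˢ Ioo (-δ) ε)) : x ∈ shell R Z ε := by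
  rw [closure_torus hΩ.off_axis] at hx
  obtain ⟨⟨s, t⟩, ⟨_, ht⟩, hst⟩ := hxc
  rcases lt_trichotomy t 0 with h1 | h1 | h1
  · refine absurd (?_ : cyl x ∈ closure Ω) hx
    rw [← hst]
    exact subset_closure (h.inside s t ⟨ht.1, h1⟩)
  · refine absurd (?_ : cyl x ∈ closure Ω) hx
    rw [← hst, h1, h.collarMap_zero]
    exact hΩ.range_subset_closure (mem_range_self s)
  · exact ⟨(s, t), ⟨mem_univ _, h1, ht.2⟩, hst⟩

/-- The external field: it is confined between the torus and the sheet, where the stream function of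
the collar is constant. -/
theorem IsOuterCollar.exists_field (h : IsOuterCollar Ω γ m δ R Z Rs Zs)
    (hΩ : IsCrossSection n Ω γ) {ε : ℝ} (hε : ε ∈ Ioo 0 δ) :
    ∃ (j : E2 → ℝ) (Bext : E3 → E3),
      IsFieldOfToroidalSheet (torus Ω) (fun s => collarMap R Z (s, ε)) j Bext ∧
      ∀ x s, cyl x = γ s → Bext x =
        (|m s| / (Rs s 0 ^ 2 + Zs s 0 ^ 2) * Rs s 0) • eR x
          + (|m s| / (Rs s 0 ^ 2 + Zs s 0 ^ 2) * Zs s 0) • eZ := by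
  classical
  have hεδ : ε ∈ Ioo (-δ) δ := ⟨by linarith [h.pos, hε.1], hε.2⟩
  have hmc : ContinuousOn (fun q : ℝ × ℝ => m q.1) (univ ×ˢ Ioo (-δ) δ) :=
    (h.continuous_m.comp continuous_fst).continuousOn
  have hN : ContinuousOn (fun q : ℝ × ℝ => Rs q.1 q.2 ^ 2 + Zs q.1 q.2 ^ 2)
      (univ ×ˢ Ioo (-δ) δ) := (h.cont_Rs.pow 2).add (h.cont_Zs.pow 2)
  have hk : ContinuousOn (fun q : ℝ × ℝ => |m q.1| / (Rs q.1 q.2 ^ 2 + Zs q.1 q.2 ^ 2))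
      (univ ×ˢ Ioo (-δ) δ) := hmc.abs.div hN fun q hq => (h.regular _ _ hq.2).ne'
  obtain ⟨b, hb, hbc⟩ := h.exists_descend
    (f := fun s t => (|m s| / (Rs s t ^ 2 + Zs s t ^ 2) * Rs s t,
      |m s| / (Rs s t ^ 2 + Zs s t ^ 2) * Zs s t))
    ((hk.mul h.cont_Rs).prodMk (hk.mul h.cont_Zs))
    (fun s t => by rw [h.periodic_m s, h.per_Rs, h.per_Zs])
  obtain ⟨j, hj, hjc⟩ := h.exists_descend
    (f := fun s t => m s / Real.sqrt (Rs s t ^ 2 + Zs s t ^ 2))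
    (hmc.div hN.sqrt fun q hq => (Real.sqrt_pos.2 (h.regular _ _ hq.2)).ne')
    (fun s t => by rw [h.periodic_m s, h.per_Rs, h.per_Zs])
  set W : Set E2 := collarMap R Z '' (univ ×ˢ Ioo (-δ) ε) with hW
  have hWo : IsOpen W := h.isOpen_image isOpen_Ioo (Ioo_subset_Ioo_right hε.2.le)
  set Bext : E3 → E3 := (torus W).indicator (poloidal b) with hB
  have hBin : ∀ x, cyl x ∈ W → Bext x = poloidal b x := fun x hx =>
    indicator_of_mem (show x ∈ torus W from hx) _
  have hBout : ∀ x, cyl x ∉ W → Bext x = 0 := fun x hx =>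
    indicator_of_notMem (show x ∉ torus W from hx) _
  have hpc : ∀ x s t, t ∈ Ioo (-δ) δ → cyl x = collarMap R Z (s, t) →
      ContinuousAt (poloidal b) x := by
    intro x s t ht hx
    refine continuousAt_poloidal (by rw [hx]; exact hbc s t ht) ?_
    rw [← cyl_zero, hx]
    exact h.R_pos s t
  have hcs := h.isCrossSection_enlarge hΩ hε
  have hWsub : W ⊆ enlarge Ω R Z δ ε := subset_union_right
  have hTo : IsOpen (torus Ω) := isOpen_torus hΩ.isOpen
  have hshellm : MeasurableSet (shell R Z ε) :=
    (isOpen_torus (h.isOpen_image isOpen_Ioo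
      (Ioo_subset_Ioo (by linarith [h.pos]) hε.2.le))).measurableSet
  have hextm : MeasurableSet (closure (torus Ω))ᶜ := isClosed_closure.measurableSet.compl
  have hzero : ∀ x ∈ (closure (torus Ω))ᶜ \ shell R Z ε, Bext x = 0 := fun x hx =>
    hBout x fun hxW => hx.2 (h.mem_shell hΩ hx.1 hxW)
  have hshellW : ∀ x ∈ shell R Z ε, cyl x ∈ W := by
    rintro x ⟨⟨s, t⟩, ⟨_, ht⟩, hst⟩
    exact ⟨(s, t), ⟨mem_univ _, by linarith [h.pos, ht.1], ht.2⟩, hst⟩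
  have hBshell : ∀ s t θ, t ∈ Ioo 0 ε → ∀ w : E3,
      (|m s|⁻¹ * (Rs s t ^ 2 + Zs s t ^ 2)) * inner ℝ (Bext (shellPoint R Z s t θ)) w =
        inner ℝ (shellS Rs Zs s t θ) w := by
    intro s t θ ht w
    have htδ : t ∈ Ioo (-δ) δ := ⟨by linarith [h.pos, ht.1], ht.2.trans hε.2⟩
    have hcyl : cyl (shellPoint R Z s t θ) = collarMap R Z (s, t) :=
      cyl_rotPoint θ (h.R_pos s t).le
    have h1 : |m s| ≠ 0 := abs_ne_zero.2 (h.m_ne s)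
    have h2 := (h.regular s t htδ).ne'
    rw [hBin _ (by rw [hcyl]; exact ⟨(s, t), ⟨mem_univ _, htδ.1, ht.2⟩, rfl⟩), poloidal, hcyl,
      hb s t htδ, shellPoint, eR_rotPoint θ (q := collarMap R Z (s, t)) (h.R_pos s t)]
    simp only [PiLp.inner_apply, Fin.sum_univ_three, RCLike.inner_apply, conj_trivial]
    simp [shellS, eZ]
    field_simp
  have hred : ∀ w : E3 → E3, ∫ x in (closure (torus Ω))ᶜ, inner ℝ (Bext x) (w x) =
      ∫ p in Ioc (0 : ℝ) 1 ×ˢ (Ioc 0 ε ×ˢ Ioc 0 (2 * Real.pi)),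
        inner ℝ (shellS Rs Zs p.1 p.2.1 p.2.2) (w (shellPoint R Z p.1 p.2.1 p.2.2)) := by
    intro w
    rw [setIntegral_eq_of_subset_of_forall_sdiff_eq_zero hextm (h.shell_subset hΩ hε)
      (fun x hx => by rw [hzero x hx, inner_zero_left]), h.setIntegral_shell hε]
    have hae : (Ioc (0 : ℝ) 1 ×ˢ (Ioo 0 ε ×ˢ Ioc 0 (2 * Real.pi)) : Set (ℝ × ℝ × ℝ)) =ᵐ[volume]
        Ioc (0 : ℝ) 1 ×ˢ (Ioc 0 ε ×ˢ Ioc 0 (2 * Real.pi)) :=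
      Measure.set_prod_ae_eq (ae_eq_refl _) (Measure.set_prod_ae_eq Ioo_ae_eq_Ioc (ae_eq_refl _))
    rw [← setIntegral_congr_set hae, ← setIntegral_congr_set hae]
    refine setIntegral_congr_fun
      (measurableSet_Ioc.prod (measurableSet_Ioo.prod measurableSet_Ioc)) fun p hp => ?_
    exact hBshell p.1 p.2.1 p.2.2 hp.2.1 _
  refine ⟨j, Bext, ⟨?_, ?_, ?_, ?_, ?_, ?_⟩, ?_⟩
  · rintro _ ⟨s, rfl⟩
    exact (hjc s ε hεδ).continuousWithinAt
  · rintro x ⟨hxT, hxΓ⟩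
    refine ContinuousAt.continuousWithinAt ?_
    by_cases hxW : cyl x ∈ W
    · have hx := hxW
      obtain ⟨⟨s, t⟩, ⟨_, ht⟩, hst⟩ := hx
      refine (hpc x s t ⟨ht.1, ht.2.trans hε.2⟩ hst.symm).congr ?_
      filter_upwards [(isOpen_torus hWo).mem_nhds hxW] with y hy
      exact (hBin y hy).symm
    · have hnc : cyl x ∉ closure (enlarge Ω R Z δ ε) := by
        intro hc
        rw [hcs.closure_eq] at hc
        rcases hc with (hc | hc) | hc
        · exact hxT hc
        · exact hxW hc
        · exact hxΓ hc
      refine (continuousAt_const (y := (0 : E3))).congr ?_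
      filter_upwards [(isOpen_torus (isClosed_closure (s := enlarge Ω R Z δ ε)).isOpen_compl).mem_nhds
        hnc] with y hy
      exact (hBout y fun hyW => hy (subset_closure (hWsub hyW))).symm
  · refine IntegrableOn.locallyIntegrableOn ?_
    have hcomp : IntegrableOn (poloidal b) (torus (collarMap R Z '' (univ ×ˢ Icc 0 ε))) := by
      refine ContinuousOn.integrableOn_compact
        (isCompact_torus (h.isCompact_image (by linarith [h.pos]) hε.2)) ?_
      rintro x ⟨⟨s, t⟩, ⟨_, ht⟩, hst⟩
      exact (hpc x s t ⟨by linarith [h.pos, ht.1], ht.2.trans_lt hε.2⟩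
        hst.symm).continuousWithinAt
    have hsh : IntegrableOn Bext (shell R Z ε) := by
      refine (hcomp.mono_set ?_).congr_fun (fun x hx => (hBin x (hshellW x hx)).symm) hshellm
      rintro x ⟨⟨s, t⟩, ⟨_, ht⟩, hst⟩
      exact ⟨(s, t), ⟨mem_univ _, ht.1.le, ht.2.le⟩, hst⟩
    exact hsh.of_forall_sdiff_eq_zero hextm hzero
  · intro v hv _ hsupp
    have hv0 : ∀ s θ, v (shellPoint R Z s 0 θ) = 0 := by
      intro s θ
      by_contra hne
      refine hsupp (subset_tsupport v hne) ?_
      rw [closure_torus hΩ.off_axis]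
      show cyl (rotPoint θ (collarMap R Z (s, 0))) ∈ closure Ω
      rw [cyl_rotPoint θ (q := collarMap R Z (s, 0)) (h.R_pos s 0).le, h.collarMap_zero]
      exact hΩ.range_subset_closure (mem_range_self s)
    rw [hred, h.integral_inner_shellS_curl hε hv hv0, sheetIntegral]
    refine intervalIntegral.integral_congr fun s _ => ?_
    refine intervalIntegral.integral_congr fun θ _ => ?_
    have h1 : Real.sqrt (Rs s ε ^ 2 + Zs s ε ^ 2) ≠ 0 := (Real.sqrt_pos.2 (h.regular s ε hεδ)).ne'
    simp only
    rw [hj s ε hεδ, ePhi_rotPoint θ (q := collarMap R Z (s, ε)) (h.R_pos s ε),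
      h.norm_deriv_collarMap hεδ s]
    have h2 : shellTheta R s ε θ = (collarMap R Z (s, ε) 0) • !₂[-Real.sin θ, Real.cos θ, 0] := by
      ext i
      fin_cases i <;> simp [shellTheta, collarMap]
    rw [h2, inner_smul_right, real_inner_comm]
    show m s * (_ * inner ℝ _ (v (rotPoint θ (collarMap R Z (s, ε))))) = _
    field_simp
  · intro η hη _ _
    rw [hred, h.integral_inner_shellS_gradient hε hη]
  · refine (tendsto_const_nhds (x := (0 : E3))).congr' ?_
    have hK : IsCompact (torus (closure (enlarge Ω R Z δ ε))) :=
      isCompact_torus hcs.isBounded.isCompact_closure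
    filter_upwards [hK.compl_mem_cocompact] with x hx
    exact (hBout x fun hxW => hx (subset_closure (hWsub hxW))).symm
  · intro x s hx
    have h0 : (0 : ℝ) ∈ Ioo (-δ) δ := ⟨by linarith [h.pos], h.pos⟩
    have hx' : cyl x = collarMap R Z (s, 0) := by rw [hx, h.collarMap_zero]
    rw [hBin x (by rw [hx']; exact ⟨(s, 0), ⟨mem_univ _, h0.1, hε.1⟩, rfl⟩), poloidal, hx', hb s 0 h0]

end ExternalField

end AxiMHD

namespace AxiMHD

section BoundaryPressure

theorem hasFDerivAt_radius {x : E3} (hx : 0 < radius x) :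
    HasFDerivAt radius ((radius x)⁻¹ • (x 0 • (EuclideanSpace.proj 0 : E3 →L[ℝ] ℝ)
      + x 1 • (EuclideanSpace.proj 1 : E3 →L[ℝ] ℝ))) x := by
  have hp : ∀ i, HasFDerivAt (fun y : E3 => y i) (EuclideanSpace.proj i : E3 →L[ℝ] ℝ) x :=
    fun i => (EuclideanSpace.proj i : E3 →L[ℝ] ℝ).hasFDerivAt
  have hne : x 0 ^ 2 + x 1 ^ 2 ≠ 0 := by rw [← radius_sq]; positivity
  have hsq : HasFDerivAt (fun y : E3 => y 0 ^ 2 + y 1 ^ 2) _ x :=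
    ((hp 0).pow 2).add ((hp 1).pow 2)
  refine (hsq.sqrt hne).congr_fderiv ?_
  have hr : Real.sqrt (x 0 ^ 2 + x 1 ^ 2) = radius x := rfl
  ext v
  simp [hr]
  field_simp

theorem gradient_comp_cyl {f : E2 → ℝ} {x : E3} (hx : 0 < radius x)
    (hf : DifferentiableAt ℝ f (cyl x)) :
    ∇ (fun y => f (cyl y)) x =
      (fderiv ℝ f (cyl x) (EuclideanSpace.single 0 1)) • eR x
        + (fderiv ℝ f (cyl x) (EuclideanSpace.single 1 1)) • eZ := by
  have hcyl : HasFDerivAt cyl (prodEquivE2.toContinuousLinearMap ∘L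
      (((radius x)⁻¹ • (x 0 • (EuclideanSpace.proj 0 : E3 →L[ℝ] ℝ)
      + x 1 • (EuclideanSpace.proj 1 : E3 →L[ℝ] ℝ))).prod (EuclideanSpace.proj 2))) x := by
    have h1 : cyl = fun y => prodEquivE2 (radius y, y 2) := by
      funext y
      rw [prodEquivE2_apply]
      rfl
    rw [h1]
    exact prodEquivE2.toContinuousLinearMap.hasFDerivAt.comp x
      ((hasFDerivAt_radius hx).prodMk (EuclideanSpace.proj 2 : E3 →L[ℝ] ℝ).hasFDerivAt)
  have hcomp := hf.hasFDerivAt.comp x hcyl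
  refine ext_inner_right ℝ fun v => ?_
  rw [inner_gradient_left]
  have h2 : fderiv ℝ (fun y => f (cyl y)) x = _ := hcomp.fderiv
  rw [h2]
  simp only [ContinuousLinearMap.comp_apply]
  have h3 : ∀ a b : ℝ, (!₂[a, b] : E2)
      = a • EuclideanSpace.single 0 1 + b • EuclideanSpace.single 1 1 := by
    intro a b
    ext i
    fin_cases i <;> simp
  have h4 : ∀ p : ℝ × ℝ, prodEquivE2.toContinuousLinearMap p = !₂[p.1, p.2] := prodEquivE2_apply
  rw [h4, h3, map_add, map_smul, map_smul]
  simp only [PiLp.inner_apply, Fin.sum_univ_three, RCLike.inner_apply, conj_trivial]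
  simp [eR, eZ]
  ring

/-- The norm of `r⁻¹ c e_φ + r⁻¹ e_φ × (a e_r + b e_z)`. -/
theorem norm_sq_toroidal_add_poloidal {x : E3} (hx : 0 < radius x) (a b c : ℝ) :
    ‖((radius x)⁻¹ * c) • ePhi x + (radius x)⁻¹ • cross (ePhi x) (a • eR x + b • eZ)‖ ^ 2
      = (c ^ 2 + a ^ 2 + b ^ 2) / radius x ^ 2 := by
  obtain ⟨θ, _, hθ⟩ := exists_rotPoint_eq x
  have h1 : ePhi x = !₂[-Real.sin θ, Real.cos θ, 0] := by
    rw [← ePhi_rotPoint θ (q := cyl x) hx, hθ]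
  have h2 : eR x = !₂[Real.cos θ, Real.sin θ, 0] := by
    rw [← eR_rotPoint θ (q := cyl x) hx, hθ]
  have h3 : cross (ePhi x) (a • eR x + b • eZ) = !₂[Real.cos θ * b, Real.sin θ * b, -a] := by
    rw [h1, h2]
    ext i
    fin_cases i
    · simp [cross, cross_apply, eZ]
    · simp [cross, cross_apply, eZ]
    · simp [cross, cross_apply, eZ]
      linear_combination -a * Real.cos_sq_add_sin_sq θ
  rw [h3, h1, EuclideanSpace.real_norm_sq_eq, Fin.sum_univ_three]
  simp
  field_simp
  linear_combination (b ^ 2 + c ^ 2) * Real.cos_sq_add_sin_sq θ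

theorem sq_fderiv_normal2 {A : E2 → ℝ} {γ : ℝ → E2} {s : ℝ} (hA : DifferentiableAt ℝ A (γ s))
    (hγ : DifferentiableAt ℝ γ s) (hreg : deriv γ s ≠ 0) (hzero : ∀ s, A (γ s) = 0) :
    |fderiv ℝ A (γ s) (normal2 γ s)| ^ 2 = fderiv ℝ A (γ s) (EuclideanSpace.single 0 1) ^ 2
      + fderiv ℝ A (γ s) (EuclideanSpace.single 1 1) ^ 2 := by
  set L := fderiv ℝ A (γ s)
  have h3 : ∀ w : E2, L w
      = w 0 * L (EuclideanSpace.single 0 1) + w 1 * L (EuclideanSpace.single 1 1) := by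
    intro w
    have : w = w 0 • EuclideanSpace.single 0 1 + w 1 • EuclideanSpace.single 1 1 := by
      ext i
      fin_cases i <;> simp
    conv_lhs => rw [this]
    simp
  have htan : L (deriv γ s) = 0 := by
    have h1 : HasDerivAt (fun s => A (γ s)) (L (deriv γ s)) s :=
      hA.hasFDerivAt.comp_hasDerivAt s hγ.hasDerivAt
    have h2 : (fun s => A (γ s)) = fun _ => (0 : ℝ) := funext hzero
    rw [h2] at h1
    exact h1.unique (hasDerivAt_const s 0)
  rw [h3] at htan
  have hn : ‖deriv γ s‖ ^ 2 = deriv γ s 0 ^ 2 + deriv γ s 1 ^ 2 := by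
    rw [EuclideanSpace.real_norm_sq_eq, Fin.sum_univ_two]
  have hn0 : ‖deriv γ s‖ ≠ 0 := norm_ne_zero_iff.2 hreg
  rw [sq_abs, h3]
  simp only [normal2, PiLp.smul_apply, smul_eq_mul, Matrix.cons_val_zero,
    Matrix.cons_val_one]
  field_simp
  rw [hn]
  set a := L (EuclideanSpace.single 0 1)
  set b := L (EuclideanSpace.single 1 1)
  linear_combination (-(deriv γ s 0 * a + deriv γ s 1 * b)) * htan

/-- The pressure on the boundary. -/
theorem boundary_pressure {n : WithTop ℕ∞} {Ω : Set E2} {γ : ℝ → E2}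
    (hΩ : IsCrossSection n Ω γ) (hn : n ≠ 0) {u B : E3 → E3} {p : E3 → ℝ} {A : E2 → ℝ}
    {C F G P : ℝ → ℝ} (hform : HasGradShafranovForm Ω A C F G P u B p) {x : E3} {s : ℝ}
    (hx : cyl x = γ s) :
    p x = bigH C F G P 0 (γ s 0) + (1 - |deriv G 0| ^ 2) *
      |fderiv ℝ A (γ s) (normal2 γ s)| ^ 2 / (2 * γ s 0 ^ 2) := by
  have hcl : γ s ∈ closure Ω := hΩ.range_subset_closure (mem_range_self s)
  have hxc : x ∈ closure (torus Ω) := by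
    rw [closure_torus hΩ.off_axis]
    show cyl x ∈ closure Ω
    rwa [hx]
  have hrad : radius x = γ s 0 := by rw [← cyl_zero, hx]
  have hr : 0 < radius x := by rw [hrad]; exact hΩ.off_axis _ hcl
  have hA0 : ∀ s, A (γ s) = 0 := fun s =>
    hform.boundary_A _ (hΩ.frontier_eq ▸ mem_range_self s)
  have hAd : DifferentiableAt ℝ A (γ s) := (hform.analytic_A _ hcl).differentiableAt
  have hGd : DifferentiableAt ℝ G (A (γ s)) := hform.differentiable_G _ hcl
  have hGA : fderiv ℝ (fun q => G (A q)) (γ s) = deriv G 0 • fderiv ℝ A (γ s) := by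
    have := hGd.hasDerivAt.comp_hasFDerivAt (γ s) hAd.hasFDerivAt
    rw [hA0] at this
    exact this.fderiv
  have hGAd : DifferentiableAt ℝ (fun q => G (A q)) (γ s) := hGd.comp (γ s) hAd
  have hB := hform.form_B x hxc
  have hu := hform.form_u x hxc
  have hbern := hform.bernoulli x hxc
  rw [gradient_comp_cyl hr (by rwa [hx])] at hB
  rw [gradient_comp_cyl (f := fun q => G (A q)) hr (by rwa [hx])] at hu
  have hB2 := (congrArg (‖·‖ ^ 2) hB).trans (norm_sq_toroidal_add_poloidal hr _ _ _)
  have hu2 := (congrArg (‖·‖ ^ 2) hu).trans (norm_sq_toroidal_add_poloidal hr _ _ _)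
  rw [hx, hA0] at hbern hB2 hu2
  rw [hGA] at hu2
  rw [sq_fderiv_normal2 hAd (hΩ.contDiff.differentiable hn s) (hΩ.regular s) hA0, sq_abs]
  rw [hB2, hu2] at hbern
  simp only [smul_apply, smul_eq_mul] at hbern
  unfold bigH
  rw [hrad] at hbern hr
  have hne := hr.ne'
  rw [← hbern]
  field_simp
  ring

end BoundaryPressure

section Main

theorem analyticAt_rotPoint (θ : ℝ) (q : E2) : AnalyticAt ℝ (rotPoint θ) q := by
  have hp : ∀ i, AnalyticAt ℝ (fun q : E2 => q i) q := fun i =>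
    (EuclideanSpace.proj i : E2 →L[ℝ] ℝ).analyticAt q
  have h : AnalyticAt ℝ (fun q : E2 => ![q 0 * Real.cos θ, q 0 * Real.sin θ, q 1]) q := by
    rw [analyticAt_pi_iff]
    intro i
    fin_cases i
    · exact (hp 0).mul analyticAt_const
    · exact (hp 0).mul analyticAt_const
    · exact hp 1
  exact ((PiLp.continuousLinearEquiv 2 ℝ
    fun _ : Fin 3 => ℝ).symm.toContinuousLinearMap.analyticAt _).comp h

theorem IsHodograph.deriv_eq {γ : ℝ → E2} {m : ℝ → ℝ} {δ : ℝ} {R Z Rs Zs : ℝ → ℝ → ℝ}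
    (h : IsHodograph γ m δ R Z Rs Zs) (s : ℝ) : deriv γ s = !₂[Rs s 0, Zs s 0] := by
  have h0 : (0 : ℝ) ∈ Ioo (-δ) δ := ⟨by linarith [h.pos], h.pos⟩
  have := (h.hasDerivAt_collarMap h0 s).deriv
  simpa only [h.collarMap_zero] using this

/-- An outer collar whose `m` matches the boundary pressure provides a free boundary
equilibrium. -/
theorem IsOuterCollar.exists_equilibrium {n : WithTop ℕ∞} {Ω : Set E2} {γ : ℝ → E2} {m : ℝ → ℝ}
    {δ : ℝ} {R Z Rs Zs : ℝ → ℝ → ℝ} (h : IsOuterCollar Ω γ m δ R Z Rs Zs)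
    (hΩ : IsCrossSection n Ω γ) {u B : E3 → E3} {p : E3 → ℝ}
    (hsol : IsAnalyticFixedBoundarySolution Ω γ u B p)
    (hp : ∀ x s, cyl x = γ s → m s ^ 2 = 2 * p x * ‖deriv γ s‖ ^ 2) :
    ∃ (Ω' : Set E2) (Γ : ℝ → E2) (j : E2 → ℝ) (Bext : E3 → E3),
      IsCrossSection ∞ Ω' Γ ∧ closure Ω ⊆ Ω' ∧
      IsFieldOfToroidalSheet (torus Ω) Γ j Bext ∧
      IsFreeBoundaryEquilibrium Ω γ u B p Bext := by
  have hε : δ / 2 ∈ Ioo 0 δ := ⟨by linarith [h.pos], by linarith [h.pos]⟩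
  obtain ⟨j, Bext, hfield, hbd⟩ := h.exists_field hΩ hε
  refine ⟨_, _, j, Bext, h.isCrossSection_enlarge hΩ hε, h.closure_subset_enlarge hΩ hε, hfield,
    hsol.steady, ?_, hsol.tangent_B, ?_, hsol.tangent_u⟩
  all_goals
    have h0 : (0 : ℝ) ∈ Ioo (-δ) δ := ⟨by linarith [h.pos], h.pos⟩
    have hfr : ∀ x ∈ frontier (torus Ω), cyl x ∈ range γ := by
      intro x hx
      rw [frontier_torus hΩ.isOpen hΩ.off_axis] at hx
      exact hΩ.frontier_eq ▸ hx
    have hrad : ∀ x ∈ frontier (torus Ω), 0 < radius x := fun x hx =>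
      hΩ.off_axis (cyl x) (hΩ.range_subset_closure (hfr x hx))
  · intro x hx
    obtain ⟨s, hs⟩ := hfr x hx
    have hN := (h.regular s 0 h0).ne'
    have hpx := hp x s hs.symm
    have hnorm : ‖deriv γ s‖ ^ 2 = Rs s 0 ^ 2 + Zs s 0 ^ 2 := by
      rw [h.deriv_eq, EuclideanSpace.real_norm_sq_eq, Fin.sum_univ_two]
      rfl
    rw [hnorm] at hpx
    rw [hbd x s hs.symm, norm_sq_frame (hrad x hx)]
    have h1 : (|m s| / (Rs s 0 ^ 2 + Zs s 0 ^ 2) * Rs s 0) ^ 2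
        + (|m s| / (Rs s 0 ^ 2 + Zs s 0 ^ 2) * Zs s 0) ^ 2
        = m s ^ 2 / (Rs s 0 ^ 2 + Zs s 0 ^ 2) := by
      rw [mul_pow, mul_pow, div_pow, sq_abs]
      field_simp
    rw [h1, hpx]
    field_simp
  · intro x hx s hs
    rw [hbd x s hs, normal3, inner_frame (hrad x hx)]
    simp only [normal2, h.deriv_eq, PiLp.smul_apply, smul_eq_mul, PiLp.toLp_apply,
      Matrix.cons_val_zero, Matrix.cons_val_one]
    ring

end Main

end AxiMHD

theorem theorem3p6
    (Ω : Set AxiMHD.E2) (γ : ℝ → AxiMHD.E2)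
    (hΩ : AxiMHD.IsCrossSection ω Ω γ) (hsc : SimplyConnectedSpace Ω)
    (u B : AxiMHD.E3 → AxiMHD.E3) (p : AxiMHD.E3 → ℝ)
    (hsol : AxiMHD.IsAnalyticFixedBoundarySolution Ω γ u B p)
    (A : AxiMHD.E2 → ℝ) (C F G P : ℝ → ℝ)
    (hform : AxiMHD.HasGradShafranovForm Ω A C F G P u B p)
    (hcond : ∀ s : ℝ,
      (1 - |deriv G 0| ^ 2) * |fderiv ℝ A (γ s) (AxiMHD.normal2 γ s)| ^ 2
        > -2 * (γ s 0) ^ 2 * AxiMHD.bigH C F G P 0 (γ s 0)) :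
    ∃ (Ω' : Set AxiMHD.E2) (Γ : ℝ → AxiMHD.E2) (j : AxiMHD.E2 → ℝ)
      (Bext : AxiMHD.E3 → AxiMHD.E3),
      AxiMHD.IsCrossSection ∞ Ω' Γ ∧ closure Ω ⊆ Ω' ∧
      AxiMHD.IsFieldOfToroidalSheet (AxiMHD.torus Ω) Γ j Bext ∧
      AxiMHD.IsFreeBoundaryEquilibrium Ω γ u B p Bext := by
  have hγa : ∀ s, AnalyticAt ℝ γ s := fun s => hΩ.contDiff.contDiffAt.analyticAt
  have hγd : Differentiable ℝ γ := fun s => (hγa s).differentiableAt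
  have hpos : ∀ s, 0 < γ s 0 := fun s =>
    hΩ.off_axis _ (hΩ.range_subset_closure (mem_range_self s))
  have hcyl : ∀ s, AxiMHD.cyl (AxiMHD.rotPoint 0 (γ s)) = γ s := fun s =>
    AxiMHD.cyl_rotPoint 0 (hpos s).le
  have hpeq : ∀ x s, AxiMHD.cyl x = γ s → p x = p (AxiMHD.rotPoint 0 (γ s)) := by
    intro x s hx
    rw [AxiMHD.boundary_pressure hΩ (by simp) hform hx,
      AxiMHD.boundary_pressure hΩ (by simp) hform (hcyl s)]
  have hppos : ∀ s, 0 < p (AxiMHD.rotPoint 0 (γ s)) := by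
    intro s
    rw [AxiMHD.boundary_pressure hΩ (by simp) hform (hcyl s)]
    have h1 := hcond s
    have h2 := hpos s
    have h3 : 0 < 2 * γ s 0 ^ 2 := by positivity
    have h4 : -AxiMHD.bigH C F G P 0 (γ s 0) < (1 - |deriv G 0| ^ 2) *
        |fderiv ℝ A (γ s) (AxiMHD.normal2 γ s)| ^ 2 / (2 * γ s 0 ^ 2) := by
      rw [lt_div_iff₀ h3]
      linarith
    linarith
  set w : ℝ → ℝ := fun s => 2 * p (AxiMHD.rotPoint 0 (γ s)) *
    (deriv γ s 0 ^ 2 + deriv γ s 1 ^ 2) with hw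
  have hnorm : ∀ s, ‖deriv γ s‖ ^ 2 = deriv γ s 0 ^ 2 + deriv γ s 1 ^ 2 := fun s => by
    rw [EuclideanSpace.real_norm_sq_eq, Fin.sum_univ_two]
  have hwpos : ∀ s, 0 < w s := by
    intro s
    have h1 := hppos s
    have h2 : 0 < ‖deriv γ s‖ := norm_pos_iff.2 (hΩ.regular s)
    simp only [hw]
    rw [← hnorm]
    positivity
  have hwa : ∀ s, AnalyticAt ℝ w s := by
    intro s
    have h1 : AnalyticAt ℝ p (AxiMHD.rotPoint 0 (γ s)) := by
      refine hsol.analytic_p _ ?_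
      rw [AxiMHD.closure_torus hΩ.off_axis]
      show AxiMHD.cyl _ ∈ closure Ω
      rw [hcyl]
      exact hΩ.range_subset_closure (mem_range_self s)
    have hrot : AnalyticAt ℝ (fun s => AxiMHD.rotPoint 0 (γ s)) s :=
      AnalyticAt.fun_comp (g := AxiMHD.rotPoint 0) (AxiMHD.analyticAt_rotPoint 0 _) (hγa s)
    have h2 : AnalyticAt ℝ (fun s => p (AxiMHD.rotPoint 0 (γ s))) s :=
      AnalyticAt.fun_comp (g := p) h1 hrot
    have h3 : ∀ i, AnalyticAt ℝ (fun s => deriv γ s i) s := fun i =>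
      ((EuclideanSpace.proj i : AxiMHD.E2 →L[ℝ] ℝ).analyticAt _).comp (hγa s).deriv
    exact (analyticAt_const.mul h2).mul (((h3 0).pow 2).add ((h3 1).pow 2))
  have hperd : Function.Periodic (deriv γ) 1 := by
    intro s
    rw [← deriv_comp_add_const]
    congr 1
    funext y
    exact hΩ.periodic y
  have hma : ∀ s, AnalyticAt ℝ (fun s => Real.sqrt (w s)) s := fun s =>
    ((hwa s).contDiffAt.sqrt (hwpos s).ne').analyticAt
  have hmper : Function.Periodic (fun s => Real.sqrt (w s)) 1 := by
    intro s
    simp only [hw, hΩ.periodic s, hperd s]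
  obtain ⟨δ₀, R, Z, Rs, Zs, hh⟩ := AxiMHD.exists_isHodograph hγa hΩ.periodic hpos hma hmper
    fun s => (Real.sqrt_pos.2 (hwpos s)).ne'
  obtain ⟨δ, hc⟩ := hh.exists_isCollar hΩ.periodic hΩ.injOn hΩ.regular hγd
  have hm2 : ∀ x s, AxiMHD.cyl x = γ s → Real.sqrt (w s) ^ 2 = 2 * p x * ‖deriv γ s‖ ^ 2 := by
    intro x s hx
    rw [Real.sq_sqrt (hwpos s).le, hpeq x s hx, hnorm]
  rcases hc.exists_isOuterCollar hΩ with ho | ho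
  · exact ho.exists_equilibrium hΩ hsol hm2
  · exact ho.exists_equilibrium hΩ hsol fun x s hx => by rw [neg_sq]; exact hm2 x s hx
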